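/- **Setting.** Let $H$ be a complex Hilbert space, $\mathcal A\subseteq B(H)$ a C*-algebra containing $I$, $A\subseteq\mathcal A$ a dense unital $*$-subalgebra and $D$ an unbounded self-adjoint operator on $H$ such that $(A,H,D)$ is a spectral triple: $(I+D^2)^{-1}$ is compact, and for every $a\in A$ the commutator $[D,a]=Da-aD$, with its natural domain $\mathrm{dom}([D,a])=\{x\in\mathrm{dom}\,D : ax\in\mathrm{dom}\,D\}$, is densely defined and bounded. Let $P\in B(H)$ be an orthogonal projection such that $((A,H,D),P)$ is of Toeplitz type, i.e. - $P$ commutes with $D$, and $Pa-aP$ is compact for all $a\in\mathcal A$; - $\varphi(a):=Pa|_{PH}+C(PH)$ is injective from $\mathcal A$ into the Calkin algebra $B(PH)/C(PH)$, where $C(PH)$ denotes the compact operators on $PH$; - for all $a\in A$ the commutators $[PD,a]$ and $[(I-P)D,a]$ are bounded, and for all $a,b\in A$ the common domain $\mathrm{dom}([D,a])\cap\mathrm{dom}([D,b])$ intersects $PH$ and $(I-P)H$ in dense subspaces of $PH$ and $(I-P)H$ respectively (this density is automatic if $A$ preserves $\mathrm{dom}\,D$); - $D_p:=D|_{PH}$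 has trivial kernel. Put also $D_q:=D|_{(I-P)H}$. Put $T(a)=Pa|_{PH}$, let $\kappa$ be the quotient map $B(PH)\to B(PH)/C(PH)$, and for $t\in T(\mathcal A)+C(PH)$ let $\rho(t)=\varphi^{-1}(\kappa(t))\in\mathcal A$ and $\pi(t)=t\oplus\rho(t)$ on $K=PH\oplus H$. Let $A_c$ be the set of all $k\in C(PH)$ for which $D_pk$ and $kD_p$ are bounded. For $\alpha,\beta>0$ let $D_{\alpha,\beta}$ be the operator on $K=PH\oplus PH\oplus(I-P)H$ with matrix $$\begin{pmatrix}0&\beta D_p&0\\ \beta D_p&\tfrac1\alpha D_p&0\\0&0&\tfrac1\alpha D_q\end{pmatrix}.$$ Consider the order-unit spaces (ordered as self-adjoint operators, with order unit $I$) and functions - $A_{\mathcal A}=\{a\in A: a=a^*\}$ with $L_{\mathcal A}(a)=\|[D,a]\|$; - $A_{\mathcal C}=\{k+\lambda I: k=k^*\in A_c,\ \lambda\in\mathbb R\}$ with $L_{\mathcal C}(k+\lambda I)=\|D_pk\|$; - $A_{\mathcal T}=\{t=T(a)+k: a\in A,\ k\in A_c,\ t=t^*\}$ with $L_{\alpha,\beta}(t)=\|[D_{\alpha,\beta},\pi(t)]\|$.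 For a function $L$ on an order-unit space $E$ put $\rho_L(\mu,\nu)=\sup\{|\mu(x)-\nu(x)| : L(x)\le 1\}$ on the state space $S(E)$. $L$ is a Lip-norm if it is a seminorm with null space $\mathbb R e$ ($e$ the order unit) and the $\rho_L$-topology on $S(E)$ is the weak* topology; $(E,L)$ is then a compact quantum metric space. The quantum Gromov–Hausdorff distance $\mathrm{dist}_q((E,L_E),(F,L_F))$ is the infimum of the Hausdorff distances between $S(E)$ and $S(F)$ in $(S(E\oplus F),\rho_L)$ over all Lip-norms $L$ on $E\oplus F$ which induce $L_E$ and $L_F$ as quotient seminorms. Let $\mathrm{diam}_{\mathcal A}$ and $\mathrm{diam}_{C}$ be the diameters of the state spaces of $(A_{\mathcal A},L_{\mathcal A})$ and $(A_{\mathcal C},L_{\mathcal C})$. **Theorem.** Suppose that $L_{\mathcal A}$ is a Lip-norm, and let $\beta>0$. For every $\alpha>0$ with $\alpha\beta\le 1$, $(A_{\mathcal T},L_{\alpha,\beta})$ and $(A_{\mathcal C},\beta L_{\mathcal C})$ are compact quantum metric spaces and $$\mathrm{dist}_q\big((A_{\mathcal T},L_{\alpha,\beta}),\,(A_{\mathcal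 C},\beta L_{\mathcal C})\big)\ \le\ \alpha\,(\mathrm{diam}_{\mathcal A}+\mathrm{diam}_{C}).$$ In particular, for fixed $\beta>0$, $\mathrm{dist}_q\big((A_{\mathcal T},L_{\alpha,\beta}),(A_{\mathcal C},\beta L_{\mathcal C})\big)\to 0$ as $\alpha\to 0^+$. -/

import Mathlib

open Filter Topology
open scoped ENNReal

noncomputable section

/-! ### Order-unit spaces, states, Lip-norms, quantum Gromov–Hausdorff distance -/

/-- An order-unit space: a real partially ordered vector space with a distinguished element
`orderUnit` which has the order unit property and the Archimedean property. -/
class OrderUnitSpace (E : Type*) [AddCommGroup E] [Module ℝ E] [PartialOrder E] where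
  orderUnit : E
  add_le_add_left' : ∀ a b : E, a ≤ b → ∀ c : E, c + a ≤ c + b
  smul_nonneg' : ∀ (r : ℝ) (a : E), 0 ≤ r → 0 ≤ a → 0 ≤ r • a
  orderUnit_nonneg : 0 ≤ orderUnit
  exists_le_smul : ∀ a : E, ∃ r : ℝ, a ≤ r • orderUnit
  archimedean : ∀ a : E, (∀ r : ℝ, 0 < r → a ≤ r • orderUnit) → a ≤ 0

namespace OrderUnitSpace

theorem smul_unit_mono {E : Type*} [AddCommGroup E] [Module ℝ E] [PartialOrder E]
    [OrderUnitSpace E] {r s : ℝ} (h : r ≤ s) :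
    r • (orderUnit : E) ≤ s • (orderUnit : E) := by
  have h' := add_le_add_left' _ _
    (smul_nonneg' (s - r) (orderUnit : E) (sub_nonneg.2 h) orderUnit_nonneg)
    (r • (orderUnit : E))
  rwa [add_zero, ← add_smul, add_sub_cancel] at h'

/-- The direct sum of two order-unit spaces, with order unit `(e, e')`. -/
instance prod (E F : Type*) [AddCommGroup E] [Module ℝ E] [PartialOrder E] [OrderUnitSpace E]
    [AddCommGroup F] [Module ℝ F] [PartialOrder F] [OrderUnitSpace F] :
    OrderUnitSpace (E × F) where
  orderUnit := (orderUnit, orderUnit)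
  add_le_add_left' a b h c :=
    ⟨add_le_add_left' a.1 b.1 h.1 c.1, add_le_add_left' a.2 b.2 h.2 c.2⟩
  smul_nonneg' r a hr ha := ⟨smul_nonneg' r a.1 hr ha.1, smul_nonneg' r a.2 hr ha.2⟩
  orderUnit_nonneg := ⟨orderUnit_nonneg, orderUnit_nonneg⟩
  exists_le_smul a := by
    obtain ⟨r, hr⟩ := exists_le_smul a.1
    obtain ⟨s, hs⟩ := exists_le_smul a.2
    exact ⟨max r s, hr.trans (smul_unit_mono (le_max_left r s)),
      hs.trans (smul_unit_mono (le_max_right r s))⟩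
  archimedean a h :=
    ⟨archimedean a.1 fun r hr => (h r hr).1, archimedean a.2 fun r hr => (h r hr).2⟩

variable (E : Type*) [AddCommGroup E] [Module ℝ E] [PartialOrder E] [OrderUnitSpace E]

variable {E} in
/-- The norm `‖a‖ = inf {r | -r e ≤ a ≤ r e}` of an order-unit space. -/
def ouNorm (a : E) : ℝ :=
  sInf {r : ℝ | -(r • (orderUnit : E)) ≤ a ∧ a ≤ r • (orderUnit : E)}

/-- The state space: the linear functionals `μ` with `μ(e) = 1 = ‖μ‖`. (Given `μ(e) = 1`, the
condition `‖μ‖ = 1` says exactly that `|μ(a)| ≤ ‖a‖` for all `a`.) -/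
def State : Type _ :=
  {μ : E →ₗ[ℝ] ℝ // μ orderUnit = 1 ∧ ∀ a : E, |μ a| ≤ ouNorm a}

/-- The weak* topology on the state space: the topology of pointwise convergence. -/
abbrev weakStarTopology : TopologicalSpace (State E) :=
  TopologicalSpace.induced (fun (μ : State E) (a : E) => μ.1 a) inferInstance

variable {E}

/-- The distance `ρ_L(μ, ν) = sup {|μ(a) - ν(a)| | L(a) ≤ 1}`, possibly infinite. -/
def stateDist (L : E → ℝ) (μ ν : State E) : ℝ≥0∞ :=
  ⨆ (a : E) (_ : L a ≤ 1), ENNReal.ofReal |μ.1 a - ν.1 a|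

/-- The state space as an extended (pseudo)metric space under `ρ_L`. -/
abbrev stateEMetric (L : E → ℝ) : PseudoEMetricSpace (State E) where
  edist := stateDist L
  edist_self μ := by simp [stateDist]
  edist_comm μ ν := by simp only [stateDist, abs_sub_comm]
  edist_triangle μ ν η := by
    refine iSup₂_le fun a ha => ?_
    calc ENNReal.ofReal |μ.1 a - η.1 a|
        ≤ ENNReal.ofReal (|μ.1 a - ν.1 a| + |ν.1 a - η.1 a|) :=
          ENNReal.ofReal_le_ofReal (abs_sub_le _ _ _)
      _ = ENNReal.ofReal |μ.1 a - ν.1 a| + ENNReal.ofReal |ν.1 a - η.1 a| :=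
          ENNReal.ofReal_add (abs_nonneg _) (abs_nonneg _)
      _ ≤ _ := add_le_add
          (le_iSup₂ (f := fun a (_ : L a ≤ 1) => ENNReal.ofReal |μ.1 a - ν.1 a|) a ha)
          (le_iSup₂ (f := fun a (_ : L a ≤ 1) => ENNReal.ofReal |ν.1 a - η.1 a|) a ha)

/-- A Lip-norm: a seminorm `L` whose null space is `ℝ e`, and such that the topology on the state
space given by `ρ_L` is the weak* topology. -/
structure IsLipNorm (L : E → ℝ) : Prop where
  add_le : ∀ a b, L (a + b) ≤ L a + L b
  smul_eq : ∀ (r : ℝ) a, L (r • a) = |r| * L a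
  eq_zero_iff : ∀ a, L a = 0 ↔ ∃ r : ℝ, a = r • (orderUnit : E)
  topology_eq : (stateEMetric L).toUniformSpace.toTopologicalSpace = weakStarTopology E

/-- The diameter of the state space for `ρ_L`. -/
def stateDiam (L : E → ℝ) : ℝ≥0∞ := ⨆ (μ : State E) (ν : State E), stateDist L μ ν

variable {F : Type*} [AddCommGroup F] [Module ℝ F] [PartialOrder F] [OrderUnitSpace F]

variable (E F) in
/-- `S(E)` as a subset of `S(E ⊕ F)`, through the dual of the quotient map `E ⊕ F → E`. -/
def leftStates : Set (State (E × F)) :=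
  {μ | ∃ φ : State E, μ.1 = φ.1 ∘ₗ LinearMap.fst ℝ E F}

variable (E F) in
/-- `S(F)` as a subset of `S(E ⊕ F)`, through the dual of the quotient map `E ⊕ F → F`. -/
def rightStates : Set (State (E × F)) :=
  {μ | ∃ ψ : State F, μ.1 = ψ.1 ∘ₗ LinearMap.snd ℝ E F}

/-- The set `M(L₁, L₂)` of Lip-norms on `E ⊕ F` whose quotient seminorms on `E` and `F` are `L₁`
and `L₂`. -/
def admissible (L₁ : E → ℝ) (L₂ : F → ℝ) : Set (E × F → ℝ) :=
  {L | IsLipNorm L ∧ (∀ a, IsGLB (Set.range fun b => L (a, b)) (L₁ a)) ∧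
    ∀ b, IsGLB (Set.range fun a => L (a, b)) (L₂ b)}

/-- The quantum Gromov–Hausdorff distance (an infimum in `[0, ∞]`). -/
def quantumGHDist (L₁ : E → ℝ) (L₂ : F → ℝ) : ℝ≥0∞ :=
  ⨅ L ∈ admissible L₁ L₂,
    @Metric.hausdorffEDist _ (stateEMetric L) (leftStates E F) (rightStates E F)

end OrderUnitSpace

/-! ### Unbounded operators -/

section Unbounded

variable {E F G : Type*} [NormedAddCommGroup E] [InnerProductSpace ℂ E]
  [NormedAddCommGroup F] [InnerProductSpace ℂ F] [NormedAddCommGroup G] [InnerProductSpace ℂ G]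

/-- The product `T a` of an unbounded operator `T` and an everywhere defined operator `a`, with its
natural domain `{x | a x ∈ dom T}`. -/
def LinearPMap.mulRight (T : F →ₗ.[ℂ] G) (a : E →ₗ[ℂ] F) : E →ₗ.[ℂ] G where
  domain := T.domain.comap a
  toFun := T.toFun ∘ₗ (a.domRestrict (T.domain.comap a)).codRestrict T.domain fun x => x.2

/-- The commutator `[T, a] = T a - a T`, with its natural domain
`{x ∈ dom T | a x ∈ dom T}`. -/
def LinearPMap.commutator (T : E →ₗ.[ℂ] E) (a : E →L[ℂ] E) : E →ₗ.[ℂ] E :=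
  T.mulRight (a : E →ₗ[ℂ] E) - (a : E →ₗ[ℂ] E).compPMap T

/-- `T` is bounded on its domain. -/
def LinearPMap.IsBounded (T : E →ₗ.[ℂ] F) : Prop :=
  ∃ C : ℝ, ∀ x : T.domain, ‖T x‖ ≤ C * ‖(x : E)‖

/-- The norm of `T`, i.e. the least `C ≥ 0` with `‖T x‖ ≤ C ‖x‖` on the domain. If `T` is bounded and
densely defined this is the norm of its closure. -/
def LinearPMap.opNorm (T : E →ₗ.[ℂ] F) : ℝ :=
  sInf {C : ℝ | 0 ≤ C ∧ ∀ x : T.domain, ‖T x‖ ≤ C * ‖(x : E)‖}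

/-- The restriction of `D` to the closed subspace `V`, as an operator in `V` (if `D` commutes with
the projection onto `V`, then `D` maps `dom D ∩ V` to `V` and projecting has no effect). -/
def LinearPMap.restrictTo (D : E →ₗ.[ℂ] E) (V : Submodule ℂ E) [V.HasOrthogonalProjection] :
    V →ₗ.[ℂ] V :=
  (V.orthogonalProjectionOnto : E →ₗ[ℂ] V).compPMap (D.mulRight V.subtype)

end Unbounded

/-! ### Order-unit spaces of self-adjoint operators -/

/-- A real space of bounded self-adjoint operators that contains the identity is an order-unit space,
for the usual order of self-adjoint operators and with the identity as order unit. -/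
abbrev OrderUnitSpace.ofSelfAdjoint {G : Type*} [NormedAddCommGroup G] [InnerProductSpace ℂ G]
    [CompleteSpace G] (V : Submodule ℝ (G →L[ℂ] G)) (h1 : 1 ∈ V)
    (hsa : ∀ v ∈ V, IsSelfAdjoint v) : OrderUnitSpace V where
  orderUnit := ⟨1, h1⟩
  add_le_add_left' a b h c := by
    have h' : (a : G →L[ℂ] G) ≤ b := h
    show (c + a : G →L[ℂ] G) ≤ c + b
    gcongr
  smul_nonneg' r a hr ha := by
    have h' : (0 : G →L[ℂ] G) ≤ a := ha
    show (0 : G →L[ℂ] G) ≤ r • (a : G →L[ℂ] G)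
    exact smul_nonneg hr h'
  orderUnit_nonneg := by
    show (0 : G →L[ℂ] G) ≤ 1
    exact zero_le_one
  exists_le_smul a := by
    refine ⟨‖(a : G →L[ℂ] G)‖, ?_⟩
    show (a : G →L[ℂ] G) ≤ ‖(a : G →L[ℂ] G)‖ • (1 : G →L[ℂ] G)
    simpa [Algebra.algebraMap_eq_smul_one] using
      IsSelfAdjoint.le_algebraMap_norm_self (hsa a a.2)
  archimedean a h := by
    show (a : G →L[ℂ] G) ≤ 0
    refine ge_of_tendsto (x := 𝓝[>] (0 : ℝ)) (f := fun r : ℝ => r • (1 : G →L[ℂ] G)) ?_ ?_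
    · have : Tendsto (fun r : ℝ => r • (1 : G →L[ℂ] G)) (𝓝 0) (𝓝 ((0 : ℝ) • 1)) :=
        (continuous_id.smul continuous_const).tendsto 0
      rw [zero_smul] at this
      exact this.mono_left nhdsWithin_le_nhds
    · filter_upwards [self_mem_nhdsWithin] with r hr using h r hr

/-! ### Spectral triples and Toeplitz extensions -/

section Toeplitz

variable {H : Type*} [NormedAddCommGroup H] [InnerProductSpace ℂ H] [CompleteSpace H]

/-- `(A, H, D)` is a spectral triple associated to the concrete unital C*-algebra `𝒜 ⊆ B(H)`. -/
structure IsSpectralTriple (𝒜 A : StarSubalgebra ℂ (H →L[ℂ] H)) (D : H →ₗ.[ℂ] H) : Prop where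
  isClosed : IsClosed (𝒜 : Set (H →L[ℂ] H))
  le : A ≤ 𝒜
  dense : (𝒜 : Set (H →L[ℂ] H)) ⊆ closure (A : Set (H →L[ℂ] H))
  isSelfAdjoint : IsSelfAdjoint D
  commutator_dense : ∀ a ∈ A, Dense ((D.commutator a).domain : Set H)
  commutator_bounded : ∀ a ∈ A, (D.commutator a).IsBounded
  /-- `(I + D²)⁻¹` is compact: `R` is the everywhere defined inverse of the (injective) operator
  `I + D²`. -/
  compact_resolvent : ∃ R : H →L[ℂ] H, IsCompactOperator R ∧
    ∀ y : H, ∃ (h₁ : R y ∈ D.domain) (h₂ : D ⟨R y, h₁⟩ ∈ D.domain),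
      R y + D ⟨D ⟨R y, h₁⟩, h₂⟩ = y

variable (W : Submodule ℂ H) [CompleteSpace W]

/-- `T(a) = P a | PH`, where `PH = W`. -/
def toeplitzMap : (H →L[ℂ] H) →ₗ[ℂ] (W →L[ℂ] W) where
  toFun a := W.orthogonalProjectionOnto ∘L a ∘L W.subtypeL
  map_add' a b := by ext; simp
  map_smul' c a := by ext; simp

/-- The quotient map `κ` of `B(PH)` onto the Calkin algebra `B(PH) / C(PH)`. -/
def calkinMap : (W →L[ℂ] W) →ₗ[ℂ] (W →L[ℂ] W) ⧸ compactOperator (RingHom.id ℂ) W W :=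
  (compactOperator (RingHom.id ℂ) W W).mkQ

/-- `φ(a) = P a | PH + C(PH)`. -/
def symbolMap (a : H →L[ℂ] H) : (W →L[ℂ] W) ⧸ compactOperator (RingHom.id ℂ) W W :=
  calkinMap W (toeplitzMap W a)

/-- The quadruple `((A, H, D), P)` is of Toeplitz type, `P` being the projection onto `W`. -/
structure IsToeplitzQuadruple (𝒜 A : StarSubalgebra ℂ (H →L[ℂ] H)) (D : H →ₗ.[ℂ] H) : Prop
    extends IsSpectralTriple 𝒜 A D where
  /-- `P` commutes with `D`. -/
  commutes : ∀ x : D.domain, ∃ h : W.starProjection x ∈ D.domain,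
    D ⟨W.starProjection x, h⟩ = W.starProjection (D x)
  /-- `P` commutes with `𝒜` modulo the compact operators. -/
  commutes_mod_compact : ∀ a ∈ 𝒜,
    IsCompactOperator (W.starProjection ∘L a - a ∘L W.starProjection)
  /-- `φ` is faithful on `𝒜`. -/
  faithful : Set.InjOn (symbolMap W) (𝒜 : Set (H →L[ℂ] H))
  /-- `[P D, a]` is bounded. -/
  regular_left : ∀ a ∈ A,
    (((W.starProjection : H →ₗ[ℂ] H).compPMap D).commutator a).IsBounded
  /-- `[(I - P) D, a]` is bounded. -/
  regular_right : ∀ a ∈ A,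
    (((Wᗮ.starProjection : H →ₗ[ℂ] H).compPMap D).commutator a).IsBounded
  /-- The common domain of `[D, a]` and `[D, b]` meets `PH` in a dense subspace of `PH`. (The
  commutators `[P D, a]` and `[(I - P) D, a]` have the same domain as `[D, a]`.) -/
  dense_left : ∀ a ∈ A, ∀ b ∈ A,
    Dense {x : W | (x : H) ∈ (D.commutator a).domain ⊓ (D.commutator b).domain}
  /-- The common domain of `[D, a]` and `[D, b]` meets `(I - P)H` in a dense subspace. -/
  dense_right : ∀ a ∈ A, ∀ b ∈ A,
    Dense {x : Wᗮ | (x : H) ∈ (D.commutator a).domain ⊓ (D.commutator b).domain}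
  /-- `D | PH` has trivial kernel. -/
  ker_trivial : ∀ x : (D.restrictTo W).domain, D.restrictTo W x = 0 → x = 0

/-- `ρ(t) = φ⁻¹(κ(t))`. -/
def rhoMap (𝒜 : StarSubalgebra ℂ (H →L[ℂ] H)) (t : W →L[ℂ] W) : H →L[ℂ] H :=
  Function.invFunOn (symbolMap W) (𝒜 : Set (H →L[ℂ] H)) (calkinMap W t)

/-- The Hilbert space `K = PH ⊕ H`. -/
abbrev ExtSpace : Type _ := WithLp 2 (W × H)

/-- The representation `π(t) = t ⊕ ρ(t)` on `K`. -/
def piMap (𝒜 : StarSubalgebra ℂ (H →L[ℂ] H)) (t : W →L[ℂ] W) : ExtSpace W →L[ℂ] ExtSpace W :=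
  ((WithLp.prodContinuousLinearEquiv 2 ℂ W H).symm : W × H →L[ℂ] ExtSpace W) ∘L
    (t.prodMap (rhoMap W 𝒜 t)) ∘L
    (WithLp.prodContinuousLinearEquiv 2 ℂ W H : ExtSpace W →L[ℂ] W × H)

/-- The first coordinate map of `K = PH ⊕ PH ⊕ (I - P)H`. -/
def projOne : ExtSpace W →ₗ[ℂ] W :=
  LinearMap.fst ℂ W H ∘ₗ (WithLp.linearEquiv 2 ℂ (W × H)).toLinearMap

/-- The second coordinate map of `K = PH ⊕ PH ⊕ (I - P)H`. -/
def projTwo : ExtSpace W →ₗ[ℂ] W :=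
  (W.orthogonalProjectionOnto : H →ₗ[ℂ] W) ∘ₗ LinearMap.snd ℂ W H ∘ₗ
    (WithLp.linearEquiv 2 ℂ (W × H)).toLinearMap

/-- The third coordinate map of `K = PH ⊕ PH ⊕ (I - P)H`. -/
def projThree : ExtSpace W →ₗ[ℂ] Wᗮ :=
  (Wᗮ.orthogonalProjectionOnto : H →ₗ[ℂ] Wᗮ) ∘ₗ LinearMap.snd ℂ W H ∘ₗ
    (WithLp.linearEquiv 2 ℂ (W × H)).toLinearMap

/-- The inclusion of the first summand of `K = PH ⊕ PH ⊕ (I - P)H`. -/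
def inclOne : W →ₗ[ℂ] ExtSpace W :=
  (WithLp.linearEquiv 2 ℂ (W × H)).symm.toLinearMap ∘ₗ LinearMap.inl ℂ W H

/-- The inclusion of the second summand of `K = PH ⊕ PH ⊕ (I - P)H`. -/
def inclTwo : W →ₗ[ℂ] ExtSpace W :=
  (WithLp.linearEquiv 2 ℂ (W × H)).symm.toLinearMap ∘ₗ LinearMap.inr ℂ W H ∘ₗ W.subtype

/-- The inclusion of the third summand of `K = PH ⊕ PH ⊕ (I - P)H`. -/
def inclThree : Wᗮ →ₗ[ℂ] ExtSpace W :=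
  (WithLp.linearEquiv 2 ℂ (W × H)).symm.toLinearMap ∘ₗ LinearMap.inr ℂ W H ∘ₗ Wᗮ.subtype

/-- The operator with matrix `![![0, β D_p, 0], ![β D_p, α⁻¹ D_p, 0], ![0, 0, α⁻¹ D_q]]` on
`K = PH ⊕ PH ⊕ (I - P)H`, where `D_p` and `D_q` are the restrictions of `D`. -/
def extDirac (D : H →ₗ.[ℂ] H) (α β : ℝ) : ExtSpace W →ₗ.[ℂ] ExtSpace W :=
  (inclOne W).compPMap ((β : ℂ) • (D.restrictTo W).mulRight (projTwo W)) +
  (inclTwo W).compPMap ((β : ℂ) • (D.restrictTo W).mulRight (projOne W)) +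
  (inclTwo W).compPMap (((α⁻¹ : ℝ) : ℂ) • (D.restrictTo W).mulRight (projTwo W)) +
  (inclThree W).compPMap (((α⁻¹ : ℝ) : ℂ) • (D.restrictTo Wᗮ).mulRight (projThree W))

/-- `A_c`: the compact operators `k` on `PH` for which `D_p k` and `k D_p` are bounded. (Since
`D_p` is closed, a bounded densely defined `D_p k` is everywhere defined.) -/
def compactLipAlgebra (D : H →ₗ.[ℂ] H) : Submodule ℂ (W →L[ℂ] W) where
  carrier := {k | IsCompactOperator k ∧
    ((D.restrictTo W).mulRight (k : W →ₗ[ℂ] W)).domain = ⊤ ∧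
    ((D.restrictTo W).mulRight (k : W →ₗ[ℂ] W)).IsBounded ∧
    ((k : W →ₗ[ℂ] W).compPMap (D.restrictTo W)).IsBounded}
  add_mem' := by
    rintro k l ⟨hk, dk, ⟨C, hC⟩, ⟨C', hC'⟩⟩ ⟨hl, dl, ⟨B, hB⟩, ⟨B', hB'⟩⟩
    have dk' : ∀ x, k x ∈ (D.restrictTo W).domain := fun x => by
      have : x ∈ ((D.restrictTo W).mulRight (k : W →ₗ[ℂ] W)).domain := dk ▸ Submodule.mem_top
      exact this
    have dl' : ∀ x, l x ∈ (D.restrictTo W).domain := fun x => by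
      have : x ∈ ((D.restrictTo W).mulRight (l : W →ₗ[ℂ] W)).domain := dl ▸ Submodule.mem_top
      exact this
    refine ⟨hk.add hl, ?_, ⟨C + B, fun x => ?_⟩, ⟨C' + B', fun x => ?_⟩⟩
    · exact Submodule.eq_top_iff'.2 fun x => (D.restrictTo W).domain.add_mem (dk' x) (dl' x)
    · have e : (D.restrictTo W).mulRight ((k + l : W →L[ℂ] W) : W →ₗ[ℂ] W) x =
          (D.restrictTo W) ⟨k x, dk' x⟩ + (D.restrictTo W) ⟨l x, dl' x⟩ := by
        rw [← LinearPMap.map_add]; rfl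
      rw [e, add_mul]
      exact (norm_add_le _ _).trans (add_le_add (hC ⟨x, dk' x⟩) (hB ⟨x, dl' x⟩))
    · rw [add_mul]
      exact (norm_add_le _ _).trans (add_le_add (hC' x) (hB' x))
  zero_mem' := by
    refine ⟨isCompactOperator_zero, ?_, ⟨0, fun x => ?_⟩, ⟨0, fun x => ?_⟩⟩
    · exact Submodule.eq_top_iff'.2 fun x => (D.restrictTo W).domain.zero_mem
    · have e : (D.restrictTo W).mulRight ((0 : W →L[ℂ] W) : W →ₗ[ℂ] W) x = 0 :=
        (D.restrictTo W).map_zero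
      rw [e]; simp
    · show ‖(0 : W)‖ ≤ _
      simp
  smul_mem' := by
    rintro c k ⟨hk, dk, ⟨C, hC⟩, ⟨C', hC'⟩⟩
    have dk' : ∀ x, k x ∈ (D.restrictTo W).domain := fun x => by
      have : x ∈ ((D.restrictTo W).mulRight (k : W →ₗ[ℂ] W)).domain := dk ▸ Submodule.mem_top
      exact this
    refine ⟨hk.smul c, ?_, ⟨‖c‖ * C, fun x => ?_⟩, ⟨‖c‖ * C', fun x => ?_⟩⟩
    · exact Submodule.eq_top_iff'.2 fun x => (D.restrictTo W).domain.smul_mem c (dk' x)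
    · have e : (D.restrictTo W).mulRight ((c • k : W →L[ℂ] W) : W →ₗ[ℂ] W) x =
          c • (D.restrictTo W) ⟨k x, dk' x⟩ := by
        rw [← LinearPMap.map_smul]; rfl
      rw [e, norm_smul, mul_assoc]
      exact mul_le_mul_of_nonneg_left (hC ⟨x, dk' x⟩) (norm_nonneg c)
    · have e : (((c • k : W →L[ℂ] W) : W →ₗ[ℂ] W).compPMap (D.restrictTo W)) x =
          c • ((k : W →ₗ[ℂ] W).compPMap (D.restrictTo W)) x := rfl
      rw [e, norm_smul, mul_assoc]
      exact mul_le_mul_of_nonneg_left (hC' x) (norm_nonneg c)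

/-- `A_t = {T(a) + k | a ∈ A, k ∈ A_c}`. -/
def toeplitzLipAlgebra (A : StarSubalgebra ℂ (H →L[ℂ] H)) (D : H →ₗ.[ℂ] H) :
    Submodule ℂ (W →L[ℂ] W) :=
  A.toSubalgebra.toSubmodule.map (toeplitzMap W) ⊔ compactLipAlgebra W D

/-- `A_𝒜 = {a ∈ A | a = a*}`. -/
def spaceA (A : StarSubalgebra ℂ (H →L[ℂ] H)) : Submodule ℝ (H →L[ℂ] H) :=
  A.toSubalgebra.toSubmodule.restrictScalars ℝ ⊓ selfAdjoint.submodule ℝ (H →L[ℂ] H)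

/-- The self-adjoint elements of `A_c`. -/
def compactLipSelfAdjoint (D : H →ₗ.[ℂ] H) : Submodule ℝ (W →L[ℂ] W) :=
  (compactLipAlgebra W D).restrictScalars ℝ ⊓ selfAdjoint.submodule ℝ (W →L[ℂ] W)

/-- `A_𝒞 = {k + λ I | k = k* ∈ A_c, λ ∈ ℝ}`. -/
def spaceC (D : H →ₗ.[ℂ] H) : Submodule ℝ (W →L[ℂ] W) :=
  compactLipSelfAdjoint W D ⊔ Submodule.span ℝ {1}

/-- `A_𝒯 = {t ∈ A_t | t = t*}`. -/
def spaceT (A : StarSubalgebra ℂ (H →L[ℂ] H)) (D : H →ₗ.[ℂ] H) : Submodule ℝ (W →L[ℂ] W) :=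
  (toeplitzLipAlgebra W A D).restrictScalars ℝ ⊓ selfAdjoint.submodule ℝ (W →L[ℂ] W)

instance (A : StarSubalgebra ℂ (H →L[ℂ] H)) : OrderUnitSpace (spaceA A) :=
  OrderUnitSpace.ofSelfAdjoint _ ⟨A.one_mem, IsSelfAdjoint.one _⟩ fun _ hv => hv.2

instance (D : H →ₗ.[ℂ] H) : OrderUnitSpace (spaceC W D) :=
  OrderUnitSpace.ofSelfAdjoint _
    (Submodule.mem_sup_right (Submodule.subset_span (Set.mem_singleton _))) fun v hv => by
      obtain ⟨k, hk, z, hz, rfl⟩ := Submodule.mem_sup.1 hv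
      obtain ⟨r, rfl⟩ := Submodule.mem_span_singleton.1 hz
      exact IsSelfAdjoint.add hk.2 (IsSelfAdjoint.smul (IsSelfAdjoint.all r) (IsSelfAdjoint.one _))

instance (A : StarSubalgebra ℂ (H →L[ℂ] H)) (D : H →ₗ.[ℂ] H) : OrderUnitSpace (spaceT W A D) :=
  OrderUnitSpace.ofSelfAdjoint _
    ⟨Submodule.mem_sup_left ⟨1, A.one_mem, by ext x; simp [toeplitzMap]⟩, IsSelfAdjoint.one _⟩
    fun _ hv => hv.2

/-- `L_𝒜(a) = ‖[D, a]‖`. -/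
def lipA (A : StarSubalgebra ℂ (H →L[ℂ] H)) (D : H →ₗ.[ℂ] H) (a : spaceA A) : ℝ :=
  (D.commutator (a : H →L[ℂ] H)).opNorm

/-- The component `k ∈ A_c` of an element `k + λ I` of `A_𝒞` (unique as `PH` has infinite
dimension). -/
def compactPart (D : H →ₗ.[ℂ] H) (x : spaceC W D) : W →L[ℂ] W :=
  (Submodule.mem_sup.1 x.2).choose

/-- `L_𝒞(k + λ I) = ‖D_p k‖`. -/
def lipC (D : H →ₗ.[ℂ] H) (x : spaceC W D) : ℝ :=
  ((D.restrictTo W).mulRight (compactPart W D x : W →ₗ[ℂ] W)).opNorm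

/-- `L_{α,β}(t) = ‖[D_{α,β}, π(t)]‖`. -/
def lipT (𝒜 A : StarSubalgebra ℂ (H →L[ℂ] H)) (D : H →ₗ.[ℂ] H) (α β : ℝ)
    (t : spaceT W A D) : ℝ :=
  ((extDirac W D α β).commutator (piMap W 𝒜 (t : W →L[ℂ] W))).opNorm

end Toeplitz

end

/-!
An element `t = T(a) + k` of `A_𝒯` is compared with `x = k / (1 + α β) + r I` in `A_𝒞`, where `r` is
the value of some state at `a`. Written with respect to `K = PH ⊕ H`, the commutator
`[D_{α,β}, π(t)]` has lower right entry `α⁻¹ [D, a]`, and its lower left entry, compressed to `PH`,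
is `β (P [D, a] + D k)` (`IsToeplitzQuadruple.val_commutator_extDirac`). Hence
`L_𝒜(a) ≤ α L(t)` and `β L_𝒞(k) ≤ (1 + α β) L(t)` for `L = L_{α,β}`
(`IsToeplitzQuadruple.exists_decomposition`). On `A_𝒞` itself the commutator is off-diagonal, so that
`L ≤ β L_𝒞` there (`IsToeplitzQuadruple.lipT_le_mul_lipC`).

The first bound gives `‖a - r‖ ≤ α diam_𝒜 L(t)`. For the compact part, `‖k‖ ≤ diam_C L_𝒞(k)`: compare
vector states with the functional `k + r I ↦ r`, which is a state because the Calkin norm of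
`k + r I` is `|r|` (`OrderUnitSpace.IsOperatorSpace.norm_compact_le`). Together `β L_𝒞(x) ≤ L(t)` and
`‖t - x‖ ≤ γ L(t)` with `γ = α (diam_𝒜 + diam_C)` (`OrderUnitSpace.IsExtension.exists_approx`).
For every larger `γ > 0`, then, `max (L t) (β L_𝒞 x) (‖t - x‖ / γ)` is a Lip-norm on the direct sum
with the right quotients. Restricting states from `A_𝒯` to `A_𝒞`, and extending them from `A_𝒞` to
`A_𝒯`, bounds the Hausdorff distance by `γ` (`OrderUnitSpace.quantumGHDist_le_of_bridge`).

That the seminorms are Lip-norms follows from Rieffel's criterion, total boundedness of the Lipschitz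
balls modulo scalars (`OrderUnitSpace.HasTotallyBoundedBall.isLipNorm` and its converse). For
`L_𝒞` it comes from the compact resolvent: self-adjoint operators mapping the unit ball into
`{w | ‖D w‖ ≤ 1}` form a totally bounded set (`totallyBounded_selfAdjoint_operators`). For `L` it
follows from the two bounds above.

Since `[D_{α,β}, π(s + t)]` may have a larger domain than the sum of the two commutators, the triangle
inequality for `L` needs skew-symmetry of the commutators and density of the common domains
(`LinearPMap.IsFormalAdjoint.opNorm_commutator_add_le`).
-/

noncomputable section

/-! ### Totally bounded Lipschitz balls and Lip-norms -/

/-- A set is totally bounded as soon as, for every `ε`, it is mapped onto a totally bounded set by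
some map that separates `ε`-distant points uniformly. -/
theorem totallyBounded_of_uniform_separation {X : Type*} [PseudoMetricSpace X] {s : Set X}
    (h : ∀ ε > 0, ∃ (Y : Type*) (_ : PseudoMetricSpace Y) (g : X → Y) (δ : ℝ), 0 < δ ∧
      TotallyBounded (g '' s) ∧ ∀ x ∈ s, ∀ y ∈ s, dist (g x) (g y) < δ → dist x y < ε) :
    TotallyBounded s := by
  refine Metric.totallyBounded_iff.2 fun ε hε => ?_
  obtain ⟨Y, _, g, δ, hδ, hg, hsep⟩ := h ε hε
  obtain ⟨t, hts, htf, hcov⟩ := Metric.finite_approx_of_totallyBounded hg δ hδ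
  obtain ⟨t', ht's, ht'f, hcov⟩ := (Set.exists_subset_image_finite_and
    (p := fun t => g '' s ⊆ ⋃ y ∈ t, Metric.ball y δ)).1 ⟨t, hts, htf, hcov⟩
  refine ⟨t', ht'f, fun x hx => ?_⟩
  obtain ⟨_, ⟨y, hy, rfl⟩, hxy⟩ := Set.mem_iUnion₂.1 (hcov ⟨x, hx, rfl⟩)
  exact Set.mem_iUnion₂.2 ⟨y, hy, hsep x hx y (ht's hy) hxy⟩

theorem TotallyBounded.prod_set {X Y : Type*} [PseudoMetricSpace X] [PseudoMetricSpace Y]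
    {s : Set X} {t : Set Y} (hs : TotallyBounded s) (ht : TotallyBounded t) :
    TotallyBounded (s ×ˢ t) := by
  rw [Metric.totallyBounded_iff] at *
  intro ε hε
  obtain ⟨u, hu, hsu⟩ := hs ε hε
  obtain ⟨v, hv, htv⟩ := ht ε hε
  refine ⟨u ×ˢ v, hu.prod hv, fun ⟨x, y⟩ ⟨hx, hy⟩ => ?_⟩
  obtain ⟨x', hx', hxx⟩ := Set.mem_iUnion₂.1 (hsu hx)
  obtain ⟨y', hy', hyy⟩ := Set.mem_iUnion₂.1 (htv hy)
  refine Set.mem_iUnion₂.2 ⟨(x', y'), ⟨hx', hy'⟩, ?_⟩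
  exact Metric.mem_ball.2 (max_lt hxx hyy)

namespace OrderUnitSpace

theorem nonneg_of_seminorm {E : Type*} [AddCommGroup E] [Module ℝ E] {L : E → ℝ}
    (hadd : ∀ a b, L (a + b) ≤ L a + L b)
    (hsmul : ∀ (r : ℝ) a, L (r • a) = |r| * L a) (a : E) : 0 ≤ L a := by
  have h0 : L 0 = 0 := by simpa using hsmul 0 0
  have h1 : L (-a) = L a := by simpa using hsmul (-1) a
  have := hadd a (-a)
  rw [add_neg_cancel, h0, h1] at this
  linarith

section OrderUnit

variable {E : Type*} [AddCommGroup E] [Module ℝ E] [PartialOrder E] [OrderUnitSpace E]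
  {F : Type*} [AddCommGroup F] [Module ℝ F] [PartialOrder F] [OrderUnitSpace F]

theorem State.abs_sub_le_ouNorm (μ : State E) (a b : E) : |μ.1 a - μ.1 b| ≤ ouNorm (a - b) := by
  rw [← map_sub]; exact μ.2.2 _

theorem State.map_smul_unit (μ : State E) (r : ℝ) : μ.1 (r • (orderUnit : E)) = r := by
  rw [map_smul, μ.2.1, smul_eq_mul, mul_one]

/-- If there is a state, the bounds `r` that define the norm are nonnegative. -/
theorem State.nonneg_of_bound (φ : State E) {a : E} {r : ℝ}
    (h : -(r • (orderUnit : E)) ≤ a ∧ a ≤ r • (orderUnit : E)) : 0 ≤ r := by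
  by_contra! hr
  have h1 : -(r • (orderUnit : E)) ≤ r • (orderUnit : E) := h.1.trans h.2
  have h2 := add_le_add_left' _ _ h1 (r • (orderUnit : E))
  rw [add_neg_cancel, ← add_smul] at h2
  have h3 := smul_nonneg' (-(r + r))⁻¹ _ (inv_nonneg.2 (by linarith)) h2
  rw [smul_smul, show (-(r + r))⁻¹ * (r + r) = -1 by
    rw [inv_neg, neg_mul, inv_mul_cancel₀ (by linarith)]] at h3
  have h4 := add_le_add_left' _ _ h3 (orderUnit : E)
  rw [add_zero, neg_one_smul, add_neg_cancel] at h4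
  have h5 : (orderUnit : E) = 0 := le_antisymm h4 orderUnit_nonneg
  have h6 := congrArg φ.1 h5
  rw [map_zero, φ.2.1] at h6
  exact one_ne_zero h6

theorem State.abs_le_of_bound (φ : State E) {a : E} {r : ℝ}
    (h : -(r • (orderUnit : E)) ≤ a ∧ a ≤ r • (orderUnit : E)) : |φ.1 a| ≤ r :=
  (φ.2.2 a).trans (csInf_le ⟨0, fun _ hs => φ.nonneg_of_bound hs⟩ h)

theorem exists_ouNorm_bound (a : E) :
    ∃ r : ℝ, -(r • (orderUnit : E)) ≤ a ∧ a ≤ r • (orderUnit : E) := by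
  obtain ⟨r, hr⟩ := exists_le_smul a
  obtain ⟨s, hs⟩ := exists_le_smul (-a)
  refine ⟨max r s, ?_, hr.trans (smul_unit_mono (le_max_left r s))⟩
  have h1 := add_le_add_left' _ _ (hs.trans (smul_unit_mono (le_max_right r s)))
    (a - max r s • (orderUnit : E))
  have e1 : a - max r s • (orderUnit : E) + -a = -(max r s • (orderUnit : E)) := by abel
  have e2 : a - max r s • (orderUnit : E) + max r s • (orderUnit : E) = a := by abel
  rwa [e1, e2] at h1

theorem bound_of_ouNorm_lt {a : E} {r : ℝ} (h : ouNorm a < r) :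
    -(r • (orderUnit : E)) ≤ a ∧ a ≤ r • (orderUnit : E) := by
  obtain ⟨s, ⟨hs1, hs2⟩, hsr⟩ := exists_lt_of_csInf_lt (exists_ouNorm_bound a) h
  have hm := smul_unit_mono (E := E) hsr.le
  refine ⟨le_trans ?_ hs1, hs2.trans hm⟩
  have h1 := add_le_add_left' _ _ hm (-(r • (orderUnit : E)) + -(s • (orderUnit : E)))
  have e1 : -(r • (orderUnit : E)) + -(s • (orderUnit : E)) + s • (orderUnit : E) =
    -(r • (orderUnit : E)) := by abel
  have e2 : -(r • (orderUnit : E)) + -(s • (orderUnit : E)) + r • (orderUnit : E) =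
    -(s • (orderUnit : E)) := by abel
  rwa [e1, e2] at h1

/-- The pull-back of a state along a linear map that is compatible with the order-unit bounds. -/
def State.comap (φ : State E) (f : F →ₗ[ℝ] E) (h1 : f orderUnit = orderUnit)
    (hf : ∀ (a : F) (r : ℝ), -(r • (orderUnit : F)) ≤ a ∧ a ≤ r • (orderUnit : F) →
      -(r • (orderUnit : E)) ≤ f a ∧ f a ≤ r • (orderUnit : E)) : State F :=
  ⟨φ.1 ∘ₗ f, by rw [LinearMap.comp_apply, h1, φ.2.1], fun a =>
    le_csInf (exists_ouNorm_bound a) fun r hr => φ.abs_le_of_bound (hf a r hr)⟩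

/-- The state `(a, b) ↦ φ(a)` of `E ⊕ F`. -/
def State.left (F : Type*) [AddCommGroup F] [Module ℝ F] [PartialOrder F] [OrderUnitSpace F]
    (φ : State E) : State (E × F) :=
  φ.comap (LinearMap.fst ℝ E F) rfl fun _ _ h => ⟨h.1.1, h.2.1⟩

/-- The state `(a, b) ↦ ψ(b)` of `E ⊕ F`. -/
def State.right (E : Type*) [AddCommGroup E] [Module ℝ E] [PartialOrder E] [OrderUnitSpace E]
    (ψ : State F) : State (E × F) :=
  ψ.comap (LinearMap.snd ℝ E F) rfl fun _ _ h => ⟨h.1.2, h.2.2⟩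

theorem IsLipNorm.map_zero {L : E → ℝ} (hL : IsLipNorm L) : L 0 = 0 :=
  (hL.eq_zero_iff 0).2 ⟨0, (zero_smul _ _).symm⟩

theorem IsLipNorm.map_neg {L : E → ℝ} (hL : IsLipNorm L) (a : E) : L (-a) = L a := by
  have := hL.smul_eq (-1) a
  rwa [neg_one_smul, abs_neg, abs_one, one_mul] at this

theorem IsLipNorm.nonneg {L : E → ℝ} (hL : IsLipNorm L) (a : E) : 0 ≤ L a :=
  nonneg_of_seminorm hL.add_le hL.smul_eq a

theorem stateDist_le_ofReal {L : E → ℝ} {μ ν : State E} {C : ℝ}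
    (h : ∀ a, L a ≤ 1 → |μ.1 a - ν.1 a| ≤ C) : stateDist L μ ν ≤ ENNReal.ofReal C :=
  iSup₂_le fun a ha => ENNReal.ofReal_le_ofReal (h a ha)

theorem ofReal_abs_sub_le_stateDist {L : E → ℝ} (μ ν : State E) {a : E} (ha : L a ≤ 1) :
    ENNReal.ofReal |μ.1 a - ν.1 a| ≤ stateDist L μ ν :=
  le_iSup₂ (f := fun a (_ : L a ≤ 1) => ENNReal.ofReal |μ.1 a - ν.1 a|) a ha

/-- A bound for `|μ - ν|` on the unit ball of `L` scales to all `a`; on the null space `ℝ e` of `L`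
the states `μ` and `ν` agree. -/
theorem abs_sub_le_mul_of_ball {L : E → ℝ} (hadd : ∀ a b, L (a + b) ≤ L a + L b)
    (hsmul : ∀ (r : ℝ) a, L (r • a) = |r| * L a)
    (hzero : ∀ a, L a = 0 ↔ ∃ r : ℝ, a = r • (orderUnit : E))
    {μ ν : State E} {C : ℝ} (h : ∀ a, L a ≤ 1 → |μ.1 a - ν.1 a| ≤ C) (a : E) :
    |μ.1 a - ν.1 a| ≤ L a * C := by
  rcases (nonneg_of_seminorm hadd hsmul a).eq_or_lt with h0 | h0
  · obtain ⟨r, rfl⟩ := (hzero a).1 h0.symm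
    rw [μ.map_smul_unit, ν.map_smul_unit, ← h0]; simp
  · have h1 : L ((L a)⁻¹ • a) ≤ 1 := by
      rw [hsmul, abs_of_pos (inv_pos.2 h0), inv_mul_cancel₀ h0.ne']
    have h2 := h _ h1
    rw [map_smul, map_smul, smul_eq_mul, smul_eq_mul, ← mul_sub, abs_mul,
      abs_of_pos (inv_pos.2 h0), inv_mul_le_iff₀ h0] at h2
    exact h2

theorem IsLipNorm.abs_sub_le {L : E → ℝ} (hL : IsLipNorm L) (hd : stateDiam L ≠ ⊤)
    (μ ν : State E) (a : E) : |μ.1 a - ν.1 a| ≤ L a * (stateDiam L).toReal := by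
  refine abs_sub_le_mul_of_ball hL.add_le hL.smul_eq hL.eq_zero_iff (fun b hb => ?_) a
  rw [← ENNReal.ofReal_le_iff_le_toReal hd]
  exact (ofReal_abs_sub_le_stateDist μ ν hb).trans
    (le_iSup₂ (f := fun μ ν => stateDist L μ ν) μ ν)

/-! ### Compactness of the state space -/

/-- The state space is a closed subset of the product of the intervals `[-‖a‖, ‖a‖]`. -/
theorem compactSpace_weakStar : @CompactSpace (State E) (weakStarTopology E) := by
  let := weakStarTopology E
  have hind : IsInducing (fun (μ : State E) (a : E) => μ.1 a) := ⟨rfl⟩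
  refine ⟨(hind.isCompact_iff).2 ?_⟩
  have hsub : (fun (μ : State E) (a : E) => μ.1 a) '' Set.univ ⊆
      Set.univ.pi fun a => Set.Icc (-ouNorm a) (ouNorm a) := by
    rintro _ ⟨μ, -, rfl⟩ a -
    exact abs_le.1 (μ.2.2 a)
  refine (isCompact_univ_pi fun a => isCompact_Icc).of_isClosed_subset ?_ hsub
  have heq : (fun (μ : State E) (a : E) => μ.1 a) '' Set.univ =
      {f : E → ℝ | (∀ a b, f (a + b) = f a + f b) ∧ (∀ (r : ℝ) a, f (r • a) = r * f a) ∧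
        f orderUnit = 1 ∧ ∀ a, |f a| ≤ ouNorm a} := by
    ext f
    constructor
    · rintro ⟨μ, -, rfl⟩
      exact ⟨map_add μ.1, fun r a => by simp, μ.2.1, μ.2.2⟩
    · rintro ⟨h1, h2, h3, h4⟩
      exact ⟨⟨⟨⟨f, h1⟩, h2⟩, h3, h4⟩, trivial, rfl⟩
  rw [heq]
  refine IsClosed.inter (s₁ := {f : E → ℝ | ∀ a b, f (a + b) = f a + f b}) ?_
    (IsClosed.inter (s₁ := {f : E → ℝ | ∀ (r : ℝ) a, f (r • a) = r * f a}) ?_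
    (IsClosed.inter (s₁ := {f : E → ℝ | f orderUnit = 1})
      (s₂ := {f : E → ℝ | ∀ a, |f a| ≤ ouNorm a}) ?_ ?_))
  · simp only [Set.ofPred_forall]
    exact isClosed_iInter fun a => isClosed_iInter fun b =>
      isClosed_eq (by fun_prop) (by fun_prop)
  · simp only [Set.ofPred_forall]
    exact isClosed_iInter fun a => isClosed_iInter fun b =>
      isClosed_eq (by fun_prop) (by fun_prop)
  · exact isClosed_eq (by fun_prop) (by fun_prop)
  · simp only [Set.ofPred_forall]
    exact isClosed_iInter fun a => isClosed_le (by fun_prop) (by fun_prop)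

/-- As the weak* topology is compact, so is the state space under `ρ_L`. -/
theorem IsLipNorm.exists_finite_net {L : E → ℝ} (hL : IsLipNorm L) {ε : ℝ} (hε : 0 < ε) :
    ∃ t : Set (State E), t.Finite ∧ ∀ μ, ∃ ν ∈ t, stateDist L μ ν < ENNReal.ofReal ε := by
  let := stateEMetric L
  have hc : CompactSpace (State E) := by
    have := compactSpace_weakStar (E := E)
    rwa [← hL.topology_eq] at this
  obtain ⟨t, ht, h⟩ := EMetric.totallyBounded_iff.1 (isCompact_univ (X := State E)).totallyBounded
    (ENNReal.ofReal ε) (ENNReal.ofReal_pos.2 hε)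
  refine ⟨t, ht, fun μ => ?_⟩
  obtain ⟨ν, hν, h'⟩ := Set.mem_iUnion₂.1 (h (Set.mem_univ μ))
  exact ⟨ν, hν, h'⟩

/-- A convex combination of two states. -/
def State.lineMap (μ ν : State E) (s : ℝ) (h0 : 0 ≤ s) (h1 : s ≤ 1) : State E :=
  ⟨(1 - s) • μ.1 + s • ν.1, by simp [μ.2.1, ν.2.1], fun a => by
    have := mul_le_mul_of_nonneg_left (μ.2.2 a) (sub_nonneg.2 h1)
    have := mul_le_mul_of_nonneg_left (ν.2.2 a) h0
    calc |((1 - s) • μ.1 + s • ν.1) a| ≤ |(1 - s) * μ.1 a| + |s * ν.1 a| := abs_add_le _ _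
      _ = (1 - s) * |μ.1 a| + s * |ν.1 a| := by
        rw [abs_mul, abs_mul, abs_of_nonneg h0, abs_of_nonneg (sub_nonneg.2 h1)]
      _ ≤ ouNorm a := by linarith⟩

/-- The distance of two states is finite: the segment that joins them is weak* continuous, hence
some point of it near `μ` has finite distance from `μ`, and distances scale along the segment. -/
theorem IsLipNorm.stateDist_lt_top {L : E → ℝ} (hL : IsLipNorm L) (μ ν : State E) :
    stateDist L μ ν < ⊤ := by
  let c : ℕ → State E := fun n => μ.lineMap ν (1 / ((n : ℝ) + 1)) (by positivity)
    (by rw [div_le_one (by positivity)]; linarith [(Nat.cast_nonneg n : (0 : ℝ) ≤ n)])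
  have hc : Tendsto c atTop (@nhds _ (weakStarTopology E) μ) := by
    rw [nhds_induced, tendsto_comap_iff, tendsto_pi_nhds]
    intro a
    have h : Tendsto (fun n : ℕ => 1 / ((n : ℝ) + 1)) atTop (𝓝 0) :=
      tendsto_one_div_add_atTop_nhds_zero_nat
    have h' : Tendsto (fun n : ℕ => (1 - 1 / ((n : ℝ) + 1)) * μ.1 a + 1 / ((n : ℝ) + 1) * ν.1 a)
        atTop (𝓝 ((1 - 0) * μ.1 a + 0 * ν.1 a)) :=
      ((tendsto_const_nhds.sub h).mul_const _).add (h.mul_const _)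
    rw [sub_zero, one_mul, zero_mul, add_zero] at h'
    exact h'
  rw [← hL.topology_eq] at hc
  let := stateEMetric L
  obtain ⟨n, hn⟩ := (hc.eventually (Metric.eball_mem_nhds μ one_pos)).exists
  refine (stateDist_le_ofReal (C := (n : ℝ) + 1) fun a ha => ?_).trans_lt ENNReal.ofReal_lt_top
  have h1 : ENNReal.ofReal |(c n).1 a - μ.1 a| ≤ 1 :=
    (ofReal_abs_sub_le_stateDist (c n) μ ha).trans (le_of_lt hn)
  rw [ENNReal.ofReal_le_one] at h1
  have h2 : (c n).1 a - μ.1 a = -((1 / ((n : ℝ) + 1)) * (μ.1 a - ν.1 a)) := by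
    simp [c, State.lineMap]; ring
  rw [h2, abs_neg, abs_mul, abs_of_pos (by positivity), one_div,
    inv_mul_le_iff₀ (by positivity)] at h1
  linarith

/-- A finite net for `ρ_L` whose points lie at finite distance from each other. -/
theorem IsLipNorm.stateDiam_ne_top {L : E → ℝ} (hL : IsLipNorm L) : stateDiam L ≠ ⊤ := by
  rcases isEmpty_or_nonempty (State E) with h | ⟨⟨μ₀⟩⟩
  · simp [stateDiam]
  obtain ⟨t, ht, h⟩ := hL.exists_finite_net one_pos
  let := stateEMetric L
  have hM : ∃ M : ℝ≥0∞, M < ⊤ ∧ ∀ ν ∈ t, stateDist L ν μ₀ ≤ M := by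
    refine ⟨ht.toFinset.sup fun ν => stateDist L ν μ₀, ?_, fun ν hν => ?_⟩
    · rw [Finset.sup_lt_iff ENNReal.zero_lt_top]
      exact fun ν _ => hL.stateDist_lt_top ν μ₀
    · exact Finset.le_sup (f := fun ν => stateDist L ν μ₀) (ht.mem_toFinset.2 hν)
  obtain ⟨M, hM, hMt⟩ := hM
  have key : ∀ μ, stateDist L μ μ₀ ≤ 1 + M := fun μ => by
    obtain ⟨ν, hν, h'⟩ := h μ
    exact (edist_triangle μ ν μ₀).trans
      (add_le_add (h'.le.trans (by simp)) (hMt ν hν))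
  have : stateDiam L ≤ (1 + M) + (1 + M) := iSup₂_le fun μ ν =>
    (edist_triangle_right μ ν μ₀).trans (add_le_add (key μ) (key ν))
  exact (this.trans_lt (by simp [hM])).ne

end OrderUnit

section Normed

variable {E : Type*} [NormedAddCommGroup E] [NormedSpace ℝ E] [PartialOrder E] [OrderUnitSpace E]
  {F : Type*} [NormedAddCommGroup F] [NormedSpace ℝ F] [PartialOrder F] [OrderUnitSpace F]

/-- The unit ball of `L` is totally bounded modulo the multiples of the order unit. -/
def HasTotallyBoundedBall (L : E → ℝ) : Prop :=
  ∃ K : Set E, TotallyBounded K ∧ ∀ a, L a ≤ 1 → ∃ r : ℝ, a - r • (orderUnit : E) ∈ K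

/-- Rieffel's criterion, in one direction: a seminorm with null space `ℝ e` whose unit ball is
totally bounded modulo `ℝ e` is a Lip-norm. -/
theorem HasTotallyBoundedBall.isLipNorm {L : E → ℝ} (hK : HasTotallyBoundedBall L)
    (hn : ∀ a : E, ouNorm a ≤ ‖a‖) (hadd : ∀ a b, L (a + b) ≤ L a + L b)
    (hsmul : ∀ (r : ℝ) a, L (r • a) = |r| * L a)
    (hzero : ∀ a, L a = 0 ↔ ∃ r : ℝ, a = r • (orderUnit : E)) : IsLipNorm L := by
  refine ⟨hadd, hsmul, hzero, le_antisymm ?_ ?_⟩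
  · rw [← continuous_iff_le_induced]
    let := stateEMetric L
    refine continuous_pi fun a => LipschitzWith.continuous (K := (L a).toNNReal) fun μ ν => ?_
    by_cases htop : stateDist L μ ν = ⊤
    · rcases (nonneg_of_seminorm hadd hsmul a).eq_or_lt with h0 | h0
      · obtain ⟨r, rfl⟩ := (hzero a).1 h0.symm
        rw [μ.map_smul_unit, ν.map_smul_unit]; simp
      · have : edist μ ν = ⊤ := htop
        rw [this, ENNReal.mul_top (by simpa using h0)]
        exact le_top
    · have := abs_sub_le_mul_of_ball hadd hsmul hzero (μ := μ) (ν := ν)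
        (C := (stateDist L μ ν).toReal) (fun b hb => by
          rw [← ENNReal.ofReal_le_iff_le_toReal htop]
          exact ofReal_abs_sub_le_stateDist μ ν hb) a
      rw [edist_dist, Real.dist_eq]
      refine (ENNReal.ofReal_le_ofReal this).trans ?_
      rw [ENNReal.ofReal_mul (nonneg_of_seminorm hadd hsmul a), ENNReal.ofReal_toReal htop]
      exact le_rfl
  · let : PseudoEMetricSpace (State E) := stateEMetric L
    refine le_of_nhds_le_nhds fun μ => ?_
    rw [Metric.nhds_basis_eball.ge_iff]
    intro ε hε
    obtain ⟨δ, hδ, hδε⟩ : ∃ δ : ℝ, 0 < δ ∧ ENNReal.ofReal δ < ε := by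
      obtain ⟨q, hq0, hq⟩ := ENNReal.lt_iff_exists_nnreal_btwn.1 hε
      exact ⟨q, by exact_mod_cast hq0, by simpa using hq⟩
    obtain ⟨K, hKt, hK⟩ := hK
    obtain ⟨t, ht, htK⟩ := Metric.totallyBounded_iff.1 hKt (δ / 3) (by positivity)
    have hnb : ∀ᶠ ν in @nhds _ (weakStarTopology E) μ, ∀ f ∈ t, |ν.1 f - μ.1 f| < δ / 3 := by
      rw [Filter.eventually_all_finite ht]
      intro f _
      rw [nhds_induced]
      have hcont : Tendsto (fun g : E → ℝ => g f) (𝓝 fun a => μ.1 a) (𝓝 (μ.1 f)) :=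
        (continuous_apply f).tendsto _
      have := (hcont.comp tendsto_comap : Tendsto (fun ν : State E => ν.1 f) _ _)
      have h2 := this.eventually (Metric.ball_mem_nhds (μ.1 f) (by positivity : 0 < δ / 3))
      simpa [Real.dist_eq] using h2
    filter_upwards [hnb] with ν hν
    refine lt_of_le_of_lt (stateDist_le_ofReal fun a ha => ?_) hδε
    obtain ⟨r, hr⟩ := hK a ha
    obtain ⟨f, hf, hfr⟩ := Set.mem_iUnion₂.1 (htK hr)
    rw [mem_ball_iff_norm] at hfr
    have h1 := (ν.abs_sub_le_ouNorm (a - r • orderUnit) f).trans (hn _)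
    have h2 := (μ.abs_sub_le_ouNorm (a - r • orderUnit) f).trans (hn _)
    have h3 := hν f hf
    rw [map_sub, State.map_smul_unit] at h1 h2
    rw [abs_le] at h1 h2 ⊢
    rw [abs_lt] at h3
    constructor <;> linarith

/-- Rieffel's criterion, in the other direction, for spaces on which states compute the norm. The
functions `μ ↦ μ(a)`, `L(a) ≤ 1`, are `1`-Lipschitz on a compact space of finite diameter, so that
this is the theorem of Arzelà and Ascoli. -/
theorem IsLipNorm.hasTotallyBoundedBall {L : E → ℝ} (hL : IsLipNorm L)
    (hs : ∀ (a : E) (C : ℝ), 0 ≤ C → (∀ μ : State E, |μ.1 a| ≤ C) → ‖a‖ ≤ C) :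
    HasTotallyBoundedBall L := by
  rcases isEmpty_or_nonempty (State E) with h | ⟨⟨μ₀⟩⟩
  · refine ⟨{0}, totallyBounded_singleton 0, fun a _ => ⟨0, ?_⟩⟩
    have : ‖a‖ ≤ 0 := hs a 0 le_rfl fun μ => (h.false μ).elim
    simpa using this
  refine ⟨{a | L a ≤ 1 ∧ μ₀.1 a = 0}, ?_, fun a ha => ⟨μ₀.1 a, ?_, ?_⟩⟩
  · refine totallyBounded_of_uniform_separation fun ε hε => ?_
    obtain ⟨t, ht, hnet⟩ := hL.exists_finite_net (by positivity : 0 < ε / 4)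
    obtain ⟨n, f, hf⟩ : ∃ (n : ℕ) (f : Fin n → State E), Set.range f = t := by
      obtain ⟨n, f, hf⟩ := ht.fin_embedding
      exact ⟨n, f, hf⟩
    refine ⟨Fin n → ℝ, inferInstance, fun a i => (f i).1 a, ε / 4, by positivity, ?_, ?_⟩
    · refine (isCompact_univ_pi fun _ : Fin n => isCompact_Icc
        (a := -(stateDiam L).toReal) (b := (stateDiam L).toReal)).totallyBounded.subset ?_
      rintro _ ⟨a, ⟨ha, h0⟩, rfl⟩ i -
      have h1 := hL.abs_sub_le hL.stateDiam_ne_top (f i) μ₀ a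
      rw [h0, sub_zero] at h1
      exact abs_le.1 (h1.trans (mul_le_of_le_one_left ENNReal.toReal_nonneg ha))
    · rintro a ⟨ha, -⟩ b ⟨hb, -⟩ hab
      rw [dist_eq_norm]
      refine (hs (a - b) (3 * (ε / 4)) (by positivity) fun μ => ?_).trans_lt (by linarith)
      obtain ⟨ν, hν, hμν⟩ := hnet μ
      rw [← hf] at hν
      obtain ⟨i, rfl⟩ := hν
      have hd : ∀ c, L c ≤ 1 → |μ.1 c - (f i).1 c| ≤ ε / 4 := fun c hc => by
        have := (ofReal_abs_sub_le_stateDist μ (f i) hc).trans hμν.le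
        rwa [ENNReal.ofReal_le_ofReal_iff (by positivity)] at this
      have h1 := hd a ha
      have h2 := hd b hb
      have h3 := (dist_le_pi_dist (fun i => (f i).1 a) (fun i => (f i).1 b) i).trans hab.le
      rw [Real.dist_eq] at h3
      rw [map_sub]
      rw [abs_le] at *
      constructor <;> linarith
  · refine le_trans ?_ ha
    have h := hL.add_le a (-(μ₀.1 a • orderUnit))
    rwa [hL.map_neg, (hL.eq_zero_iff _).2 ⟨_, rfl⟩, add_zero, ← sub_eq_add_neg] at h
  · rw [map_sub, State.map_smul_unit, sub_self]

end Normed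

end OrderUnitSpace

/-! ### A bridge between an order-unit space and a subspace -/

namespace OrderUnitSpace

section Bridge

variable {E : Type*} [NormedAddCommGroup E] [NormedSpace ℝ E] [PartialOrder E] [OrderUnitSpace E]
  {F : Type*} [NormedAddCommGroup F] [NormedSpace ℝ F] [PartialOrder F] [OrderUnitSpace F]

/-- The order-unit norm of a direct sum is at most the maximum of the norms. The case distinction
concerns the trivial space, where the infimum of the bounds is that of all real numbers. -/
theorem ouNorm_prod_le (hE : ∀ a : E, ouNorm a ≤ ‖a‖) (hF : ∀ b : F, ouNorm b ≤ ‖b‖)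
    (x : E × F) : ouNorm x ≤ ‖x‖ := by
  by_cases hbdd : BddBelow {r : ℝ | -(r • (orderUnit : E × F)) ≤ x ∧ x ≤ r • (orderUnit : E × F)}
  · refine le_of_forall_gt_imp_ge_of_dense fun r hr => csInf_le hbdd ?_
    have h1 := bound_of_ouNorm_lt (((hE x.1).trans (norm_fst_le x)).trans_lt hr)
    have h2 := bound_of_ouNorm_lt (((hF x.2).trans (norm_snd_le x)).trans_lt hr)
    exact ⟨⟨h1.1, h2.1⟩, ⟨h1.2, h2.2⟩⟩
  · exact (Real.sInf_of_not_bddBelow hbdd).le.trans (norm_nonneg x)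

/-- A state of a subspace (with the same order unit) extends to a state. -/
theorem exists_state_extension (hE : ∀ a : E, ouNorm a = ‖a‖) (hF : ∀ b : F, ouNorm b = ‖b‖)
    (ι : F →ₗᵢ[ℝ] E) (hι : ι orderUnit = orderUnit) (ψ : State F) :
    ∃ φ : State E, ∀ b, φ.1 (ι b) = ψ.1 b := by
  let f := ψ.1 ∘ₗ (ι.equivRange.symm.toLinearEquiv : LinearMap.range ι.toLinearMap →ₗ[ℝ] F)
  have hf : ∀ b, f ⟨ι b, b, rfl⟩ = ψ.1 b := fun b => by
    have : ι.equivRange.symm ⟨ι b, b, rfl⟩ = b := by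
      rw [LinearIsometryEquiv.symm_apply_eq]; rfl
    exact congrArg ψ.1 this
  obtain ⟨g, hg, hgn⟩ := Module.Dual.exists_extension_of_le_seminorm_real
    (LinearMap.range ι.toLinearMap) f (p := normSeminorm ℝ E) (by
      rintro ⟨_, b, rfl⟩
      have := ψ.2.2 b
      rw [hF, ← ι.norm_map] at this
      exact (le_abs_self _).trans ((hf b) ▸ this))
  have hg' : ∀ b, g (ι b) = ψ.1 b := fun b => (hg ⟨ι b, b, rfl⟩).trans (hf b)
  refine ⟨⟨g, ?_, fun a => ?_⟩, hg'⟩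
  · rw [← hι, hg', ψ.2.1]
  · rw [hE]; exact hgn a

/-- The bridge seminorm `max (L₁(a), L₂(b), ‖a - ι b‖ / γ)`. -/
def bridge (L₁ : E → ℝ) (L₂ : F → ℝ) (ι : F →ₗᵢ[ℝ] E) (γ : ℝ) (x : E × F) : ℝ :=
  max (max (L₁ x.1) (L₂ x.2)) (γ⁻¹ * ‖x.1 - ι x.2‖)

variable {L₁ : E → ℝ} {L₂ : F → ℝ} {ι : F →ₗᵢ[ℝ] E} {γ : ℝ}

theorem HasTotallyBoundedBall.bridge (h₁ : HasTotallyBoundedBall L₁)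
    (h₂ : HasTotallyBoundedBall L₂) (hι : ι orderUnit = orderUnit) (hγ : 0 < γ) :
    HasTotallyBoundedBall (bridge L₁ L₂ ι γ) := by
  obtain ⟨K₁, hK₁, h₁⟩ := h₁
  obtain ⟨K₂, hK₂, h₂⟩ := h₂
  obtain ⟨B₁, hB₁⟩ := hK₁.isBounded.exists_norm_le
  obtain ⟨B₂, hB₂⟩ := hK₂.isBounded.exists_norm_le
  -- the multiples of the order unit in the two components differ by at most `M`
  let M := γ + B₁ + B₂
  let K₃ : Set F := (fun s : ℝ => s • (orderUnit : F)) '' {s | ‖s • (orderUnit : F)‖ ≤ M}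
  have hK₃ : TotallyBounded K₃ := by
    rcases eq_or_ne (orderUnit : F) 0 with h0 | h0
    · refine (totallyBounded_singleton (0 : F)).subset ?_
      rintro _ ⟨s, -, rfl⟩
      simp [h0]
    · have : 0 < ‖(orderUnit : F)‖ := norm_pos_iff.2 h0
      refine TotallyBounded.image ((isCompact_Icc (a := -(M / ‖(orderUnit : F)‖))
        (b := M / ‖(orderUnit : F)‖)).totallyBounded.subset fun s hs => ?_)
        (LipschitzWith.uniformContinuous (K := ‖(orderUnit : F)‖₊) ?_)
      · rw [Set.mem_ofPred_eq, norm_smul, ← le_div_iff₀ this] at hs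
        exact abs_le.1 hs
      · refine LipschitzWith.of_dist_le_mul fun s r => ?_
        rw [dist_eq_norm, ← sub_smul, norm_smul, mul_comm]; exact le_rfl
  have hsum : TotallyBounded ((fun p : F × F => p.1 + p.2) '' (K₂ ×ˢ K₃)) :=
    (hK₂.prod_set hK₃).image uniformContinuous_add
  refine ⟨K₁ ×ˢ ((fun p : F × F => p.1 + p.2) '' (K₂ ×ˢ K₃)), hK₁.prod_set hsum, ?_⟩
  rintro ⟨a, b⟩ hab
  obtain ⟨hab, hd⟩ := max_le_iff.1 hab
  obtain ⟨ha, hb⟩ := max_le_iff.1 hab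
  rw [inv_mul_le_iff₀ hγ, mul_one] at hd
  obtain ⟨r, hr⟩ := h₁ a ha
  obtain ⟨s, hs⟩ := h₂ b hb
  refine ⟨r, hr, ⟨(b - s • orderUnit, (s - r) • orderUnit), ⟨hs, s - r, ?_, rfl⟩, ?_⟩⟩
  · have e : ι ((s - r) • (orderUnit : F)) =
        (a - r • orderUnit) - ι (b - s • orderUnit) - (a - ι b) := by
      simp only [map_sub, map_smul, hι, sub_smul]; abel
    rw [Set.mem_ofPred_eq, ← ι.norm_map, e]
    refine (norm_sub_le _ _).trans ?_
    have := norm_sub_le (a - r • (orderUnit : E)) (ι (b - s • orderUnit))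
    rw [ι.norm_map] at this
    have := hB₁ _ hr
    have := hB₂ _ hs
    simp only [M]
    linarith
  · show b - s • orderUnit + (s - r) • orderUnit = b - r • orderUnit
    rw [sub_smul]; abel

theorem IsLipNorm.bridge (hL₁ : IsLipNorm L₁) (hL₂ : IsLipNorm L₂)
    (h₁ : HasTotallyBoundedBall L₁) (h₂ : HasTotallyBoundedBall L₂)
    (hE : ∀ a : E, ouNorm a = ‖a‖) (hF : ∀ b : F, ouNorm b = ‖b‖)
    (hι : ι orderUnit = orderUnit) (hγ : 0 < γ) : IsLipNorm (bridge L₁ L₂ ι γ) := by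
  refine (h₁.bridge h₂ hι hγ).isLipNorm
    (ouNorm_prod_le (fun a => (hE a).le) fun b => (hF b).le) ?_ ?_ ?_
  · rintro ⟨a, b⟩ ⟨c, d⟩
    refine max_le (max_le ?_ ?_) ?_
    · exact (hL₁.add_le a c).trans (add_le_add
        ((le_max_left _ _).trans (le_max_left _ _)) ((le_max_left _ _).trans (le_max_left _ _)))
    · exact (hL₂.add_le b d).trans (add_le_add
        ((le_max_right _ _).trans (le_max_left _ _)) ((le_max_right _ _).trans (le_max_left _ _)))
    · refine le_trans ?_ (add_le_add (le_max_right _ _) (le_max_right _ _))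
      rw [← mul_add]
      refine mul_le_mul_of_nonneg_left ?_ (inv_nonneg.2 hγ.le)
      have e : (a, b).1 + (c, d).1 - ι ((a, b).2 + (c, d).2) = (a - ι b) + (c - ι d) := by
        simp only [map_add]; abel
      exact (congrArg norm e).le.trans (norm_add_le _ _)
  · rintro r ⟨a, b⟩
    have e : ‖r • a - ι (r • b)‖ = |r| * ‖a - ι b‖ := by
      rw [map_smul, ← smul_sub, norm_smul, Real.norm_eq_abs]
    show max (max (L₁ (r • a)) (L₂ (r • b))) (γ⁻¹ * ‖r • a - ι (r • b)‖) =
      |r| * max (max (L₁ a) (L₂ b)) (γ⁻¹ * ‖a - ι b‖)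
    rw [hL₁.smul_eq, hL₂.smul_eq, e, mul_left_comm, mul_max_of_nonneg _ _ (abs_nonneg r),
      mul_max_of_nonneg _ _ (abs_nonneg r)]
  · rintro ⟨a, b⟩
    constructor
    · intro h
      obtain ⟨h12, h3⟩ := max_le_iff.1 h.le
      obtain ⟨h1, h2⟩ := max_le_iff.1 h12
      obtain ⟨r, hr⟩ := (hL₂.eq_zero_iff b).1 (le_antisymm h2 (hL₂.nonneg b))
      have h4 : ‖a - ι b‖ = 0 := by
        rw [inv_mul_le_iff₀ hγ, mul_zero] at h3
        exact le_antisymm h3 (norm_nonneg _)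
      refine ⟨r, Prod.ext ?_ hr⟩
      have h5 : b = r • orderUnit := hr
      show a = r • orderUnit
      rw [sub_eq_zero.1 (norm_eq_zero.1 h4), h5, map_smul, hι]
    · rintro ⟨r, hr⟩
      obtain ⟨rfl, rfl⟩ := Prod.ext_iff.1 hr
      have h1 : L₁ (r • (orderUnit : E)) = 0 := (hL₁.eq_zero_iff _).2 ⟨r, rfl⟩
      have h2 : L₂ (r • (orderUnit : F)) = 0 := (hL₂.eq_zero_iff _).2 ⟨r, rfl⟩
      show max (max (L₁ (r • (orderUnit : E))) (L₂ (r • (orderUnit : F))))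
        (γ⁻¹ * ‖r • (orderUnit : E) - ι (r • (orderUnit : F))‖) = 0
      rw [h1, h2, map_smul, hι]; simp

/-- If `F` is a subspace of `E` and every `a` is close to some `b ∈ F`, in the sense that
`L₂(b) ≤ L₁(a)` and `‖a - b‖ ≤ γ L₁(a)`, while `L₁ ≤ L₂` on `F`, then the distance of `E` and `F`
is at most `γ`: restriction of states moves them by at most `γ` for the bridge seminorm. -/
theorem quantumGHDist_le_of_bridge (hL₁ : IsLipNorm L₁) (hL₂ : IsLipNorm L₂)
    (h₁ : HasTotallyBoundedBall L₁) (h₂ : HasTotallyBoundedBall L₂)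
    (hE : ∀ a : E, ouNorm a = ‖a‖) (hF : ∀ b : F, ouNorm b = ‖b‖)
    (hι : ι orderUnit = orderUnit) (hγ : 0 < γ)
    (hleft : ∀ a, ∃ b, L₂ b ≤ L₁ a ∧ ‖a - ι b‖ ≤ γ * L₁ a) (hright : ∀ b, L₁ (ι b) ≤ L₂ b) :
    quantumGHDist L₁ L₂ ≤ ENNReal.ofReal γ := by
  have hadm : OrderUnitSpace.bridge L₁ L₂ ι γ ∈ admissible L₁ L₂ := by
    refine ⟨hL₁.bridge hL₂ h₁ h₂ hE hF hι hγ, fun a => ⟨?_, fun c hc => ?_⟩,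
      fun b => ⟨?_, fun c hc => ?_⟩⟩
    · rintro _ ⟨b, rfl⟩
      exact (le_max_left _ _).trans (le_max_left _ _)
    · obtain ⟨b, hb, hab⟩ := hleft a
      refine (hc ⟨b, rfl⟩).trans (max_le (max_le le_rfl hb) ?_)
      rwa [inv_mul_le_iff₀ hγ]
    · rintro _ ⟨a, rfl⟩
      exact (le_max_right _ _).trans (le_max_left _ _)
    · refine (hc ⟨ι b, rfl⟩).trans (max_le (max_le (hright b) le_rfl) ?_)
      simpa using hL₂.nonneg b
  refine (iInf₂_le _ hadm).trans ?_
  have key : ∀ (φ : State E) (ψ : State F), (∀ b, φ.1 (ι b) = ψ.1 b) →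
      stateDist (OrderUnitSpace.bridge L₁ L₂ ι γ) (φ.left F) (ψ.right E) ≤ ENNReal.ofReal γ := by
    intro φ ψ h
    refine stateDist_le_ofReal fun x hx => ?_
    have h3 := (max_le_iff.1 hx).2
    rw [inv_mul_le_iff₀ hγ, mul_one] at h3
    show |φ.1 x.1 - ψ.1 x.2| ≤ γ
    rw [← h]
    exact ((φ.abs_sub_le_ouNorm _ _).trans (hE _).le).trans h3
  let := stateEMetric (OrderUnitSpace.bridge L₁ L₂ ι γ)
  refine Metric.hausdorffEDist_le_of_mem_edist ?_ ?_
  · rintro μ ⟨φ, hφ⟩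
    let ψ : State F := ⟨φ.1 ∘ₗ ι.toLinearMap, (congrArg φ.1 hι).trans φ.2.1, fun b => by
      have := φ.2.2 (ι b)
      rwa [hE, ι.norm_map, ← hF] at this⟩
    refine ⟨ψ.right E, ⟨ψ, rfl⟩, ?_⟩
    rw [show μ = φ.left F from Subtype.ext hφ]
    exact key φ ψ fun b => rfl
  · rintro ν ⟨ψ, hψ⟩
    obtain ⟨φ, hφ⟩ := exists_state_extension hE hF ι hι ψ
    refine ⟨φ.left F, ⟨φ, rfl⟩, ?_⟩
    rw [show ν = ψ.right E from Subtype.ext hψ, edist_comm]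
    exact key φ ψ hφ

end Bridge

end OrderUnitSpace

/-! ### Order-unit spaces of operators: norm and vector states -/

section OperatorSpaces

variable {G : Type*} [NormedAddCommGroup G] [InnerProductSpace ℂ G] [CompleteSpace G]

theorem norm_le_of_re_inner_le {v : G →L[ℂ] G} (hv : IsSelfAdjoint v) {C : ℝ} (hC : 0 ≤ C)
    (h : ∀ x : G, ‖x‖ = 1 → |RCLike.re (inner ℂ (v x) x)| ≤ C) : ‖v‖ ≤ C := by
  rw [ContinuousLinearMap.norm_eq_iSup_rayleighQuotient v
    (ContinuousLinearMap.isSelfAdjoint_iff_isSymmetric.1 hv)]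
  refine ciSup_le fun x => ?_
  rcases eq_or_ne x 0 with rfl | hx
  · simpa [ContinuousLinearMap.rayleighQuotient] using hC
  · have hx' : (0 : ℝ) < ‖x‖ := norm_pos_iff.2 hx
    have h1 := h (((‖x‖⁻¹ : ℝ) : ℂ) • x) (by
      rw [norm_smul, Complex.norm_real, norm_inv, norm_norm, inv_mul_cancel₀ hx'.ne'])
    have h2 := v.rayleigh_smul x (c := ((‖x‖⁻¹ : ℝ) : ℂ)) (by
      simpa using hx)
    rw [← h2, ContinuousLinearMap.rayleighQuotient, ContinuousLinearMap.reApplyInnerSelf_apply]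
    have h3 : ‖((‖x‖⁻¹ : ℝ) : ℂ) • x‖ = 1 := by
      rw [norm_smul, Complex.norm_real, norm_inv, norm_norm, inv_mul_cancel₀ hx'.ne']
    rw [h3, one_pow, div_one]
    exact h1

theorem abs_re_inner_le_of_bound {G : Type*} [NormedAddCommGroup G] [InnerProductSpace ℂ G]
    {v : G →L[ℂ] G} {r : ℝ}
    (h : -(r • (1 : G →L[ℂ] G)) ≤ v ∧ v ≤ r • (1 : G →L[ℂ] G)) {x : G} (hx : ‖x‖ = 1) :
    |RCLike.re (inner ℂ (v x) x)| ≤ r := by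
  have e : RCLike.re (inner ℂ ((r • (1 : G →L[ℂ] G)) x) x) = r := by
    have : (r • (1 : G →L[ℂ] G)) x = (r : ℂ) • x := by simp
    rw [this, inner_smul_left, inner_self_eq_norm_sq_to_K, hx]; simp
  have h1 := ((ContinuousLinearMap.le_def _ _).1 h.1).re_inner_nonneg_left x
  have h2 := ((ContinuousLinearMap.le_def _ _).1 h.2).re_inner_nonneg_left x
  rw [sub_apply, inner_sub_left, map_sub] at h1 h2
  rw [neg_apply, inner_neg_left, map_neg, e] at h1
  rw [e] at h2
  rw [abs_le]; constructor <;> linarith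

variable {V : Submodule ℝ (G →L[ℂ] G)} (h1 : (1 : G →L[ℂ] G) ∈ V) (hsa : ∀ v ∈ V, IsSelfAdjoint v)

theorem ouNorm_ofSelfAdjoint (v : V) :
    @OrderUnitSpace.ouNorm V _ _ _ (OrderUnitSpace.ofSelfAdjoint V h1 hsa) v = ‖v‖ := by
  let _ := OrderUnitSpace.ofSelfAdjoint V h1 hsa
  have hmem : -(‖v‖ • (OrderUnitSpace.orderUnit : V)) ≤ v ∧
      v ≤ ‖v‖ • (OrderUnitSpace.orderUnit : V) := by
    constructor
    · show -(‖(v : G →L[ℂ] G)‖ • (1 : G →L[ℂ] G)) ≤ (v : G →L[ℂ] G)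
      simpa [Algebra.algebraMap_eq_smul_one] using
        IsSelfAdjoint.neg_algebraMap_norm_le_self (hsa v v.2)
    · show (v : G →L[ℂ] G) ≤ ‖(v : G →L[ℂ] G)‖ • (1 : G →L[ℂ] G)
      simpa [Algebra.algebraMap_eq_smul_one] using
        IsSelfAdjoint.le_algebraMap_norm_self (hsa v v.2)
  rcases subsingleton_or_nontrivial G with hG | hG
  · -- every real number is a bound, and the infimum of all reals is `0` by convention
    have : {r : ℝ | -(r • (OrderUnitSpace.orderUnit : V)) ≤ v ∧
        v ≤ r • (OrderUnitSpace.orderUnit : V)} = Set.univ :=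
      Set.eq_univ_of_forall fun r =>
        ⟨(Subsingleton.elim _ _ : -(r • (OrderUnitSpace.orderUnit : V)) = v).le,
          (Subsingleton.elim _ _ : v = r • (OrderUnitSpace.orderUnit : V)).le⟩
    rw [OrderUnitSpace.ouNorm, this, Real.sInf_univ, Subsingleton.elim v 0, norm_zero]
  · obtain ⟨x, hx⟩ := exists_norm_eq G (zero_le_one (α := ℝ))
    have hb : ∀ r : ℝ, -(r • (OrderUnitSpace.orderUnit : V)) ≤ v ∧
        v ≤ r • (OrderUnitSpace.orderUnit : V) → ∀ y : G, ‖y‖ = 1 →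
        |RCLike.re (inner ℂ ((v : G →L[ℂ] G) y) y)| ≤ r :=
      fun r hr y hy => abs_re_inner_le_of_bound ⟨hr.1, hr.2⟩ hy
    refine le_antisymm (csInf_le ⟨0, fun r hr => (abs_nonneg _).trans (hb r hr x hx)⟩ hmem)
      (le_csInf ⟨_, hmem⟩ fun r hr => ?_)
    exact norm_le_of_re_inner_le (hsa v v.2) ((abs_nonneg _).trans (hb r hr x hx)) (hb r hr)

/-- The vector state `v ↦ ⟨v x, x⟩` of a unit vector `x`. -/
def vectorState (x : G) (hx : ‖x‖ = 1) :
    @OrderUnitSpace.State V _ _ _ (OrderUnitSpace.ofSelfAdjoint V h1 hsa) :=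
  let _ := OrderUnitSpace.ofSelfAdjoint V h1 hsa
  ⟨{ toFun := fun v => RCLike.re (inner ℂ ((v : G →L[ℂ] G) x) x)
     map_add' := fun v w => by simp
     map_smul' := fun r v => by simp [← Complex.coe_smul, mul_comm] },
   by
    show RCLike.re (inner ℂ ((1 : G →L[ℂ] G) x) x) = 1
    exact (inner_self_eq_norm_sq (𝕜 := ℂ) x).trans (by rw [hx, one_pow]),
   fun v => by
    rw [ouNorm_ofSelfAdjoint h1 hsa v]
    refine (RCLike.abs_re_le_norm _).trans
      ((norm_inner_le_norm (𝕜 := ℂ) ((v : G →L[ℂ] G) x) x).trans ?_)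
    rw [hx, mul_one]
    simpa [hx] using (v : G →L[ℂ] G).le_opNorm x⟩

theorem norm_le_of_forall_state (v : V) {C : ℝ} (hC : 0 ≤ C)
    (h : ∀ μ : @OrderUnitSpace.State V _ _ _ (OrderUnitSpace.ofSelfAdjoint V h1 hsa),
      |μ.1 v| ≤ C) : ‖v‖ ≤ C :=
  norm_le_of_re_inner_le (hsa v v.2) hC fun x hx => h (vectorState h1 hsa x hx)

end OperatorSpaces

/-! ### Totally bounded sets of self-adjoint operators -/

section TotallyBoundedOperators

variable {G : Type*} [NormedAddCommGroup G] [InnerProductSpace ℂ G]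

/-- The span of a finite `ε`-net is uniformly `ε`-close to `X`. -/
theorem exists_finiteDimensional_approx {X : Set G} (hX : TotallyBounded X) {ε : ℝ} (hε : 0 < ε) :
    ∃ V : Submodule ℂ G, FiniteDimensional ℂ V ∧ ∀ (_ : V.HasOrthogonalProjection) (x : G), x ∈ X →
      ‖x - V.starProjection x‖ ≤ ε := by
  obtain ⟨t, ht, htX⟩ := Metric.totallyBounded_iff.1 hX ε hε
  refine ⟨Submodule.span ℂ t, FiniteDimensional.span_of_finite ℂ ht, fun _ x hx => ?_⟩
  obtain ⟨f, hf, hfk⟩ := Set.mem_iUnion₂.1 (htX hx)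
  rw [mem_ball_iff_norm] at hfk
  rw [Submodule.starProjection_minimal]
  exact (ciInf_le ⟨0, by rintro _ ⟨x, rfl⟩; exact norm_nonneg _⟩
    (⟨f, Submodule.subset_span hf⟩ : Submodule.span ℂ t)).trans hfk.le

theorem totallyBounded_compressions {F : Type*} [NormedAddCommGroup F] [InnerProductSpace ℂ F]
    [FiniteDimensional ℂ F] (ι : F →L[ℂ] G) (p : G →L[ℂ] F) {S : Set (G →L[ℂ] G)} {B : ℝ}
    (hS : ∀ k ∈ S, ‖k‖ ≤ B) : TotallyBounded ((fun k => p ∘L k ∘L ι) '' S) := by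
  have : ProperSpace (F →L[ℂ] F) := FiniteDimensional.proper ℂ (F →L[ℂ] F)
  refine (isCompact_closedBall (0 : F →L[ℂ] F) (‖p‖ * (B * ‖ι‖))).totallyBounded.subset ?_
  rintro _ ⟨k, hk, rfl⟩
  rw [mem_closedBall_zero_iff]
  refine (ContinuousLinearMap.opNorm_comp_le _ _).trans
    (mul_le_mul_of_nonneg_left ?_ (norm_nonneg _))
  exact (ContinuousLinearMap.opNorm_comp_le _ _).trans
    (mul_le_mul_of_nonneg_right (hS k hk) (norm_nonneg _))

variable [CompleteSpace G]

/-- For a projection `Q = ι p` write `d = (d - Q d) + Q (d - d Q) + Q d Q` with `d = k - l`; the first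
two terms are small, the second one being controlled by the adjoint of the first. -/
theorem norm_lt_of_compression {F : Type*} [NormedAddCommGroup F] [InnerProductSpace ℂ F]
    (ι : F →L[ℂ] G) (p : G →L[ℂ] F) (hι : ‖ι‖ ≤ 1) (hp : ‖p‖ ≤ 1) (hQ : IsSelfAdjoint (ι ∘L p))
    {k l : G →L[ℂ] G} (hk : IsSelfAdjoint k) (hl : IsSelfAdjoint l) {ε : ℝ}
    (hk' : ‖k - ι ∘L p ∘L k‖ ≤ ε / 8) (hl' : ‖l - ι ∘L p ∘L l‖ ≤ ε / 8)
    (hkl : dist (p ∘L k ∘L ι) (p ∘L l ∘L ι) < ε / 2) : dist k l < ε := by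
  rw [dist_eq_norm] at hkl ⊢
  obtain ⟨Q, hQd⟩ : ∃ Q, Q = ι ∘L p := ⟨_, rfl⟩
  obtain ⟨d, hd⟩ : ∃ d, d = k - l := ⟨_, rfl⟩
  have hQn : ‖Q‖ ≤ 1 := hQd ▸ (ContinuousLinearMap.opNorm_comp_le _ _).trans
    (mul_le_one₀ hι (norm_nonneg _) hp)
  have hQs : star Q = Q := hQd ▸ hQ
  have hds : star d = d := hd ▸ hk.sub hl
  have h1 : ‖d - Q * d‖ ≤ ε / 8 + ε / 8 := by
    have e : d - Q * d = (k - ι ∘L p ∘L k) - (l - ι ∘L p ∘L l) := by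
      rw [hd, hQd]; ext x; simp; abel
    rw [e]
    exact (norm_sub_le _ _).trans (add_le_add hk' hl')
  have h2 : ‖d - d * Q‖ ≤ ε / 8 + ε / 8 := by
    rw [← norm_star, star_sub, star_mul, hds, hQs]; exact h1
  have h3 : ‖Q * d * Q‖ ≤ ‖p ∘L k ∘L ι - p ∘L l ∘L ι‖ := by
    have e : Q * d * Q = ι ∘L (p ∘L k ∘L ι - p ∘L l ∘L ι) ∘L p := by
      rw [hd, hQd]; ext x; simp
    rw [e]
    refine (ContinuousLinearMap.opNorm_comp_le _ _).trans ((mul_le_of_le_one_left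
      (norm_nonneg _) hι).trans ?_)
    exact (ContinuousLinearMap.opNorm_comp_le _ _).trans
      (mul_le_of_le_one_right (norm_nonneg _) hp)
  have e : d = (d - Q * d) + Q * (d - d * Q) + Q * d * Q := by
    rw [mul_sub Q d, mul_assoc]; abel
  have h4 : ‖Q * (d - d * Q)‖ ≤ ε / 8 + ε / 8 :=
    (norm_mul_le _ _).trans ((mul_le_of_le_one_left (norm_nonneg _) hQn).trans h2)
  calc ‖k - l‖ = ‖(d - Q * d) + Q * (d - d * Q) + Q * d * Q‖ := by rw [← e, hd]
    _ ≤ ‖d - Q * d‖ + ‖Q * (d - d * Q)‖ + ‖Q * d * Q‖ := norm_add₃_le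
    _ < ε := by linarith

/-- Self-adjoint operators that map the unit ball into a fixed totally bounded set form a totally
bounded set in norm: up to a small error they are compressions to a finite dimensional space. -/
theorem totallyBounded_selfAdjoint_operators {X : Set G} (hX : TotallyBounded X) :
    TotallyBounded {k : G →L[ℂ] G | IsSelfAdjoint k ∧ ∀ w, ‖w‖ ≤ 1 → k w ∈ X} := by
  obtain ⟨B, hB⟩ := hX.isBounded.exists_norm_le
  refine totallyBounded_of_uniform_separation fun ε hε => ?_
  obtain ⟨V, hV, hVX⟩ := exists_finiteDimensional_approx hX (by positivity : 0 < ε / 8)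
  have hcomp : ∀ k : G →L[ℂ] G, (∀ w, ‖w‖ ≤ 1 → k w ∈ X) →
      ‖k - V.subtypeL ∘L V.orthogonalProjectionOnto ∘L k‖ ≤ ε / 8 := fun k hk =>
    ContinuousLinearMap.opNorm_le_of_unit_norm (𝕜 := ℂ) (by positivity) fun w hw =>
      hVX inferInstance (k w) (hk w hw.le)
  refine ⟨V →L[ℂ] V, inferInstance, fun k => V.orthogonalProjectionOnto ∘L k ∘L V.subtypeL, ε / 2,
    by positivity, ?_, ?_⟩
  · refine totallyBounded_compressions V.subtypeL V.orthogonalProjectionOnto (B := max B 0) ?_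
    rintro k ⟨-, hk⟩
    exact ContinuousLinearMap.opNorm_le_of_unit_norm (𝕜 := ℂ) (le_max_right _ _) fun w hw =>
      (hB _ (hk w hw.le)).trans (le_max_left _ _)
  · rintro k ⟨hks, hk⟩ l ⟨hls, hl⟩ hkl
    exact norm_lt_of_compression V.subtypeL V.orthogonalProjectionOnto
      (Submodule.norm_subtypeL_le V) V.orthogonalProjectionOnto_norm_le
      (isSelfAdjoint_starProjection V) hks hls (hcomp k hk) (hcomp l hl) hkl

end TotallyBoundedOperators

/-! ### Values, bounds and commutators of unbounded operators -/

namespace LinearPMap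

section Values

variable {E F G : Type*} [NormedAddCommGroup E] [InnerProductSpace ℂ E]
  [NormedAddCommGroup F] [InnerProductSpace ℂ F] [NormedAddCommGroup G] [InnerProductSpace ℂ G]

open Classical in
/-- The value `T x`, set to `0` outside the domain of `T`; it is only used at points of the domain,
where it avoids carrying membership proofs along. -/
def val (T : E →ₗ.[ℂ] F) (x : E) : F := if h : x ∈ T.domain then T ⟨x, h⟩ else 0

variable (T : E →ₗ.[ℂ] F)

theorem apply_eq_val (x : T.domain) : T x = T.val x := by
  rw [val, dif_pos x.2]

variable {T}

theorem val_eq {x : E} (h : x ∈ T.domain) : T.val x = T ⟨x, h⟩ := dif_pos h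

theorem val_add {x y : E} (hx : x ∈ T.domain) (hy : y ∈ T.domain) :
    T.val (x + y) = T.val x + T.val y := by
  rw [val_eq hx, val_eq hy, val_eq (T.domain.add_mem hx hy), ← T.map_add]; rfl

theorem val_sub {x y : E} (hx : x ∈ T.domain) (hy : y ∈ T.domain) :
    T.val (x - y) = T.val x - T.val y := by
  rw [val_eq hx, val_eq hy, val_eq (T.domain.sub_mem hx hy), ← T.map_sub]; rfl

theorem val_smul (c : ℂ) {x : E} (hx : x ∈ T.domain) : T.val (c • x) = c • T.val x := by
  rw [val_eq hx, val_eq (T.domain.smul_mem c hx), ← T.map_smul]; rfl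

theorem val_zero : T.val 0 = 0 := by
  rw [val_eq T.domain.zero_mem]; exact T.map_zero

theorem val_mulRight {T : F →ₗ.[ℂ] G} {a : E →ₗ[ℂ] F} {x : E} (h : a x ∈ T.domain) :
    (T.mulRight a).val x = T.val (a x) := by
  rw [val_eq h, val_eq (show x ∈ (T.mulRight a).domain from h)]; rfl

theorem val_compPMap (g : F →ₗ[ℂ] G) {x : E} (hx : x ∈ T.domain) :
    (g.compPMap T).val x = g (T.val x) := by
  rw [val_eq hx, val_eq (show x ∈ (g.compPMap T).domain from hx)]; rfl

theorem isBounded_iff : T.IsBounded ↔ ∃ C : ℝ, ∀ x ∈ T.domain, ‖T.val x‖ ≤ C * ‖x‖ :=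
  exists_congr fun _ => ⟨fun h x hx => by rw [val_eq hx]; exact h ⟨x, hx⟩,
    fun h x => by rw [apply_eq_val]; exact h x x.2⟩

theorem opNorm_nonneg : 0 ≤ T.opNorm := Real.sInf_nonneg fun _ h => h.1

theorem opNorm_le {C : ℝ} (hC : 0 ≤ C) (h : ∀ x ∈ T.domain, ‖T.val x‖ ≤ C * ‖x‖) :
    T.opNorm ≤ C :=
  csInf_le ⟨0, fun _ h => h.1⟩ ⟨hC, fun x => by rw [apply_eq_val]; exact h x x.2⟩

theorem IsBounded.le_opNorm (hT : T.IsBounded) {x : E} (hx : x ∈ T.domain) :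
    ‖T.val x‖ ≤ T.opNorm * ‖x‖ := by
  obtain ⟨C, hC⟩ := isBounded_iff.1 hT
  have hmem : max C 0 ∈ {C : ℝ | 0 ≤ C ∧ ∀ x : T.domain, ‖T x‖ ≤ C * ‖(x : E)‖} :=
    ⟨le_max_right _ _, fun y => by
      rw [apply_eq_val]
      exact (hC y y.2).trans (mul_le_mul_of_nonneg_right (le_max_left _ _) (norm_nonneg _))⟩
  rcases eq_or_ne x 0 with rfl | h0
  · simp [val_zero]
  · rw [← div_le_iff₀ (norm_pos_iff.2 h0)]
    refine le_csInf ⟨_, hmem⟩ fun c hc => ?_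
    rw [div_le_iff₀ (norm_pos_iff.2 h0), val_eq hx]
    exact hc.2 ⟨x, hx⟩

end Values

section Commutator

variable {E : Type*} [NormedAddCommGroup E] [InnerProductSpace ℂ E] {T : E →ₗ.[ℂ] E}

theorem mem_commutator_domain {a : E →L[ℂ] E} {x : E} :
    x ∈ (T.commutator a).domain ↔ a x ∈ T.domain ∧ x ∈ T.domain := Iff.rfl

theorem val_commutator {a : E →L[ℂ] E} {x : E} (ha : a x ∈ T.domain) (hx : x ∈ T.domain) :
    (T.commutator a).val x = T.val (a x) - a (T.val x) := by
  rw [val_eq ha, val_eq hx, val_eq (mem_commutator_domain.2 ⟨ha, hx⟩)]; rfl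

theorem IsFormalAdjoint.inner_val (hT : T.IsFormalAdjoint T) {x y : E} (hx : x ∈ T.domain)
    (hy : y ∈ T.domain) : inner ℂ (T.val x) y = inner ℂ x (T.val y) := by
  rw [val_eq hx, val_eq hy]; exact hT ⟨x, hx⟩ ⟨y, hy⟩

/-- The commutator of a symmetric operator with a self-adjoint one is skew-symmetric. -/
theorem IsFormalAdjoint.inner_commutator [CompleteSpace E] (hT : T.IsFormalAdjoint T)
    {a : E →L[ℂ] E} (ha : IsSelfAdjoint a) {x y : E} (hx : x ∈ (T.commutator a).domain)
    (hy : y ∈ (T.commutator a).domain) :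
    inner ℂ ((T.commutator a).val x) y = -inner ℂ x ((T.commutator a).val y) := by
  have hs : ∀ u v : E, inner ℂ (a u) v = inner ℂ u (a v) :=
    fun u v => (ContinuousLinearMap.isSelfAdjoint_iff_isSymmetric.1 ha) u v
  obtain ⟨hx₁, hx₂⟩ : a x ∈ T.domain ∧ x ∈ T.domain := hx
  obtain ⟨hy₁, hy₂⟩ : a y ∈ T.domain ∧ y ∈ T.domain := hy
  rw [val_commutator hx₁ hx₂, val_commutator hy₁ hy₂, inner_sub_left, inner_sub_right,
    hT.inner_val hx₁ hy₂, hs x (T.val y), hs (T.val x) y, hT.inner_val hx₂ hy₁]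
  ring

theorem norm_le_of_forall_inner_le {x : E} {C : ℝ} (hC : 0 ≤ C) {s : Set E} (hs : Dense s)
    (h : ∀ y ∈ s, ‖inner ℂ x y‖ ≤ C * ‖y‖) : ‖x‖ ≤ C := by
  have h' : ∀ y : E, ‖inner ℂ x y‖ ≤ C * ‖y‖ := fun y => by
    have hcl : _root_.IsClosed {y : E | ‖inner ℂ x y‖ ≤ C * ‖y‖} :=
      isClosed_le (by fun_prop) (by fun_prop)
    exact hcl.closure_subset_iff.2 h (hs y)
  have h1 := h' x
  rw [inner_self_eq_norm_sq_to_K] at h1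
  have h2 : ‖x‖ * ‖x‖ ≤ C * ‖x‖ := by
    calc ‖x‖ * ‖x‖ = ‖((‖x‖ : ℂ)) ^ 2‖ := by simp [sq]
      _ ≤ _ := h1
  rcases (norm_nonneg x).eq_or_lt with h0 | h0
  · exact h0 ▸ hC
  · exact le_of_mul_le_mul_right h2 h0

/-- Subadditivity of `‖[T, ·]‖`. The domain of `[T, a + b]` may be larger than the intersection of
those of `[T, a]` and `[T, b]`; by skew-symmetry a bound on the intersection suffices. -/
theorem IsFormalAdjoint.opNorm_commutator_add_le [CompleteSpace E] (hT : T.IsFormalAdjoint T)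
    {a b : E →L[ℂ] E} (ha : IsSelfAdjoint a) (hb : IsSelfAdjoint b)
    (hab : (T.commutator a).IsBounded) (hbb : (T.commutator b).IsBounded)
    (hd : Dense (((T.commutator a).domain ⊓ (T.commutator b).domain : Submodule ℂ E) : Set E)) :
    (T.commutator (a + b)).opNorm ≤ (T.commutator a).opNorm + (T.commutator b).opNorm := by
  refine opNorm_le (add_nonneg opNorm_nonneg opNorm_nonneg) fun x hx => ?_
  refine norm_le_of_forall_inner_le (mul_nonneg (add_nonneg opNorm_nonneg opNorm_nonneg)
    (norm_nonneg x)) hd fun y hy => ?_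
  obtain ⟨⟨hya, hyT⟩, ⟨hyb, -⟩⟩ : (a y ∈ T.domain ∧ y ∈ T.domain) ∧ (b y ∈ T.domain ∧ _) := hy
  have hy' : y ∈ (T.commutator (a + b)).domain :=
    ⟨T.domain.add_mem hya hyb, hyT⟩
  have e : (T.commutator (a + b)).val y = (T.commutator a).val y + (T.commutator b).val y := by
    rw [val_commutator hy'.1 hyT, val_commutator hya hyT, val_commutator hyb hyT,
      _root_.add_apply, _root_.add_apply, val_add hya hyb]
    abel
  rw [hT.inner_commutator (ha.add hb) hx hy', norm_neg]
  calc _ ≤ ‖x‖ * ‖(T.commutator (a + b)).val y‖ := norm_inner_le_norm _ _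
    _ ≤ ‖x‖ * (((T.commutator a).opNorm + (T.commutator b).opNorm) * ‖y‖) := by
      refine mul_le_mul_of_nonneg_left ?_ (norm_nonneg x)
      rw [e, add_mul]
      exact (norm_add_le _ _).trans
        (add_le_add (hab.le_opNorm ⟨hya, hyT⟩) (hbb.le_opNorm ⟨hyb, hyT⟩))
    _ = _ := by ring

theorem opNorm_commutator_smul_one (c : ℂ) :
    (T.commutator (c • (1 : E →L[ℂ] E))).opNorm = 0 := by
  refine le_antisymm (opNorm_le le_rfl fun x hx => ?_) opNorm_nonneg
  obtain ⟨hx₁, hx₂⟩ : (c • (1 : E →L[ℂ] E)) x ∈ T.domain ∧ x ∈ T.domain := hx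
  rw [val_commutator hx₁ hx₂]
  have h : ∀ y, (c • (1 : E →L[ℂ] E)) y = c • y := fun y => rfl
  rw [h, h, val_smul c hx₂, sub_self]; simp

theorem val_commutator_smul (c : ℂ) {a : E →L[ℂ] E} {x : E} (hx : x ∈ (T.commutator a).domain) :
    (T.commutator (c • a)).val x = c • (T.commutator a).val x := by
  have h : ∀ y, (c • a) y = c • a y := fun y => rfl
  obtain ⟨hx₁, hx₂⟩ : a x ∈ T.domain ∧ x ∈ T.domain := hx
  have hx' : (c • a) x ∈ T.domain := T.domain.smul_mem c hx₁
  rw [val_commutator hx₁ hx₂, val_commutator hx' hx₂, h, h, val_smul c hx₁, smul_sub]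

theorem IsBounded.commutator_smul {a : E →L[ℂ] E} (h : (T.commutator a).IsBounded) {c : ℂ}
    (hc : c ≠ 0) : (T.commutator (c • a)).IsBounded ∧
      (T.commutator (c • a)).opNorm ≤ ‖c‖ * (T.commutator a).opNorm := by
  have hdom : ∀ x ∈ (T.commutator (c • a)).domain, x ∈ (T.commutator a).domain := fun x hx =>
    ⟨(T.domain.smul_mem_iff hc).1 hx.1, hx.2⟩
  have key : ∀ x ∈ (T.commutator (c • a)).domain,
      ‖(T.commutator (c • a)).val x‖ ≤ ‖c‖ * (T.commutator a).opNorm * ‖x‖ := fun x hx => by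
    rw [val_commutator_smul c (hdom x hx), norm_smul, mul_assoc]
    exact mul_le_mul_of_nonneg_left (h.le_opNorm (hdom x hx)) (norm_nonneg c)
  exact ⟨isBounded_iff.2 ⟨_, key⟩, opNorm_le (mul_nonneg (norm_nonneg c) opNorm_nonneg) key⟩

theorem IsBounded.opNorm_commutator_smul {a : E →L[ℂ] E} (h : (T.commutator a).IsBounded) (c : ℂ) :
    (T.commutator (c • a)).opNorm = ‖c‖ * (T.commutator a).opNorm := by
  rcases eq_or_ne c 0 with rfl | hc
  · have := opNorm_commutator_smul_one (T := T) 0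
    rw [zero_smul] at this ⊢
    rw [this, norm_zero, zero_mul]
  · obtain ⟨h1, h2⟩ := h.commutator_smul hc
    obtain ⟨-, h3⟩ := h1.commutator_smul (inv_ne_zero hc)
    rw [smul_smul, inv_mul_cancel₀ hc, one_smul, norm_inv,
      ← div_eq_inv_mul, le_div_iff₀ (norm_pos_iff.2 hc)] at h3
    exact le_antisymm h2 (by linarith)

end Commutator

/-! ### Compactness from the resolvent -/

section Compactness

variable {H : Type*} [NormedAddCommGroup H] [InnerProductSpace ℂ H] {D : H →ₗ.[ℂ] H}

/-- With `z = R x = (I + D²)⁻¹ x` one has `‖z‖² + ‖D z‖² = ⟨z, x⟩` and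
`‖x‖² = ⟨x, z⟩ + ⟨D x, D z⟩`. -/
theorem norm_pow_four_le_of_resolvent (hD : D.IsFormalAdjoint D) {R : H →L[ℂ] H}
    (hR : ∀ y : H, ∃ (h₁ : R y ∈ D.domain) (h₂ : D ⟨R y, h₁⟩ ∈ D.domain),
      R y + D ⟨D ⟨R y, h₁⟩, h₂⟩ = y) {x : H} (hx : x ∈ D.domain) {M : ℝ}
    (h1 : ‖x‖ ≤ M) (h2 : ‖D.val x‖ ≤ M) : ‖x‖ ^ 4 ≤ 2 * M ^ 3 * ‖R x‖ := by
  obtain ⟨hz, hDz, hres⟩ := hR x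
  rw [← val_eq hDz, ← val_eq hz] at hres
  rw [← val_eq hz] at hDz
  set z := R x with hzd
  have hM : 0 ≤ M := (norm_nonneg _).trans h1
  have e1 : ‖z‖ ^ 2 + ‖D.val z‖ ^ 2 ≤ ‖z‖ * M := by
    have : inner ℂ z x = inner ℂ z z + inner ℂ (D.val z) (D.val z) := by
      conv_lhs => rw [← hres]
      rw [inner_add_right, hD.inner_val hz hDz]
    rw [inner_self_eq_norm_sq_to_K, inner_self_eq_norm_sq_to_K] at this
    have h3 : ‖inner ℂ z x‖ = ‖z‖ ^ 2 + ‖D.val z‖ ^ 2 := by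
      rw [this]
      have : ((‖z‖ : ℂ) ^ 2 + (‖D.val z‖ : ℂ) ^ 2) = ((‖z‖ ^ 2 + ‖D.val z‖ ^ 2 : ℝ) : ℂ) := by
        push_cast; rfl
      refine (congrArg norm this).trans ?_
      rw [Complex.norm_real, Real.norm_of_nonneg (by positivity)]
    rw [← h3]
    exact (norm_inner_le_norm _ _).trans (mul_le_mul_of_nonneg_left h1 (norm_nonneg _))
  have e2 : ‖x‖ ^ 2 ≤ M * ‖z‖ + M * ‖D.val z‖ := by
    have : inner ℂ x x = inner ℂ x z + inner ℂ (D.val x) (D.val z) := by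
      conv_lhs => rw [← hres, inner_add_right, hres]
      rw [hD.inner_val hx hDz]
    rw [inner_self_eq_norm_sq_to_K] at this
    have h3 : ‖x‖ ^ 2 = ‖((‖x‖ : ℂ)) ^ 2‖ := by simp
    rw [h3]
    refine (congrArg norm this).le.trans ((norm_add_le _ _).trans (add_le_add ?_ ?_))
    · exact (norm_inner_le_norm _ _).trans (mul_le_mul_of_nonneg_right h1 (norm_nonneg _))
    · exact (norm_inner_le_norm _ _).trans (mul_le_mul_of_nonneg_right h2 (norm_nonneg _))
  calc ‖x‖ ^ 4 = (‖x‖ ^ 2) ^ 2 := by ring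
    _ ≤ (M * ‖z‖ + M * ‖D.val z‖) ^ 2 := by gcongr
    _ = M ^ 2 * (‖z‖ + ‖D.val z‖) ^ 2 := by ring
    _ ≤ M ^ 2 * (2 * (‖z‖ * M)) := by
      gcongr
      nlinarith [sq_nonneg (‖z‖ - ‖D.val z‖)]
    _ = 2 * M ^ 3 * ‖z‖ := by ring

theorem totallyBounded_graph_ball (hD : D.IsFormalAdjoint D) {R : H →L[ℂ] H}
    (hRc : IsCompactOperator R)
    (hR : ∀ y : H, ∃ (h₁ : R y ∈ D.domain) (h₂ : D ⟨R y, h₁⟩ ∈ D.domain),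
      R y + D ⟨D ⟨R y, h₁⟩, h₂⟩ = y) (C : ℝ) :
    TotallyBounded {x | x ∈ D.domain ∧ ‖x‖ ≤ C ∧ ‖D.val x‖ ≤ C} := by
  rcases lt_or_ge C 0 with hC | hC
  · refine totallyBounded_empty.subset ?_
    rintro x ⟨-, hx, -⟩
    exact absurd ((norm_nonneg x).trans hx) (not_le.2 hC)
  refine totallyBounded_of_uniform_separation fun ε hε => ?_
  refine ⟨H, inferInstance, R, ε ^ 4 / (2 * (2 * C) ^ 3 + 1), by positivity, ?_, ?_⟩
  · obtain ⟨K, hK, hRK⟩ := hRc.image_closedBall_subset_compact (f := (R : H →ₗ[ℂ] H)) C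
    refine hK.totallyBounded.subset (Set.Subset.trans (Set.image_mono ?_) hRK)
    rintro x ⟨-, hx, -⟩
    simpa using hx
  · rintro x ⟨hx, hx1, hx2⟩ y ⟨hy, hy1, hy2⟩ hxy
    have h1 : ‖x - y‖ ≤ 2 * C := (norm_sub_le _ _).trans (by linarith)
    have h2 : ‖D.val (x - y)‖ ≤ 2 * C := by
      rw [val_sub hx hy]; exact (norm_sub_le _ _).trans (by linarith)
    have h3 := norm_pow_four_le_of_resolvent hD hR (D.domain.sub_mem hx hy) h1 h2
    rw [dist_eq_norm, lt_div_iff₀ (by positivity)] at hxy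
    rw [_root_.map_sub] at h3
    rw [dist_eq_norm]
    refine lt_of_pow_lt_pow_left₀ 4 hε.le ?_
    nlinarith [norm_nonneg (R x - R y)]

variable [CompleteSpace H]

theorem exists_val_eq_of_isSelfAdjoint (hD : IsSelfAdjoint D) {x w : H}
    (h : ∀ y ∈ D.domain, inner ℂ w y = inner ℂ x (D.val y)) : x ∈ D.domain ∧ D.val x = w := by
  have h' : ∀ y : D.domain, inner ℂ w (y : H) = inner ℂ x (D y) := fun y => by
    rw [apply_eq_val]; exact h y y.2
  have hx := mem_adjoint_domain_of_exists x ⟨w, h'⟩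
  have hxw := adjoint_apply_eq hD.dense_domain ⟨x, hx⟩ h'
  have key : ∃ hx : x ∈ D†.domain, D† ⟨x, hx⟩ = w := ⟨hx, hxw⟩
  rw [isSelfAdjoint_def.1 hD] at key
  obtain ⟨hx, hxw⟩ := key
  exact ⟨hx, (val_eq hx).trans hxw⟩

theorem isFormalAdjoint_of_isSelfAdjoint (hD : IsSelfAdjoint D) : D.IsFormalAdjoint D := by
  have := adjoint_isFormalAdjoint hD.dense_domain
  rwa [isSelfAdjoint_def.1 hD] at this

/-- A self-adjoint operator with compact resolvent is bounded below on every closed subspace that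
does not meet its kernel. -/
theorem exists_norm_le_mul_norm_val (hD : IsSelfAdjoint D)
    (hcomp : TotallyBounded {x | x ∈ D.domain ∧ ‖x‖ ≤ 1 ∧ ‖D.val x‖ ≤ 1}) {s : Submodule ℂ H}
    (hs : _root_.IsClosed (s : Set H)) (hker : ∀ x ∈ s, x ∈ D.domain → D.val x = 0 → x = 0) :
    ∃ c : ℝ, 0 < c ∧ ∀ x ∈ s, x ∈ D.domain → ‖x‖ ≤ c * ‖D.val x‖ := by
  by_contra! hcon
  have hseq : ∀ n : ℕ, ∃ x ∈ s, x ∈ D.domain ∧ ‖x‖ = 1 ∧ ‖D.val x‖ ≤ 1 / ((n : ℝ) + 1) := by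
    intro n
    obtain ⟨x, hxs, hxd, hx⟩ := hcon ((n : ℝ) + 1) (by positivity)
    have hpos : 0 < ‖x‖ := lt_of_le_of_lt (by positivity) hx
    refine ⟨((‖x‖⁻¹ : ℝ) : ℂ) • x, s.smul_mem _ hxs, D.domain.smul_mem _ hxd, ?_, ?_⟩
    · rw [norm_smul, Complex.norm_real, norm_inv, norm_norm, inv_mul_cancel₀ hpos.ne']
    · rw [val_smul _ hxd, norm_smul, Complex.norm_real, norm_inv, norm_norm,
        inv_mul_le_iff₀ hpos, mul_one_div, le_div_iff₀ (by positivity)]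
      linarith
  choose x hxs hxd hx1 hxD using hseq
  have hlim : Tendsto (fun n => D.val (x n)) atTop (𝓝 0) :=
    squeeze_zero_norm hxD tendsto_one_div_add_atTop_nhds_zero_nat
  have hcl := hcomp.closure.isCompact_of_isClosed isClosed_closure
  obtain ⟨x₀, -, φ, hφ, hx₀⟩ := hcl.tendsto_subseq (x := x) fun n => subset_closure
    ⟨hxd n, (hx1 n).le, (hxD n).trans (by
      rw [div_le_one (by positivity)]; linarith [(Nat.cast_nonneg n : (0 : ℝ) ≤ n)])⟩
  have hn : ‖x₀‖ = 1 := tendsto_nhds_unique hx₀.norm (by simp [hx1])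
  have hsx : x₀ ∈ s := hs.mem_of_tendsto hx₀ (Eventually.of_forall fun n => hxs (φ n))
  obtain ⟨hd, hv⟩ := exists_val_eq_of_isSelfAdjoint hD (x := x₀) (w := 0) fun y hy => by
    have hl : Tendsto (fun n => inner ℂ (D.val (x (φ n))) y) atTop (𝓝 (inner ℂ 0 y)) :=
      (hlim.comp hφ.tendsto_atTop).inner tendsto_const_nhds
    have hr : Tendsto (fun n => inner ℂ (x (φ n)) (D.val y)) atTop (𝓝 (inner ℂ x₀ (D.val y))) :=
      hx₀.inner tendsto_const_nhds
    refine tendsto_nhds_unique hl (hr.congr fun n => ?_)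
    exact ((isFormalAdjoint_of_isSelfAdjoint hD).inner_val (hxd _) hy).symm
  rw [hker x₀ hsx hd hv, norm_zero] at hn
  exact zero_ne_one hn

end Compactness

end LinearPMap

/-! ### Extensions of order-unit spaces of operators -/

namespace OrderUnitSpace

section Extension

variable {G : Type*} [NormedAddCommGroup G] [InnerProductSpace ℂ G] [CompleteSpace G]
  {H : Type*} [NormedAddCommGroup H] [InnerProductSpace ℂ H] [CompleteSpace H]

/-- The order-unit structure of `V` is that of a space of operators: the unit is the identity
operator, and both the order-unit norm and the supremum over the states are the operator norm. -/
structure IsOperatorSpace (V : Submodule ℝ (G →L[ℂ] G)) [OrderUnitSpace V] : Prop where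
  coe_unit : ((orderUnit : V) : G →L[ℂ] G) = 1
  ouNorm_eq : ∀ a : V, ouNorm a = ‖a‖
  norm_le : ∀ (a : V) (C : ℝ), 0 ≤ C → (∀ μ : State V, |μ.1 a| ≤ C) → ‖a‖ ≤ C
  exists_vectorState : ∀ x : G, ‖x‖ = 1 →
    ∃ μ : State V, ∀ a : V, μ.1 a = RCLike.re (inner ℂ ((a : G →L[ℂ] G) x) x)
  isSelfAdjoint : ∀ a : V, IsSelfAdjoint (a : G →L[ℂ] G)

theorem isOperatorSpace_ofSelfAdjoint {V : Submodule ℝ (G →L[ℂ] G)} (h1 : (1 : G →L[ℂ] G) ∈ V)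
    (hsa : ∀ v ∈ V, IsSelfAdjoint v) :
    @IsOperatorSpace G _ _ _ V (OrderUnitSpace.ofSelfAdjoint V h1 hsa) :=
  let _ := OrderUnitSpace.ofSelfAdjoint V h1 hsa
  { coe_unit := rfl
    ouNorm_eq := ouNorm_ofSelfAdjoint h1 hsa
    norm_le := fun a _ hC h => norm_le_of_forall_state h1 hsa a hC h
    exists_vectorState := fun x hx => ⟨vectorState h1 hsa x hx, fun _ => rfl⟩
    isSelfAdjoint := fun a => hsa a a.2 }

variable {VC : Submodule ℝ (G →L[ℂ] G)} [OrderUnitSpace VC]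

theorem IsOperatorSpace.hasTotallyBoundedBall (hVC : IsOperatorSpace VC) {LC : VC → ℝ} {X : Set G}
    (hX : TotallyBounded X) (h : ∀ x : VC, LC x ≤ 1 → ∃ r : ℝ, ∀ w : G, ‖w‖ ≤ 1 →
      (x : G →L[ℂ] G) w - (r : ℂ) • w ∈ X) : HasTotallyBoundedBall LC := by
  refine ⟨Subtype.val ⁻¹' {k : G →L[ℂ] G | IsSelfAdjoint k ∧ ∀ w, ‖w‖ ≤ 1 → k w ∈ X},
    totallyBounded_preimage isometry_subtype_coe.isUniformInducing
      (totallyBounded_selfAdjoint_operators hX), fun a ha => ?_⟩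
  obtain ⟨r, hr⟩ := h a ha
  refine ⟨r, hVC.isSelfAdjoint _, fun w hw => ?_⟩
  have e : ((a - r • (orderUnit : VC) : VC) : G →L[ℂ] G) w =
      (a : G →L[ℂ] G) w - (r : ℂ) • w := by
    have : ((a - r • (orderUnit : VC) : VC) : G →L[ℂ] G) = (a : G →L[ℂ] G) - r • 1 := by
      rw [← hVC.coe_unit]; rfl
    rw [this]
    simp
  rw [e]
  exact hr w hw

/-- A space of operators for which `{x w | L(x) ≤ 1, ‖w‖ ≤ 1}` is totally bounded modulo the
scalars: the operators are approximated by their compressions to a finite-dimensional space. -/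
theorem IsOperatorSpace.isLipNorm (hVC : IsOperatorSpace VC) {LC : VC → ℝ} {X : Set G}
    (hX : TotallyBounded X) (h : ∀ x : VC, LC x ≤ 1 → ∃ r : ℝ, ∀ w : G, ‖w‖ ≤ 1 →
      (x : G →L[ℂ] G) w - (r : ℂ) • w ∈ X) (hadd : ∀ a b, LC (a + b) ≤ LC a + LC b)
    (hsmul : ∀ (r : ℝ) a, LC (r • a) = |r| * LC a)
    (hzero : ∀ a, LC a = 0 ↔ ∃ r : ℝ, a = r • (orderUnit : VC)) : IsLipNorm LC :=
  (hVC.hasTotallyBoundedBall hX h).isLipNorm (fun a => (hVC.ouNorm_eq a).le) hadd hsmul hzero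

/-- The Calkin norm of `k + r` is at least `|r|` if no nonzero scalar is compact: otherwise the
compact operator `k` would be invertible by the Neumann series. -/
theorem abs_le_norm_of_compact_add [Nontrivial G]
    (huniq : ∀ c : ℝ, IsCompactOperator ((c : ℂ) • (1 : G →L[ℂ] G)) → c = 0)
    {k : G →L[ℂ] G} (hk : IsCompactOperator k) {r : ℝ} :
    |r| ≤ ‖k + (r : ℂ) • (1 : G →L[ℂ] G)‖ := by
  by_contra! hlt
  have hr : (r : ℂ) ≠ 0 := fun h => by
    have h0 : r = 0 := by exact_mod_cast h
    rw [h0, abs_zero] at hlt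
    exact absurd hlt (not_lt.2 (norm_nonneg _))
  have hu : IsUnit (1 - (r : ℂ)⁻¹ • (k + (r : ℂ) • (1 : G →L[ℂ] G))) := by
    refine isUnit_one_sub_of_norm_lt_one ?_
    rw [norm_smul, norm_inv, Complex.norm_real, Real.norm_eq_abs,
      inv_mul_lt_iff₀ (abs_pos.2 (by exact_mod_cast hr)), mul_one]
    exact hlt
  have he : 1 - (r : ℂ)⁻¹ • (k + (r : ℂ) • (1 : G →L[ℂ] G)) = (-(r : ℂ)⁻¹) • k := by
    rw [smul_add, smul_smul, inv_mul_cancel₀ hr, one_smul, neg_smul]; abel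
  rw [he] at hu
  obtain ⟨u, hu⟩ := hu
  have h1 : IsCompactOperator ((((-(r : ℂ)⁻¹) • k) ∘L (↑u⁻¹ : G →L[ℂ] G) : G →L[ℂ] G)) :=
    (hk.smul (-(r : ℂ)⁻¹)).comp_clm (↑u⁻¹ : G →L[ℂ] G)
  rw [← hu] at h1
  have h2 : (u : G →L[ℂ] G) ∘L (↑u⁻¹ : G →L[ℂ] G) = ((1 : ℝ) : ℂ) • 1 := by
    rw [Complex.ofReal_one, one_smul]; exact u.mul_inv
  rw [h2] at h1
  exact one_ne_zero (huniq 1 h1)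

/-- The norm of a compact element is at most the diameter times its Lipschitz seminorm: compare
vector states with the state `k + r ↦ r`. -/
theorem IsOperatorSpace.norm_compact_le (hVC : IsOperatorSpace VC)
    (huniq : ∀ c : ℝ, IsCompactOperator ((c : ℂ) • (1 : G →L[ℂ] G)) →
      (c : ℂ) • (1 : G →L[ℂ] G) = 0)
    (hdec : ∀ x : VC, ∃ k : G →L[ℂ] G, IsCompactOperator k ∧
      ∃ r : ℝ, (x : G →L[ℂ] G) = k + (r : ℂ) • (1 : G →L[ℂ] G))
    {LC : VC → ℝ} (hLC : IsLipNorm LC) {k : VC}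
    (hk : IsCompactOperator (k : G →L[ℂ] G)) : ‖k‖ ≤ LC k * (stateDiam LC).toReal := by
  have hnn : 0 ≤ LC k * (stateDiam LC).toReal := mul_nonneg (hLC.nonneg k) ENNReal.toReal_nonneg
  rcases subsingleton_or_nontrivial G with hG | hG
  · rw [Subsingleton.elim k 0, norm_zero]
    exact Subsingleton.elim k 0 ▸ hnn
  have huniq' : ∀ c : ℝ, IsCompactOperator ((c : ℂ) • (1 : G →L[ℂ] G)) → c = 0 := fun c hc => by
    have := huniq c hc
    rw [smul_eq_zero] at this
    exact_mod_cast this.resolve_right one_ne_zero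
  choose κ hκ lam hlam using hdec
  have hun : ∀ (x : VC) (k : G →L[ℂ] G) (r : ℝ), IsCompactOperator k →
      (x : G →L[ℂ] G) = k + (r : ℂ) • (1 : G →L[ℂ] G) → lam x = r := fun x k r hk hx => by
    have e : (((lam x - r : ℝ) : ℂ)) • (1 : G →L[ℂ] G) = k - κ x := by
      rw [Complex.ofReal_sub, sub_smul]
      have := (hlam x).symm.trans hx
      rw [sub_eq_sub_iff_add_eq_add, add_comm, this, add_comm]
    have hc : IsCompactOperator ((((lam x - r : ℝ) : ℂ)) • (1 : G →L[ℂ] G)) := by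
      rw [e]; exact hk.sub (hκ x)
    exact sub_eq_zero.1 (huniq' _ hc)
  -- `k + r ↦ r` is bounded by the norm, hence a state
  let ν : State VC := ⟨{ toFun := lam
                         map_add' := fun x y => hun _ (κ x + κ y) _ ((hκ x).add (hκ y)) (by
                           rw [Complex.ofReal_add, add_smul]
                           show (x : G →L[ℂ] G) + y = _
                           conv_lhs => rw [hlam x, hlam y]
                           abel)
                         map_smul' := fun r x => hun _ ((r : ℂ) • κ x) _ ((hκ x).smul (r : ℂ)) (by
                           rw [RingHom.id_apply, smul_eq_mul, Complex.ofReal_mul, mul_smul,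
                             ← smul_add, ← hlam x]
                           exact (Complex.coe_smul r (x : G →L[ℂ] G)).symm) },
    hun _ 0 1 isCompactOperator_zero (by rw [hVC.coe_unit]; simp), fun x => by
      rw [hVC.ouNorm_eq]
      exact (abs_le_norm_of_compact_add huniq' (hκ x) (r := lam x)).trans
        (congrArg norm (hlam x)).ge⟩
  have hνk : ν.1 k = 0 := hun k k 0 hk (by simp)
  refine norm_le_of_re_inner_le (hVC.isSelfAdjoint k) hnn fun x hx => ?_
  obtain ⟨μ, hμ⟩ := hVC.exists_vectorState x hx
  have := hLC.abs_sub_le hLC.stateDiam_ne_top μ ν k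
  rwa [hνk, sub_zero, hμ] at this

variable {VA : Submodule ℝ (H →L[ℂ] H)} [OrderUnitSpace VA]
  {VT : Submodule ℝ (G →L[ℂ] G)}

theorem IsLipNorm.const_mul {E : Type*} [AddCommGroup E] [Module ℝ E] [PartialOrder E]
    [OrderUnitSpace E] {L : E → ℝ} (hL : IsLipNorm L) {β : ℝ} (hβ : 0 < β) :
    (∀ a b, β * L (a + b) ≤ β * L a + β * L b) ∧ (∀ (r : ℝ) a, β * L (r • a) = |r| * (β * L a)) ∧
      ∀ a, β * L a = 0 ↔ ∃ r : ℝ, a = r • (orderUnit : E) := by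
  refine ⟨fun a b => ?_, fun r a => ?_, fun a => ?_⟩
  · rw [← mul_add]; exact mul_le_mul_of_nonneg_left (hL.add_le a b) hβ.le
  · rw [hL.smul_eq]; ring
  · rw [mul_eq_zero, or_iff_right hβ.ne', hL.eq_zero_iff]

theorem HasTotallyBoundedBall.exists_of_le {E : Type*} [NormedAddCommGroup E] [NormedSpace ℝ E]
    [PartialOrder E] [OrderUnitSpace E] {L : E → ℝ} (hL : IsLipNorm L)
    (h : HasTotallyBoundedBall L) {M : ℝ} (hM : 0 < M) :
    ∃ K : Set E, TotallyBounded K ∧ ∀ a, L a ≤ M → ∃ r : ℝ, a - r • (orderUnit : E) ∈ K := by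
  obtain ⟨K, hK, h⟩ := h
  refine ⟨(fun a => M • a) '' K, hK.image (uniformContinuous_const_smul M), fun a ha => ?_⟩
  obtain ⟨r, hr⟩ := h (M⁻¹ • a) (by
    rw [hL.smul_eq, abs_of_pos (inv_pos.2 hM), inv_mul_le_iff₀ hM, mul_one]; exact ha)
  refine ⟨M * r, _, hr, ?_⟩
  show M • (M⁻¹ • a - r • orderUnit) = a - (M * r) • orderUnit
  rw [smul_sub, smul_smul, smul_smul, mul_inv_cancel₀ hM.ne', one_smul]

/-- The common setting of the comparison: every `t ∈ V_T` is `T(a) + k` with `a ∈ V_A` and a compact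
`k ∈ V_C`, and the seminorms of `a` and `k` are controlled by that of `t`. -/
structure IsExtension (T : (H →L[ℂ] H) →ₗ[ℂ] (G →L[ℂ] G)) (LA : VA → ℝ) (LC : VC → ℝ) (LT : VT → ℝ)
    (α β : ℝ) : Prop where
  map_one : T 1 = 1
  norm_map_le : ∀ a, ‖T a‖ ≤ ‖a‖
  exists_decomposition : ∀ t : VT, ∃ (a : VA) (k : VC), IsCompactOperator (k : G →L[ℂ] G) ∧
    (t : G →L[ℂ] G) = T a + k ∧ LA a ≤ α * LT t ∧ β * LC k ≤ (1 + α * β) * LT t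

/-- The scalar `r` is the value at `a` of an arbitrary state; without states, `a = 0`. -/
theorem IsOperatorSpace.exists_norm_sub_le (hVA : IsOperatorSpace VA) {LA : VA → ℝ}
    (hLA : IsLipNorm LA) (a : VA) :
    ∃ r : ℝ, ‖(a : H →L[ℂ] H) - r • 1‖ ≤ LA a * (stateDiam LA).toReal := by
  have hnn : 0 ≤ LA a * (stateDiam LA).toReal := mul_nonneg (hLA.nonneg a) ENNReal.toReal_nonneg
  have he : ∀ r : ℝ, ((a - r • (orderUnit : VA) : VA) : H →L[ℂ] H) = a - r • 1 := fun r => by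
    rw [← hVA.coe_unit]; rfl
  rcases isEmpty_or_nonempty (State VA) with hS | ⟨⟨ν⟩⟩
  · refine ⟨0, ?_⟩
    rw [← he]
    exact hVA.norm_le (a - (0 : ℝ) • orderUnit) _ hnn fun μ => (hS.false μ).elim
  · refine ⟨ν.1 a, ?_⟩
    rw [← he]
    refine hVA.norm_le (a - ν.1 a • orderUnit) _ hnn fun μ => ?_
    rw [map_sub, State.map_smul_unit]
    exact hLA.abs_sub_le hLA.stateDiam_ne_top μ ν a

/-- An element `t = T(a) + k` is compared with `k / (1 + α β) + r`, where `r` is the value of a state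
at `a`: the distance is at most `‖a - r‖ + α β ‖k‖ / (1 + α β)`. -/
theorem IsExtension.exists_approx {T : (H →L[ℂ] H) →ₗ[ℂ] (G →L[ℂ] G)} {LA : VA → ℝ}
    {LC : VC → ℝ} {LT : VT → ℝ} {α β : ℝ} (h : IsExtension T LA LC LT α β) (hα : 0 < α) (hβ : 0 < β)
    (hVA : IsOperatorSpace VA) (hVC : IsOperatorSpace VC)
    (hLA : IsLipNorm LA) (hLC : IsLipNorm LC)
    (hnorm : ∀ k : VC, IsCompactOperator (k : G →L[ℂ] G) →
      ‖(k : G →L[ℂ] G)‖ ≤ LC k * (stateDiam LC).toReal) (t : VT) :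
    ∃ x : VC, β * LC x ≤ LT t ∧ ‖(t : G →L[ℂ] G) - x‖ ≤
      α * ((stateDiam LA).toReal + (stateDiam LC).toReal) * LT t := by
  obtain ⟨a, k, hkc, htak, ha, hk⟩ := h.exists_decomposition t
  set dA := (stateDiam LA).toReal
  set dC := (stateDiam LC).toReal
  have hdA : 0 ≤ dA := ENNReal.toReal_nonneg
  have hdC : 0 ≤ dC := ENNReal.toReal_nonneg
  have hc : 0 < 1 + α * β := by positivity
  obtain ⟨r, hr⟩ := hVA.exists_norm_sub_le hLA a
  refine ⟨(1 + α * β)⁻¹ • k + r • orderUnit, ?_, ?_⟩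
  · have h1 : LC ((1 + α * β)⁻¹ • k + r • orderUnit) ≤ (1 + α * β)⁻¹ * LC k := by
      refine (hLC.add_le _ _).trans ?_
      rw [(hLC.eq_zero_iff (r • orderUnit)).2 ⟨r, rfl⟩, add_zero, hLC.smul_eq,
        abs_of_pos (inv_pos.2 hc)]
    calc β * LC ((1 + α * β)⁻¹ • k + r • orderUnit) ≤ β * ((1 + α * β)⁻¹ * LC k) := by gcongr
      _ = (1 + α * β)⁻¹ * (β * LC k) := by ring
      _ ≤ LT t := by rwa [inv_mul_le_iff₀ hc]
  · have e : (t : G →L[ℂ] G) - (((1 + α * β)⁻¹ • k + r • orderUnit : VC) : G →L[ℂ] G) =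
        T ((a : H →L[ℂ] H) - r • 1) + (α * β * (1 + α * β)⁻¹) • (k : G →L[ℂ] G) := by
      have e1 : (((1 + α * β)⁻¹ • k + r • orderUnit : VC) : G →L[ℂ] G) =
          (1 + α * β)⁻¹ • (k : G →L[ℂ] G) + r • 1 := by
        rw [← hVC.coe_unit]; rfl
      have e2 : T ((a : H →L[ℂ] H) - r • 1) = T a - r • 1 := by
        rw [← Complex.coe_smul, map_sub, map_smul, h.map_one, Complex.coe_smul]
      have e3 : α * β * (1 + α * β)⁻¹ = 1 - (1 + α * β)⁻¹ := by field_simp; ring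
      rw [e1, e2, e3, htak, sub_smul, one_smul]; abel
    rw [e]
    have hk1 : α * β * (1 + α * β)⁻¹ * LC k ≤ α * LT t := by
      calc α * β * (1 + α * β)⁻¹ * LC k = α * ((1 + α * β)⁻¹ * (β * LC k)) := by ring
        _ ≤ α * LT t := by
          refine mul_le_mul_of_nonneg_left ?_ hα.le
          rwa [inv_mul_le_iff₀ hc]
    calc _ ≤ ‖T ((a : H →L[ℂ] H) - r • 1)‖ + ‖(α * β * (1 + α * β)⁻¹) • (k : G →L[ℂ] G)‖ :=
          norm_add_le _ _
      _ ≤ LA a * dA + α * β * (1 + α * β)⁻¹ * (LC k * dC) := by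
          refine add_le_add ((h.norm_map_le _).trans hr) ?_
          rw [norm_smul, Real.norm_of_nonneg (by positivity)]
          exact mul_le_mul_of_nonneg_left (hnorm k hkc) (by positivity)
      _ = LA a * dA + α * β * (1 + α * β)⁻¹ * LC k * dC := by ring
      _ ≤ α * LT t * dA + α * LT t * dC := by gcongr
      _ = _ := by ring

variable [OrderUnitSpace VT]

/-- The Lipschitz ball of `V_T` lies in `T` of a ball of `V_A` plus a ball of `V_C`. -/
theorem IsExtension.hasTotallyBoundedBall {T : (H →L[ℂ] H) →ₗ[ℂ] (G →L[ℂ] G)} {LA : VA → ℝ}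
    {LC : VC → ℝ} {LT : VT → ℝ} {α β : ℝ} (h : IsExtension T LA LC LT α β) (hα : 0 < α) (hβ : 0 < β)
    (hVA : IsOperatorSpace VA) (hVC : IsOperatorSpace VC) (hVT : IsOperatorSpace VT)
    (hLA : IsLipNorm LA) (hLC : IsLipNorm LC) (hbA : HasTotallyBoundedBall LA)
    (hbC : HasTotallyBoundedBall LC) : HasTotallyBoundedBall LT := by
  obtain ⟨KA, hKA, hA⟩ := hbA.exists_of_le hLA hα
  obtain ⟨KC, hKC, hC⟩ := hbC.exists_of_le hLC (M := β⁻¹ * (1 + α * β)) (by positivity)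
  let f : VA × VC → (G →L[ℂ] G) := fun p => T p.1 + p.2
  have hf : UniformContinuous f := by
    refine UniformContinuous.add ?_ (uniformContinuous_subtype_val.comp uniformContinuous_snd)
    refine (LipschitzWith.uniformContinuous (K := 1) (f := fun a : VA => T a) ?_).comp
      uniformContinuous_fst
    refine LipschitzWith.of_dist_le_mul fun a b => ?_
    rw [dist_eq_norm, dist_eq_norm, ← map_sub, NNReal.coe_one, one_mul]
    exact h.norm_map_le _
  refine ⟨Subtype.val ⁻¹' (f '' (KA ×ˢ KC)), totallyBounded_preimage
    isometry_subtype_coe.isUniformInducing ((hKA.prod_set hKC).image hf), fun t ht => ?_⟩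
  obtain ⟨a, k, -, htak, ha, hk⟩ := h.exists_decomposition t
  obtain ⟨r, hr⟩ := hA a (ha.trans (mul_le_of_le_one_right hα.le ht))
  obtain ⟨s, hs⟩ := hC k (by
    rw [← div_eq_inv_mul, le_div_iff₀ hβ, mul_comm]
    exact hk.trans (mul_le_of_le_one_right (by positivity) ht))
  refine ⟨r + s, ⟨(a - r • orderUnit, k - s • orderUnit), ⟨hr, hs⟩, ?_⟩⟩
  have e1 : T ((a - r • (orderUnit : VA) : VA) : H →L[ℂ] H) = T a - r • 1 := by
    have : ((a - r • (orderUnit : VA) : VA) : H →L[ℂ] H) = a - (r : ℂ) • 1 := by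
      rw [← hVA.coe_unit, Complex.coe_smul]; rfl
    rw [this, map_sub, map_smul, h.map_one, Complex.coe_smul]
  have e2 : ((k - s • (orderUnit : VC) : VC) : G →L[ℂ] G) = k - s • 1 := by
    rw [← hVC.coe_unit]; rfl
  have e3 : ((t - (r + s) • (orderUnit : VT) : VT) : G →L[ℂ] G) = t - (r + s) • 1 := by
    rw [← hVT.coe_unit]; rfl
  show T ((a - r • (orderUnit : VA) : VA) : H →L[ℂ] H) + ((k - s • (orderUnit : VC) : VC) :
    G →L[ℂ] G) = ((t - (r + s) • (orderUnit : VT) : VT) : G →L[ℂ] G)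
  rw [e1, e2, e3, htak, add_smul]; abel

theorem IsExtension.isLipNorm_and_quantumGHDist_le {T : (H →L[ℂ] H) →ₗ[ℂ] (G →L[ℂ] G)}
    {LA : VA → ℝ} {LC : VC → ℝ} {LT : VT → ℝ} {α β : ℝ} (h : IsExtension T LA LC LT α β)
    (hα : 0 < α) (hβ : 0 < β)
    (hVA : IsOperatorSpace VA) (hVC : IsOperatorSpace VC) (hVT : IsOperatorSpace VT)
    (hLA : IsLipNorm LA) (hLC : IsLipNorm LC)
    (hnorm : ∀ k : VC, IsCompactOperator (k : G →L[ℂ] G) →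
      ‖(k : G →L[ℂ] G)‖ ≤ LC k * (stateDiam LC).toReal)
    (hadd : ∀ s t, LT (s + t) ≤ LT s + LT t) (hsmul : ∀ (r : ℝ) t, LT (r • t) = |r| * LT t)
    (hzero : ∀ t, LT t = 0 ↔ ∃ r : ℝ, t = r • (orderUnit : VT))
    (hsub : VC ≤ VT) (hright : ∀ x : VC, LT ⟨x, hsub x.2⟩ ≤ β * LC x) :
    IsLipNorm LT ∧ IsLipNorm (fun x => β * LC x) ∧
      quantumGHDist LT (fun x => β * LC x) ≤
        ENNReal.ofReal α * (stateDiam LA + stateDiam LC) := by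
  have hbC := hLC.hasTotallyBoundedBall hVC.norm_le
  have hbT := h.hasTotallyBoundedBall hα hβ hVA hVC hVT hLA hLC
    (hLA.hasTotallyBoundedBall hVA.norm_le) hbC
  have hLT : IsLipNorm LT := hbT.isLipNorm (fun a => (hVT.ouNorm_eq a).le) hadd hsmul hzero
  obtain ⟨c1, c2, c3⟩ := hLC.const_mul hβ
  have hbC' : HasTotallyBoundedBall (fun x => β * LC x) := by
    obtain ⟨K, hK, hC⟩ := hbC.exists_of_le hLC (inv_pos.2 hβ)
    exact ⟨K, hK, fun a ha => hC a (by rwa [← mul_one β⁻¹, le_inv_mul_iff₀ hβ])⟩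
  have hLC' : IsLipNorm (fun x => β * LC x) :=
    hbC'.isLipNorm (fun a => (hVC.ouNorm_eq a).le) c1 c2 c3
  refine ⟨hLT, hLC', ?_⟩
  let ι : VC →ₗᵢ[ℝ] VT := ⟨Submodule.inclusion hsub, fun _ => rfl⟩
  have hι : ι orderUnit = orderUnit :=
    Subtype.ext ((hVC.coe_unit).trans hVT.coe_unit.symm)
  have key : quantumGHDist LT (fun x => β * LC x) ≤
      ENNReal.ofReal (α * ((stateDiam LA).toReal + (stateDiam LC).toReal)) := by
    refine ENNReal.le_of_forall_pos_le_add fun ε hε _ => ?_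
    have hε' : (0 : ℝ) < ε := hε
    have hnn : 0 ≤ α * ((stateDiam LA).toReal + (stateDiam LC).toReal) :=
      mul_nonneg hα.le (add_nonneg ENNReal.toReal_nonneg ENNReal.toReal_nonneg)
    rw [← ENNReal.ofReal_coe_nnreal, ← ENNReal.ofReal_add hnn hε'.le]
    -- the bridge needs a positive constant, but both diameters may vanish
    refine quantumGHDist_le_of_bridge hLT hLC' hbT hbC' hVT.ouNorm_eq hVC.ouNorm_eq hι
      (by positivity) (fun t => ?_) hright
    obtain ⟨x, hx, htx⟩ := h.exists_approx hα hβ hVA hVC hLA hLC hnorm t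
    refine ⟨x, hx, htx.trans ?_⟩
    have := hLT.nonneg t
    nlinarith
  rwa [ENNReal.ofReal_mul hα.le, ENNReal.ofReal_add ENNReal.toReal_nonneg ENNReal.toReal_nonneg,
    ENNReal.ofReal_toReal hLA.stateDiam_ne_top, ENNReal.ofReal_toReal hLC.stateDiam_ne_top] at key

end Extension

end OrderUnitSpace

/-! ### Toeplitz quadruples: the Dirac operator of the extension -/

/-- The adjoint of a compact operator is compact, as `‖k* x‖² ≤ ‖x‖ ‖k k* x‖`. -/
theorem isCompactOperator_star {G : Type*} [NormedAddCommGroup G] [InnerProductSpace ℂ G]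
    [CompleteSpace G] {k : G →L[ℂ] G} (hk : IsCompactOperator k) :
    IsCompactOperator (star k : G →L[ℂ] G) := by
  refine (isCompactOperator_iff_isCompact_closure_image_closedBall
    ((star k : G →L[ℂ] G) : G →ₗ[ℂ] G) one_pos).2 ?_
  refine TotallyBounded.isCompact_of_isClosed (TotallyBounded.closure ?_) isClosed_closure
  refine totallyBounded_of_uniform_separation fun ε hε => ⟨G, inferInstance, k, ε ^ 2 / 2,
    by positivity, ?_, ?_⟩
  · obtain ⟨K, hK, hkK⟩ := hk.image_closedBall_subset_compact (f := (k : G →ₗ[ℂ] G)) ‖star k‖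
    refine hK.totallyBounded.subset (Set.Subset.trans (Set.image_mono ?_) hkK)
    rintro _ ⟨x, hx, rfl⟩
    rw [mem_closedBall_zero_iff] at hx ⊢
    exact ((star k).le_opNorm x).trans (mul_le_of_le_one_right (norm_nonneg _) hx)
  · rintro _ ⟨x, hx, rfl⟩ _ ⟨y, hy, rfl⟩ hxy
    rw [mem_closedBall_zero_iff] at hx hy
    obtain ⟨u, hu⟩ : ∃ u, u = (star k) (x - y) := ⟨_, rfl⟩
    have hd : dist ((star k) x) ((star k) y) = ‖u‖ := by rw [dist_eq_norm, hu, map_sub]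
    have hd' : dist (k ((star k) x)) (k ((star k) y)) = ‖k u‖ := by
      rw [dist_eq_norm, hu, map_sub, map_sub]
    have hxy' : ‖k u‖ < ε ^ 2 / 2 := hd' ▸ hxy
    have h1 : ‖x - y‖ ≤ 2 := (norm_sub_le _ _).trans (by linarith)
    have h2 : ‖u‖ ^ 2 ≤ ‖x - y‖ * ‖k u‖ := by
      have e : inner ℂ u u = inner ℂ (x - y) (k u) := by
        calc inner ℂ u u = inner ℂ ((star k) (x - y)) u := by rw [← hu]
          _ = _ := by
            rw [ContinuousLinearMap.star_eq_adjoint, ContinuousLinearMap.adjoint_inner_left]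
      have h3 : ‖u‖ ^ 2 = ‖inner ℂ u u‖ := by
        rw [inner_self_eq_norm_sq_to_K]; simp
      rw [h3, e]
      exact norm_inner_le_norm _ _
    show dist ((star k) x) ((star k) y) < ε
    rw [hd]
    refine lt_of_pow_lt_pow_left₀ 2 hε.le ?_
    have := norm_nonneg (k u)
    nlinarith

section Toeplitz

variable {H : Type*} [NormedAddCommGroup H] [InnerProductSpace ℂ H] [CompleteSpace H]
  {𝒜 A : StarSubalgebra ℂ (H →L[ℂ] H)} {D : H →ₗ.[ℂ] H} {W : Submodule ℂ H} [CompleteSpace W]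

theorem restrictTo_val {H : Type*} [NormedAddCommGroup H] [InnerProductSpace ℂ H] {D : H →ₗ.[ℂ] H}
    {V : Submodule ℂ H} [V.HasOrthogonalProjection] {w : V}
    (hw : (w : H) ∈ D.domain) :
    (D.restrictTo V).val w = V.orthogonalProjectionOnto (D.val w) := by
  rw [LinearPMap.val_eq hw, LinearPMap.val_eq (show w ∈ (D.restrictTo V).domain from hw)]; rfl

theorem projOrth_apply {H : Type*} [NormedAddCommGroup H] [InnerProductSpace ℂ H]
    {W : Submodule ℂ H} [W.HasOrthogonalProjection] (x : H) :
    Wᗮ.starProjection x = x - W.starProjection x := by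
  rw [eq_sub_iff_add_eq, add_comm, W.starProjection_add_starProjection_orthogonal]

namespace IsToeplitzQuadruple

theorem isFormalAdjoint (hT : IsToeplitzQuadruple W 𝒜 A D) : D.IsFormalAdjoint D :=
  LinearPMap.isFormalAdjoint_of_isSelfAdjoint hT.isSelfAdjoint

theorem proj_mem (hT : IsToeplitzQuadruple W 𝒜 A D) {x : H} (hx : x ∈ D.domain) :
    W.starProjection x ∈ D.domain :=
  (hT.commutes ⟨x, hx⟩).1

theorem val_proj (hT : IsToeplitzQuadruple W 𝒜 A D) {x : H} (hx : x ∈ D.domain) :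
    D.val (W.starProjection x) = W.starProjection (D.val x) := by
  obtain ⟨h, h'⟩ := hT.commutes ⟨x, hx⟩
  rw [LinearPMap.val_eq h, LinearPMap.val_eq hx, h']

theorem proj_val_coe (hT : IsToeplitzQuadruple W 𝒜 A D) {w : W} (hw : (w : H) ∈ D.domain) :
    W.starProjection (D.val w) = D.val w := by
  rw [← hT.val_proj hw, W.starProjection_eq_self_iff.2 w.2]

theorem mem_extDirac_domain (hT : IsToeplitzQuadruple W 𝒜 A D) {α β : ℝ} {x : ExtSpace W} :
    x ∈ (extDirac W D α β).domain ↔ (x.fst : H) ∈ D.domain ∧ x.snd ∈ D.domain := by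
  constructor
  · rintro ⟨⟨⟨h2, h1⟩, -⟩, h3⟩
    have h2' : W.starProjection x.snd ∈ D.domain := h2
    have h3' : Wᗮ.starProjection x.snd ∈ D.domain := h3
    refine ⟨h1, ?_⟩
    have := D.domain.add_mem h2' h3'
    rwa [W.starProjection_add_starProjection_orthogonal] at this
  · rintro ⟨h1, h2⟩
    have h3 : Wᗮ.starProjection x.snd ∈ D.domain := by
      rw [projOrth_apply]; exact D.domain.sub_mem h2 (hT.proj_mem h2)
    exact ⟨⟨⟨hT.proj_mem h2, h1⟩, hT.proj_mem h2⟩, h3⟩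

theorem extDirac_val (hT : IsToeplitzQuadruple W 𝒜 A D) {α β : ℝ} {x : ExtSpace W}
    (h1 : (x.fst : H) ∈ D.domain)
    (h2 : x.snd ∈ D.domain) :
    (extDirac W D α β).val x = WithLp.toLp 2
      ((β : ℂ) • W.orthogonalProjectionOnto (D.val x.snd),
        (β : ℂ) • D.val x.fst + ((α⁻¹ : ℝ) : ℂ) • D.val x.snd) := by
  have h3 : Wᗮ.starProjection x.snd ∈ D.domain := by
    rw [projOrth_apply]; exact D.domain.sub_mem h2 (hT.proj_mem h2)
  have hP : W.starProjection x.snd ∈ D.domain := hT.proj_mem h2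
  have e1 : (D.restrictTo W).val (projOne W x) = W.orthogonalProjectionOnto (D.val x.fst) :=
    restrictTo_val h1
  have e2 : (D.restrictTo W).val (projTwo W x) = W.orthogonalProjectionOnto (D.val x.snd) := by
    have : (D.restrictTo W).val (projTwo W x) =
        W.orthogonalProjectionOnto (D.val (W.starProjection x.snd)) := restrictTo_val hP
    rw [this, hT.val_proj h2]
    exact W.orthogonalProjectionOnto_mem_subspace_eq_self _
  have e3 : (D.restrictTo Wᗮ).val (projThree W x) = Wᗮ.orthogonalProjectionOnto (D.val x.snd) := by
    have : (D.restrictTo Wᗮ).val (projThree W x) =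
        Wᗮ.orthogonalProjectionOnto (D.val (Wᗮ.starProjection x.snd)) := restrictTo_val h3
    rw [this, projOrth_apply, LinearPMap.val_sub h2 hP, hT.val_proj h2, ← projOrth_apply]
    exact Wᗮ.orthogonalProjectionOnto_mem_subspace_eq_self _
  have m1 : projOne W x ∈ (D.restrictTo W).domain := h1
  have m2 : projTwo W x ∈ (D.restrictTo W).domain := hP
  have m3 : projThree W x ∈ (D.restrictTo Wᗮ).domain := h3
  have key : (extDirac W D α β).val x =
      inclOne W ((β : ℂ) • (D.restrictTo W).val (projTwo W x)) +
      inclTwo W ((β : ℂ) • (D.restrictTo W).val (projOne W x)) +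
      inclTwo W (((α⁻¹ : ℝ) : ℂ) • (D.restrictTo W).val (projTwo W x)) +
      inclThree W (((α⁻¹ : ℝ) : ℂ) • (D.restrictTo Wᗮ).val (projThree W x)) := by
    rw [LinearPMap.val_eq m1, LinearPMap.val_eq m2, LinearPMap.val_eq m3,
      LinearPMap.val_eq (hT.mem_extDirac_domain.2 ⟨h1, h2⟩)]
    rfl
  rw [key, e1, e2, e3]
  have e4 : W.starProjection (D.val x.snd) + Wᗮ.starProjection (D.val x.snd) = D.val x.snd :=
    W.starProjection_add_starProjection_orthogonal _
  refine (WithLp.ofLp_injective 2) (Prod.ext ?_ ?_)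
  · show (β : ℂ) • W.orthogonalProjectionOnto (D.val x.snd) + 0 + 0 + 0 = _
    simp
  · show (0 : H) + (β : ℂ) • W.starProjection (D.val x.fst) +
      ((α⁻¹ : ℝ) : ℂ) • W.starProjection (D.val x.snd) +
      ((α⁻¹ : ℝ) : ℂ) • Wᗮ.starProjection (D.val x.snd) = _
    rw [hT.proj_val_coe h1, zero_add, add_assoc, ← smul_add, e4]

theorem extDirac_isFormalAdjoint (hT : IsToeplitzQuadruple W 𝒜 A D) (α β : ℝ) :
    (extDirac W D α β).IsFormalAdjoint (extDirac W D α β) := by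
  rintro ⟨x, hx⟩ ⟨y, hy⟩
  obtain ⟨hx1, hx2⟩ := hT.mem_extDirac_domain.1 hx
  obtain ⟨hy1, hy2⟩ := hT.mem_extDirac_domain.1 hy
  rw [LinearPMap.apply_eq_val, LinearPMap.apply_eq_val, hT.extDirac_val hx1 hx2,
    hT.extDirac_val hy1 hy2, WithLp.prod_inner_apply, WithLp.prod_inner_apply]
  have hs := hT.isFormalAdjoint
  have p1 : inner ℂ (W.orthogonalProjectionOnto (D.val x.snd)) y.fst =
      inner ℂ (x.snd) (D.val y.fst) := by
    rw [Submodule.inner_orthogonalProjectionOnto_eq_of_mem_right, hs.inner_val hx2 hy1]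
  have p2 : inner ℂ x.fst (W.orthogonalProjectionOnto (D.val y.snd)) =
      inner ℂ (D.val x.fst) y.snd := by
    rw [Submodule.inner_orthogonalProjectionOnto_eq_of_mem_left, hs.inner_val hx1 hy2]
  show inner ℂ ((β : ℂ) • W.orthogonalProjectionOnto (D.val x.snd)) y.fst +
      inner ℂ ((β : ℂ) • D.val x.fst + ((α⁻¹ : ℝ) : ℂ) • D.val x.snd) y.snd =
    inner ℂ x.fst ((β : ℂ) • W.orthogonalProjectionOnto (D.val y.snd)) +
      inner ℂ x.snd ((β : ℂ) • D.val y.fst + ((α⁻¹ : ℝ) : ℂ) • D.val y.snd)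
  rw [inner_smul_left, inner_smul_right, inner_add_left, inner_add_right, inner_smul_left,
    inner_smul_left, inner_smul_right, inner_smul_right, p1, p2, hs.inner_val hx2 hy2,
    Complex.conj_ofReal, Complex.conj_ofReal]
  ring

end IsToeplitzQuadruple

end Toeplitz

/-! ### Compressions and the symbol -/

section Compression

variable {H : Type*} [NormedAddCommGroup H] [InnerProductSpace ℂ H] {D : H →ₗ.[ℂ] H}
  {W : Submodule ℂ H}

theorem calkinMap_eq_iff {s t : W →L[ℂ] W} :
    calkinMap W s = calkinMap W t ↔ IsCompactOperator (s - t : W →L[ℂ] W) :=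
  Submodule.Quotient.eq _

variable [CompleteSpace W]

theorem toeplitzMap_apply (a : H →L[ℂ] H) (w : W) :
    toeplitzMap W a w = W.orthogonalProjectionOnto (a w) := rfl

theorem toeplitzMap_one : toeplitzMap W (1 : H →L[ℂ] H) = 1 := by
  ext w; simp [toeplitzMap]

theorem norm_toeplitzMap_le (a : H →L[ℂ] H) : ‖toeplitzMap W a‖ ≤ ‖a‖ :=
  ContinuousLinearMap.opNorm_le_bound _ (norm_nonneg a) fun w =>
    (W.norm_orthogonalProjectionOnto_apply_le (a w)).trans (a.le_opNorm w)

theorem isCompactOperator_of_mem {k : W →L[ℂ] W} (hk : k ∈ compactLipSelfAdjoint W D) :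
    IsCompactOperator k := hk.1.1

end Compression

section Toeplitz

variable {H : Type*} [NormedAddCommGroup H] [InnerProductSpace ℂ H] [CompleteSpace H]
  {𝒜 A : StarSubalgebra ℂ (H →L[ℂ] H)} {D : H →ₗ.[ℂ] H} {W : Submodule ℂ H} [CompleteSpace W]

theorem toeplitzMap_star (a : H →L[ℂ] H) : toeplitzMap W (star a) = star (toeplitzMap W a) := by
  rw [ContinuousLinearMap.star_eq_adjoint, ContinuousLinearMap.star_eq_adjoint]
  refine (ContinuousLinearMap.eq_adjoint_iff _ _).2 fun x y => ?_
  rw [toeplitzMap_apply, toeplitzMap_apply,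
    Submodule.inner_orthogonalProjectionOnto_eq_of_mem_right,
    Submodule.inner_orthogonalProjectionOnto_eq_of_mem_left, ContinuousLinearMap.adjoint_inner_left]

theorem star_toeplitzMap_add (a : H →L[ℂ] H) (k : W →L[ℂ] W) :
    star (toeplitzMap W a + k) = toeplitzMap W (star a) + star k := by
  rw [toeplitzMap_star]; exact star_add (toeplitzMap W a) k

namespace IsToeplitzQuadruple

theorem eq_of_isCompactOperator (hT : IsToeplitzQuadruple W 𝒜 A D) {a b : H →L[ℂ] H} (ha : a ∈ 𝒜)
    (hb : b ∈ 𝒜) (h : IsCompactOperator (toeplitzMap W a - toeplitzMap W b : W →L[ℂ] W)) : a = b :=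
  hT.faithful ha hb (calkinMap_eq_iff.2 h)

/-- As `φ` is injective, `PH` is infinite dimensional or zero. -/
theorem smul_one_eq_zero (hT : IsToeplitzQuadruple W 𝒜 A D) (c : ℝ)
    (h : IsCompactOperator ((c : ℂ) • (1 : W →L[ℂ] W))) : (c : ℂ) • (1 : W →L[ℂ] W) = 0 := by
  have h0 : (c : ℂ) • (1 : H →L[ℂ] H) = 0 :=
    hT.eq_of_isCompactOperator (𝒜.smul_mem 𝒜.one_mem _) 𝒜.zero_mem (by
      rw [map_smul, toeplitzMap_one, map_zero, sub_zero]; exact h)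
  rw [← toeplitzMap_one, ← map_smul, h0, map_zero]

theorem rhoMap_eq (hT : IsToeplitzQuadruple W 𝒜 A D) {a : H →L[ℂ] H} (ha : a ∈ 𝒜) {k : W →L[ℂ] W}
    (hk : IsCompactOperator k) : rhoMap W 𝒜 (toeplitzMap W a + k) = a := by
  have hak : symbolMap W a = calkinMap W (toeplitzMap W a + k) := calkinMap_eq_iff.2 (by
    rw [sub_add_cancel_left]; exact hk.neg)
  have h : ∃ b ∈ (𝒜 : Set (H →L[ℂ] H)), symbolMap W b = calkinMap W (toeplitzMap W a + k) :=
    ⟨a, ha, hak⟩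
  exact hT.faithful (Function.invFunOn_mem h) ha ((Function.invFunOn_eq h).trans hak.symm)

/-- The components of a self-adjoint `T(a) + k` are self-adjoint, by injectivity of `φ`. -/
theorem mem_spaceT_iff (hT : IsToeplitzQuadruple W 𝒜 A D) {t : W →L[ℂ] W} :
    t ∈ spaceT W A D ↔
      ∃ a ∈ spaceA A, ∃ k ∈ compactLipSelfAdjoint W D, t = toeplitzMap W a + k := by
  constructor
  · rintro ⟨ht, hts⟩
    have hts' : star t = t := hts
    obtain ⟨y, ⟨a, ha, rfl⟩, k, hk, rfl⟩ := Submodule.mem_sup.1 ht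
    have haA : a ∈ A := ha
    rw [star_toeplitzMap_add] at hts'
    have has : star a = a :=
      hT.eq_of_isCompactOperator (hT.le (star_mem haA)) (hT.le haA) (by
        have e : (toeplitzMap W (star a) - toeplitzMap W a : W →L[ℂ] W) = k - star k := by
          rw [sub_eq_sub_iff_add_eq_add, hts', add_comm]
        rw [e]; exact hk.1.sub (isCompactOperator_star hk.1))
    rw [has] at hts'
    exact ⟨a, ⟨haA, has⟩, k, ⟨hk, add_left_cancel hts'⟩, rfl⟩
  · rintro ⟨a, ha, k, hk, rfl⟩
    refine ⟨Submodule.add_mem_sup ⟨a, ha.1, rfl⟩ hk.1, ?_⟩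
    have has : star a = a := ha.2
    have hks : star k = k := hk.2
    show star (toeplitzMap W a + k) = _
    rw [star_toeplitzMap_add, has, hks]

theorem piMap_toeplitzMap_add (hT : IsToeplitzQuadruple W 𝒜 A D) {a : H →L[ℂ] H} (ha : a ∈ spaceA A)
    {k : W →L[ℂ] W} (hk : k ∈ compactLipSelfAdjoint W D) (x : ExtSpace W) :
    piMap W 𝒜 (toeplitzMap W a + k) x =
      WithLp.toLp 2 (W.orthogonalProjectionOnto (a x.fst) + k x.fst, a x.snd) := by
  have h := hT.rhoMap_eq (hT.le ha.1) (isCompactOperator_of_mem hk)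
  show WithLp.toLp 2 ((toeplitzMap W a + k) x.fst, rhoMap W 𝒜 (toeplitzMap W a + k) x.snd) = _
  rw [h]; rfl

theorem piMap_add (hT : IsToeplitzQuadruple W 𝒜 A D) {s t : W →L[ℂ] W} (hs : s ∈ spaceT W A D)
    (ht : t ∈ spaceT W A D) : piMap W 𝒜 (s + t) = piMap W 𝒜 s + piMap W 𝒜 t := by
  obtain ⟨a, ha, k, hk, rfl⟩ := hT.mem_spaceT_iff.1 hs
  obtain ⟨b, hb, l, hl, rfl⟩ := hT.mem_spaceT_iff.1 ht
  ext1 x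
  have e : toeplitzMap W a + k + (toeplitzMap W b + l) = toeplitzMap W (a + b) + (k + l) := by
    rw [map_add]; abel
  rw [e, add_apply, hT.piMap_toeplitzMap_add (add_mem ha hb) (add_mem hk hl), hT.piMap_toeplitzMap_add ha hk,
    hT.piMap_toeplitzMap_add hb hl, ← WithLp.toLp_add, Prod.mk_add_mk]
  congr 2
  simp only [add_apply, map_add]
  abel

theorem piMap_smul (hT : IsToeplitzQuadruple W 𝒜 A D) (r : ℝ) {t : W →L[ℂ] W}
    (ht : t ∈ spaceT W A D) : piMap W 𝒜 (r • t) = (r : ℂ) • piMap W 𝒜 t := by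
  obtain ⟨a, ha, k, hk, rfl⟩ := hT.mem_spaceT_iff.1 ht
  ext1 x
  have e : r • (toeplitzMap W a + k) = toeplitzMap W (r • a) + r • k := by
    have h1 : (r : ℂ) • toeplitzMap W a = r • toeplitzMap W a := rfl
    rw [← Complex.coe_smul r a, map_smul, h1]
    exact smul_add r (toeplitzMap W a) k
  rw [e, hT.piMap_toeplitzMap_add ((spaceA A).smul_mem r ha) ((compactLipSelfAdjoint W D).smul_mem r hk)]
  show _ = (r : ℂ) • (piMap W 𝒜 (toeplitzMap W a + k) x)
  rw [hT.piMap_toeplitzMap_add ha hk, ← WithLp.toLp_smul, Prod.smul_mk]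
  have e1 : (r • a) (x.fst : H) = (r : ℂ) • a x.fst := (Complex.coe_smul r _).symm
  have e2 : (r • a) x.snd = (r : ℂ) • a x.snd := (Complex.coe_smul r _).symm
  have e3 : (r • k) x.fst = (r : ℂ) • k x.fst := (Complex.coe_smul r _).symm
  rw [e1, e2, e3, map_smul, smul_add]

theorem piMap_one (hT : IsToeplitzQuadruple W 𝒜 A D) : piMap W 𝒜 1 = 1 := by
  ext1 x
  have h1 : (1 : H →L[ℂ] H) ∈ spaceA A := ⟨A.one_mem, IsSelfAdjoint.one _⟩
  have := hT.piMap_toeplitzMap_add h1 (compactLipSelfAdjoint W D).zero_mem x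
  rw [toeplitzMap_one, add_zero] at this
  rw [this]
  refine (WithLp.ofLp_injective 2) (Prod.ext ?_ rfl)
  show W.orthogonalProjectionOnto (x.fst : H) + 0 = x.fst
  rw [add_zero, W.orthogonalProjectionOnto_mem_subspace_eq_self]

theorem isSelfAdjoint_piMap (hT : IsToeplitzQuadruple W 𝒜 A D) {t : W →L[ℂ] W}
    (ht : t ∈ spaceT W A D) : IsSelfAdjoint (piMap W 𝒜 t) := by
  have hts : IsSelfAdjoint t := ht.2
  obtain ⟨a, ha, k, hk, rfl⟩ := hT.mem_spaceT_iff.1 ht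
  have has : IsSelfAdjoint a := ha.2
  rw [ContinuousLinearMap.isSelfAdjoint_iff_isSymmetric] at hts has ⊢
  intro x y
  show inner ℂ (piMap W 𝒜 (toeplitzMap W a + k) x) y = inner ℂ x (piMap W 𝒜 (toeplitzMap W a + k) y)
  rw [hT.piMap_toeplitzMap_add ha hk, hT.piMap_toeplitzMap_add ha hk, WithLp.prod_inner_apply, WithLp.prod_inner_apply]
  exact congrArg₂ (· + ·) (hts x.fst y.fst) (has x.snd y.snd)

end IsToeplitzQuadruple

end Toeplitz

/-! ### The compact operators of finite Lipschitz norm -/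

theorem sub_smul_eq_sub_of_add_smul_eq {R M : Type*} [Ring R] [AddCommGroup M] [Module R M]
    {k l u : M} {r s : R} (h : k + r • u = l + s • u) : (r - s) • u = l - k := by
  rw [sub_smul, sub_eq_sub_iff_add_eq_add, add_comm, h]

section CompactPart

variable {H : Type*} [NormedAddCommGroup H] [InnerProductSpace ℂ H] {D : H →ₗ.[ℂ] H}
  {W : Submodule ℂ H} [CompleteSpace W]

variable (D) in
/-- The norm `‖D_p k‖`. -/
def diracNorm (k : W →L[ℂ] W) : ℝ := ((D.restrictTo W).mulRight (k : W →ₗ[ℂ] W)).opNorm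

theorem diracNorm_nonneg {k : W →L[ℂ] W} : 0 ≤ diracNorm D k := LinearPMap.opNorm_nonneg

theorem apply_mem_of_mem_compactLipSelfAdjoint {k : W →L[ℂ] W}
    (hk : k ∈ compactLipSelfAdjoint W D) (w : W) : (k w : H) ∈ D.domain := by
  have : w ∈ ((D.restrictTo W).mulRight (k : W →ₗ[ℂ] W)).domain :=
    hk.1.2.1 ▸ Submodule.mem_top
  exact this

theorem mem_spaceC_iff {x : W →L[ℂ] W} : x ∈ spaceC W D ↔
    ∃ k ∈ compactLipSelfAdjoint W D, ∃ r : ℝ, x = k + (r : ℂ) • (1 : W →L[ℂ] W) := by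
  constructor
  · intro hx
    obtain ⟨k, hk, z, hz, rfl⟩ := Submodule.mem_sup.1 hx
    obtain ⟨r, rfl⟩ := Submodule.mem_span_singleton.1 hz
    exact ⟨k, hk, r, rfl⟩
  · rintro ⟨k, hk, r, rfl⟩
    exact Submodule.add_mem_sup hk (Submodule.mem_span_singleton.2 ⟨r, rfl⟩)

end CompactPart

section Toeplitz

variable {H : Type*} [NormedAddCommGroup H] [InnerProductSpace ℂ H] [CompleteSpace H]
  {𝒜 A : StarSubalgebra ℂ (H →L[ℂ] H)} {D : H →ₗ.[ℂ] H} {W : Submodule ℂ H} [CompleteSpace W]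

namespace IsToeplitzQuadruple

theorem norm_val_restrictTo (hT : IsToeplitzQuadruple W 𝒜 A D) {w : W} (hw : (w : H) ∈ D.domain) :
    ‖(D.restrictTo W).val w‖ = ‖D.val w‖ := by
  rw [restrictTo_val hw]
  exact congrArg norm (hT.proj_val_coe hw)

theorem norm_val_le_diracNorm (hT : IsToeplitzQuadruple W 𝒜 A D) {k : W →L[ℂ] W}
    (hk : k ∈ compactLipSelfAdjoint W D) (w : W) : ‖D.val (k w)‖ ≤ diracNorm D k * ‖w‖ := by
  have hw := apply_mem_of_mem_compactLipSelfAdjoint hk w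
  have h := LinearPMap.IsBounded.le_opNorm hk.1.2.2.1 (x := w) hw
  rw [LinearPMap.val_mulRight (show (k : W →ₗ[ℂ] W) w ∈ (D.restrictTo W).domain from hw)] at h
  rw [← hT.norm_val_restrictTo hw]
  exact h

theorem diracNorm_le (hT : IsToeplitzQuadruple W 𝒜 A D) {k : W →L[ℂ] W}
    (hk : k ∈ compactLipSelfAdjoint W D) {C : ℝ} (hC : 0 ≤ C)
    (h : ∀ w : W, ‖D.val (k w)‖ ≤ C * ‖w‖) : diracNorm D k ≤ C := by
  refine LinearPMap.opNorm_le hC fun w _ => ?_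
  have hw := apply_mem_of_mem_compactLipSelfAdjoint hk w
  rw [LinearPMap.val_mulRight (show (k : W →ₗ[ℂ] W) w ∈ (D.restrictTo W).domain from hw)]
  exact (hT.norm_val_restrictTo hw).trans_le (h w)

theorem diracNorm_add_le (hT : IsToeplitzQuadruple W 𝒜 A D) {k l : W →L[ℂ] W}
    (hk : k ∈ compactLipSelfAdjoint W D) (hl : l ∈ compactLipSelfAdjoint W D) :
    diracNorm D (k + l) ≤ diracNorm D k + diracNorm D l := by
  refine hT.diracNorm_le (add_mem hk hl) (add_nonneg diracNorm_nonneg diracNorm_nonneg) fun w => ?_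
  show ‖D.val ((k w : H) + (l w : H))‖ ≤ _
  rw [LinearPMap.val_add (apply_mem_of_mem_compactLipSelfAdjoint hk w)
    (apply_mem_of_mem_compactLipSelfAdjoint hl w), add_mul]
  exact (norm_add_le _ _).trans
    (add_le_add (hT.norm_val_le_diracNorm hk w) (hT.norm_val_le_diracNorm hl w))

theorem diracNorm_smul_le (hT : IsToeplitzQuadruple W 𝒜 A D) {k : W →L[ℂ] W}
    (hk : k ∈ compactLipSelfAdjoint W D) (r : ℝ) :
    diracNorm D (r • k) ≤ |r| * diracNorm D k := by
  refine hT.diracNorm_le ((compactLipSelfAdjoint W D).smul_mem r hk)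
    (mul_nonneg (abs_nonneg r) diracNorm_nonneg) fun w => ?_
  show ‖D.val ((r : ℂ) • (k w : H))‖ ≤ _
  rw [LinearPMap.val_smul _ (apply_mem_of_mem_compactLipSelfAdjoint hk w), norm_smul,
    Complex.norm_real, Real.norm_eq_abs, mul_assoc]
  exact mul_le_mul_of_nonneg_left (hT.norm_val_le_diracNorm hk w) (abs_nonneg r)

theorem diracNorm_smul (hT : IsToeplitzQuadruple W 𝒜 A D) {k : W →L[ℂ] W}
    (hk : k ∈ compactLipSelfAdjoint W D) (r : ℝ) :
    diracNorm D (r • k) = |r| * diracNorm D k := by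
  refine le_antisymm (hT.diracNorm_smul_le hk r) ?_
  rcases eq_or_ne r 0 with rfl | hr
  · rw [abs_zero, zero_mul]; exact diracNorm_nonneg
  · have h := hT.diracNorm_smul_le ((compactLipSelfAdjoint W D).smul_mem r hk) r⁻¹
    have e : r⁻¹ • r • k = k := by
      ext w
      show ((r⁻¹ : ℝ) : ℂ) • (r : ℂ) • (k w : H) = k w
      rw [smul_smul, ← Complex.ofReal_mul, inv_mul_cancel₀ hr, Complex.ofReal_one, one_smul]
    rw [e, abs_inv, ← div_eq_inv_mul, le_div_iff₀ (abs_pos.2 hr)] at h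
    linarith

theorem ker_val (hT : IsToeplitzQuadruple W 𝒜 A D) {x : H} (hx : x ∈ W) (hd : x ∈ D.domain)
    (h : D.val x = 0) : x = 0 := by
  have hm : (⟨x, hx⟩ : W) ∈ (D.restrictTo W).domain := hd
  have := hT.ker_trivial ⟨⟨x, hx⟩, hm⟩ (by
    rw [LinearPMap.apply_eq_val, restrictTo_val (w := ⟨x, hx⟩) hd]
    show W.orthogonalProjectionOnto (D.val x) = 0
    rw [h, map_zero])
  exact congrArg (fun y : (D.restrictTo W).domain => ((y : W) : H)) this

theorem eq_zero_of_diracNorm_eq_zero (hT : IsToeplitzQuadruple W 𝒜 A D) {k : W →L[ℂ] W}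
    (hk : k ∈ compactLipSelfAdjoint W D) (h : diracNorm D k = 0) : k = 0 := by
  ext w
  refine hT.ker_val (k w).2 (apply_mem_of_mem_compactLipSelfAdjoint hk w) ?_
  have := hT.norm_val_le_diracNorm hk w
  rwa [h, zero_mul, norm_le_zero_iff] at this

/-- `k D_p` is contained in the adjoint of `D_p k`, so it has at most the same norm. -/
theorem norm_apply_proj_val_le (hT : IsToeplitzQuadruple W 𝒜 A D) {k : W →L[ℂ] W}
    (hk : k ∈ compactLipSelfAdjoint W D) {x : H} (hx : x ∈ D.domain) :
    ‖k (W.orthogonalProjectionOnto (D.val x))‖ ≤ diracNorm D k * ‖x‖ := by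
  have hs : ∀ u v : W, inner ℂ (k u) v = inner ℂ u (k v) :=
    fun u v => (ContinuousLinearMap.isSelfAdjoint_iff_isSymmetric.1 hk.2) u v
  refine LinearPMap.norm_le_of_forall_inner_le (mul_nonneg diracNorm_nonneg (norm_nonneg x))
    dense_univ fun y _ => ?_
  rw [hs, Submodule.inner_orthogonalProjectionOnto_eq_of_mem_right,
    hT.isFormalAdjoint.inner_val hx (apply_mem_of_mem_compactLipSelfAdjoint hk y)]
  calc _ ≤ ‖x‖ * ‖D.val (k y)‖ := norm_inner_le_norm _ _
    _ ≤ ‖x‖ * (diracNorm D k * ‖y‖) :=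
      mul_le_mul_of_nonneg_left (hT.norm_val_le_diracNorm hk y) (norm_nonneg x)
    _ = _ := by ring

theorem continuous_val_apply (hT : IsToeplitzQuadruple W 𝒜 A D) {k : W →L[ℂ] W}
    (hk : k ∈ compactLipSelfAdjoint W D) : Continuous fun w => D.val (k w) := by
  refine LipschitzWith.continuous (K := ⟨diracNorm D k, diracNorm_nonneg⟩)
    (LipschitzWith.of_dist_le_mul fun x y => ?_)
  rw [dist_eq_norm, dist_eq_norm, ← LinearPMap.val_sub
    (apply_mem_of_mem_compactLipSelfAdjoint hk x) (apply_mem_of_mem_compactLipSelfAdjoint hk y)]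
  have := hT.norm_val_le_diracNorm hk (x - y)
  rw [map_sub] at this
  exact this

/-! ### The Lip-norm of the compact part -/

theorem eq_of_add_smul_one_eq (hT : IsToeplitzQuadruple W 𝒜 A D) {k l : W →L[ℂ] W}
    (hk : IsCompactOperator k) (hl : IsCompactOperator l) {r s : ℝ}
    (h : k + (r : ℂ) • (1 : W →L[ℂ] W) = l + (s : ℂ) • (1 : W →L[ℂ] W)) : k = l := by
  have e : (((r - s : ℝ) : ℂ)) • (1 : W →L[ℂ] W) = l - k := by
    rw [Complex.ofReal_sub]; exact sub_smul_eq_sub_of_add_smul_eq h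
  have h0 := hT.smul_one_eq_zero (r - s) (by rw [e]; exact hl.sub hk)
  rw [e] at h0
  exact (sub_eq_zero.1 h0).symm

theorem compactPart_eq (hT : IsToeplitzQuadruple W 𝒜 A D) {k : W →L[ℂ] W}
    (hk : k ∈ compactLipSelfAdjoint W D) {r : ℝ} {x : spaceC W D}
    (hx : (x : W →L[ℂ] W) = k + (r : ℂ) • (1 : W →L[ℂ] W)) : compactPart W D x = k := by
  obtain ⟨hc, z, hz, hcz⟩ := (Submodule.mem_sup.1 x.2).choose_spec
  obtain ⟨s, rfl⟩ := Submodule.mem_span_singleton.1 hz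
  have h : compactPart W D x + (s : ℂ) • (1 : W →L[ℂ] W) = k + (r : ℂ) • (1 : W →L[ℂ] W) :=
    hcz.trans hx
  exact hT.eq_of_add_smul_one_eq (isCompactOperator_of_mem hc) (isCompactOperator_of_mem hk) h

theorem lipC_eq (hT : IsToeplitzQuadruple W 𝒜 A D) {k : W →L[ℂ] W}
    (hk : k ∈ compactLipSelfAdjoint W D) {r : ℝ} {x : spaceC W D}
    (hx : (x : W →L[ℂ] W) = k + (r : ℂ) • (1 : W →L[ℂ] W)) : lipC W D x = diracNorm D k := by
  rw [lipC, hT.compactPart_eq hk hx]; rfl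

end IsToeplitzQuadruple

end Toeplitz

/-! ### The order-unit spaces of the extension -/

theorem WithLp.norm_le_norm_fst_add_norm_snd {E F : Type*} [NormedAddCommGroup E]
    [NormedAddCommGroup F] (x : WithLp 2 (E × F)) : ‖x‖ ≤ ‖x.fst‖ + ‖x.snd‖ := by
  refine le_of_sq_le_sq ?_ (by positivity)
  rw [WithLp.prod_norm_sq_eq_of_L2]
  nlinarith [norm_nonneg x.fst, norm_nonneg x.snd]

theorem isOperatorSpace_spaceC {H : Type*} [NormedAddCommGroup H] [InnerProductSpace ℂ H]
    {D : H →ₗ.[ℂ] H} {W : Submodule ℂ H} [CompleteSpace W] :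
    OrderUnitSpace.IsOperatorSpace (spaceC W D) :=
  OrderUnitSpace.isOperatorSpace_ofSelfAdjoint _ fun v hv => by
    obtain ⟨k, hk, r, rfl⟩ := mem_spaceC_iff.1 hv
    exact IsSelfAdjoint.add hk.2 (IsSelfAdjoint.smul (Complex.conj_ofReal r) (IsSelfAdjoint.one _))

section Toeplitz

variable {H : Type*} [NormedAddCommGroup H] [InnerProductSpace ℂ H] [CompleteSpace H]
  {𝒜 A : StarSubalgebra ℂ (H →L[ℂ] H)} {D : H →ₗ.[ℂ] H} {W : Submodule ℂ H} [CompleteSpace W]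

theorem isOperatorSpace_spaceA : OrderUnitSpace.IsOperatorSpace (spaceA A) :=
  OrderUnitSpace.isOperatorSpace_ofSelfAdjoint (V := spaceA A) _ fun _ hv => hv.2

theorem isOperatorSpace_spaceT : OrderUnitSpace.IsOperatorSpace (spaceT W A D) :=
  OrderUnitSpace.isOperatorSpace_ofSelfAdjoint (V := spaceT W A D) _ fun _ hv => hv.2

namespace IsToeplitzQuadruple

theorem exists_lipC_eq (hT : IsToeplitzQuadruple W 𝒜 A D) (x : spaceC W D) :
    ∃ k ∈ compactLipSelfAdjoint W D, ∃ r : ℝ,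
      (x : W →L[ℂ] W) = k + (r : ℂ) • (1 : W →L[ℂ] W) ∧ lipC W D x = diracNorm D k := by
  obtain ⟨k, hk, r, hx⟩ := mem_spaceC_iff.1 x.2
  exact ⟨k, hk, r, hx, hT.lipC_eq hk hx⟩

/-- As `D_p` has trivial kernel, a bound for `D w` bounds `w`; the resolvent gives compactness. -/
theorem totallyBounded_graph_ball (hT : IsToeplitzQuadruple W 𝒜 A D) :
    TotallyBounded {w : W | (w : H) ∈ D.domain ∧ ‖D.val w‖ ≤ 1} := by
  obtain ⟨R, hRc, hR⟩ := hT.compact_resolvent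
  have hcl : IsClosed (W : Set H) := (completeSpace_coe_iff_isComplete.1 ‹_›).isClosed
  obtain ⟨c, hc, h⟩ := LinearPMap.exists_norm_le_mul_norm_val hT.isSelfAdjoint
    (LinearPMap.totallyBounded_graph_ball hT.isFormalAdjoint hRc hR 1) hcl
    fun x hx hd h0 => hT.ker_val hx hd h0
  refine (totallyBounded_preimage isometry_subtype_coe.isUniformInducing
    (LinearPMap.totallyBounded_graph_ball hT.isFormalAdjoint hRc hR (max c 1))).subset ?_
  rintro w ⟨hw, hDw⟩
  exact ⟨hw, ((h w w.2 hw).trans (mul_le_of_le_one_right hc.le hDw)).trans (le_max_left _ _),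
    hDw.trans (le_max_right _ _)⟩

theorem mem_graph_ball_of_lipC_le_one (hT : IsToeplitzQuadruple W 𝒜 A D) {x : spaceC W D}
    (hx : lipC W D x ≤ 1) : ∃ r : ℝ, ∀ w : W, ‖w‖ ≤ 1 →
      (x : W →L[ℂ] W) w - (r : ℂ) • w ∈ {w : W | (w : H) ∈ D.domain ∧ ‖D.val w‖ ≤ 1} := by
  obtain ⟨k, hk, r, hxk, hL⟩ := hT.exists_lipC_eq x
  refine ⟨r, fun w hw => ?_⟩
  have e : (x : W →L[ℂ] W) w - (r : ℂ) • w = k w := by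
    rw [hxk]; exact add_sub_cancel_right (k w) ((r : ℂ) • w)
  rw [e]
  refine ⟨apply_mem_of_mem_compactLipSelfAdjoint hk w, (hT.norm_val_le_diracNorm hk w).trans ?_⟩
  rw [← hL]
  exact mul_le_one₀ hx (norm_nonneg w) hw

theorem isLipNorm_lipC (hT : IsToeplitzQuadruple W 𝒜 A D) :
    OrderUnitSpace.IsLipNorm (lipC W D) := by
  refine isOperatorSpace_spaceC.isLipNorm hT.totallyBounded_graph_ball
    (fun x hx => hT.mem_graph_ball_of_lipC_le_one hx) (fun x y => ?_) (fun c x => ?_) fun x => ?_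
  · obtain ⟨k, hk, r, hx, hLx⟩ := hT.exists_lipC_eq x
    obtain ⟨l, hl, s, hy, hLy⟩ := hT.exists_lipC_eq y
    rw [hLx, hLy, hT.lipC_eq (x := x + y) (add_mem hk hl) (r := r + s) (by
      show (x : W →L[ℂ] W) + y = _
      have e : (((r + s : ℝ) : ℂ)) • (1 : W →L[ℂ] W) = (r : ℂ) • 1 + (s : ℂ) • 1 := by
        rw [Complex.ofReal_add]; exact add_smul (r : ℂ) s (1 : W →L[ℂ] W)
      rw [hx, hy, e]
      exact add_add_add_comm _ _ _ _)]
    exact hT.diracNorm_add_le hk hl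
  · obtain ⟨k, hk, r, hx, hLx⟩ := hT.exists_lipC_eq x
    rw [hLx, hT.lipC_eq (x := c • x) ((compactLipSelfAdjoint W D).smul_mem c hk) (r := c * r) (by
      show (c : ℂ) • (x : W →L[ℂ] W) = (c : ℂ) • k + _
      rw [hx, Complex.ofReal_mul, mul_smul]
      exact smul_add (c : ℂ) k ((r : ℂ) • (1 : W →L[ℂ] W)))]
    exact hT.diracNorm_smul hk c
  · obtain ⟨k, hk, r, hx, hLx⟩ := hT.exists_lipC_eq x
    rw [hLx]
    constructor
    · intro h
      refine ⟨r, Subtype.ext ?_⟩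
      rw [hx, hT.eq_zero_of_diracNorm_eq_zero hk h, zero_add]; rfl
    · rintro ⟨s, hs⟩
      have e : (x : W →L[ℂ] W) = 0 + (s : ℂ) • (1 : W →L[ℂ] W) := by
        rw [zero_add, hs]; rfl
      rw [← hLx, hT.lipC_eq (compactLipSelfAdjoint W D).zero_mem e]
      refine le_antisymm (hT.diracNorm_le (compactLipSelfAdjoint W D).zero_mem le_rfl fun w => ?_)
        diracNorm_nonneg
      show ‖D.val 0‖ ≤ _
      rw [LinearPMap.val_zero, norm_zero, zero_mul]

theorem norm_le_lipC_mul_stateDiam (hT : IsToeplitzQuadruple W 𝒜 A D) {k : spaceC W D}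
    (hk : IsCompactOperator (k : W →L[ℂ] W)) :
    ‖(k : W →L[ℂ] W)‖ ≤ lipC W D k * (OrderUnitSpace.stateDiam (lipC W D)).toReal := by
  have hdec : ∀ x : spaceC W D, ∃ k : W →L[ℂ] W, IsCompactOperator k ∧
      ∃ r : ℝ, (x : W →L[ℂ] W) = k + (r : ℂ) • (1 : W →L[ℂ] W) := fun x => by
    obtain ⟨k, hk, r, hx⟩ := mem_spaceC_iff.1 x.2
    exact ⟨k, isCompactOperator_of_mem hk, r, hx⟩
  exact isOperatorSpace_spaceC.norm_compact_le hT.smul_one_eq_zero hdec hT.isLipNorm_lipC hk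

/-! ### The commutators of the extension -/

/-- The boundedness of `[P D, a]`, written out on the domain of `[D, a]`. -/
theorem norm_proj_commutator_le (hT : IsToeplitzQuadruple W 𝒜 A D) {a : H →L[ℂ] H} (ha : a ∈ A) :
    ∃ M : ℝ, 0 ≤ M ∧ ∀ x ∈ (D.commutator a).domain,
      ‖W.starProjection (D.val (a x)) - a (W.starProjection (D.val x))‖ ≤ M * ‖x‖ := by
  refine ⟨(((W.starProjection : H →ₗ[ℂ] H).compPMap D).commutator a).opNorm,
    LinearPMap.opNorm_nonneg, fun x hx => ?_⟩
  obtain ⟨hx₁, hx₂⟩ : a x ∈ D.domain ∧ x ∈ D.domain := hx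
  have h := LinearPMap.IsBounded.le_opNorm (hT.regular_left a ha) (x := x) ⟨hx₁, hx₂⟩
  have e : (((W.starProjection : H →ₗ[ℂ] H).compPMap D).commutator a).val x =
      W.starProjection (D.val (a x)) - a (W.starProjection (D.val x)) :=
    (LinearPMap.val_commutator (T := (W.starProjection : H →ₗ[ℂ] H).compPMap D) hx₁ hx₂).trans
      (congrArg₂ (fun u v => u - a v) (LinearPMap.val_compPMap _ hx₁)
        (LinearPMap.val_compPMap _ hx₂))
  rwa [e] at h

/-- The operator `D P a - a D` is bounded on the vectors of `PH` where it is defined, even outside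
the domain of `[D, a]`: it is contained in the negative of the adjoint of `[P D, a]`. -/
theorem norm_val_proj_sub_le (hT : IsToeplitzQuadruple W 𝒜 A D) {a : H →L[ℂ] H} (ha : a ∈ spaceA A)
    {M : ℝ} (hM : 0 ≤ M) (h : ∀ x ∈ (D.commutator a).domain,
      ‖W.starProjection (D.val (a x)) - a (W.starProjection (D.val x))‖ ≤ M * ‖x‖) {w : W}
    (hw : (w : H) ∈ D.domain) (hPw : W.starProjection (a w) ∈ D.domain) :
    ‖D.val (W.starProjection (a w)) - a (D.val w)‖ ≤ M * ‖w‖ := by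
  have hs : ∀ u v : H, inner ℂ (a u) v = inner ℂ u (a v) :=
    fun u v => (ContinuousLinearMap.isSelfAdjoint_iff_isSymmetric.1 ha.2) u v
  have hP : ∀ u v : H, inner ℂ (W.starProjection u) v = inner ℂ u (W.starProjection v) :=
    fun u v => W.inner_starProjection_left_eq_right u v
  have hPP : ∀ v : H, inner ℂ (w : H) (W.starProjection v) = inner ℂ (w : H) v := fun v => by
    rw [← hP, W.starProjection_eq_self_iff.2 w.2]
  refine LinearPMap.norm_le_of_forall_inner_le (mul_nonneg hM (norm_nonneg w))
    (hT.commutator_dense a ha.1) fun z hz => ?_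
  obtain ⟨hz₁, hz₂⟩ : a z ∈ D.domain ∧ z ∈ D.domain := hz
  have e : inner ℂ (D.val (W.starProjection (a w)) - a (D.val w)) z =
      -inner ℂ (w : H) (W.starProjection (D.val (a z)) - a (W.starProjection (D.val z))) := by
    rw [inner_sub_left, inner_sub_right, hT.isFormalAdjoint.inner_val hPw hz₂, hP, hs, hs,
      hT.isFormalAdjoint.inner_val hw hz₁, hPP]
    ring
  rw [e, norm_neg]
  calc _ ≤ ‖(w : H)‖ * ‖W.starProjection (D.val (a z)) - a (W.starProjection (D.val z))‖ :=
        norm_inner_le_norm _ _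
    _ ≤ ‖(w : H)‖ * (M * ‖z‖) := mul_le_mul_of_nonneg_left (h z ⟨hz₁, hz₂⟩) (norm_nonneg _)
    _ = M * ‖w‖ * ‖z‖ := by rw [Submodule.coe_norm]; ring

section Commutator

variable {a : H →L[ℂ] H} {k : W →L[ℂ] W} {α β : ℝ}

/-- In the first component only `P a x` has to lie in `dom D`, not `a x`. -/
theorem mem_domain_commutator_extDirac (hT : IsToeplitzQuadruple W 𝒜 A D) (ha : a ∈ spaceA A)
    (hk : k ∈ compactLipSelfAdjoint W D) {x : ExtSpace W} :
    x ∈ ((extDirac W D α β).commutator (piMap W 𝒜 (toeplitzMap W a + k))).domain ↔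
      ((x.fst : H) ∈ D.domain ∧ W.starProjection (a x.fst) ∈ D.domain) ∧
        x.snd ∈ (D.commutator a).domain := by
  rw [LinearPMap.mem_commutator_domain, hT.mem_extDirac_domain, hT.mem_extDirac_domain,
    hT.piMap_toeplitzMap_add ha hk, LinearPMap.mem_commutator_domain]
  have e : (W.starProjection (a x.fst) + (k x.fst : H) ∈ D.domain) ↔
      W.starProjection (a x.fst) ∈ D.domain :=
    D.domain.add_mem_iff_left (apply_mem_of_mem_compactLipSelfAdjoint hk x.fst)
  show ((W.starProjection (a x.fst) + (k x.fst : H) ∈ D.domain) ∧ a x.snd ∈ D.domain) ∧ _ ↔ _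
  rw [e]
  tauto

/-- The matrix of `[D_{α,β}, π(T(a) + k)]` with respect to `K = PH ⊕ H`. -/
theorem val_commutator_extDirac (hT : IsToeplitzQuadruple W 𝒜 A D) (ha : a ∈ spaceA A)
    (hk : k ∈ compactLipSelfAdjoint W D) {x : ExtSpace W} (h₁ : (x.fst : H) ∈ D.domain)
    (h₂ : W.starProjection (a x.fst) ∈ D.domain) (h₃ : x.snd ∈ (D.commutator a).domain) :
    ((extDirac W D α β).commutator (piMap W 𝒜 (toeplitzMap W a + k))).val x = WithLp.toLp 2
      ((β : ℂ) • (W.orthogonalProjectionOnto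
          (W.starProjection (D.val (a x.snd)) - a (W.starProjection (D.val x.snd))) -
          k (W.orthogonalProjectionOnto (D.val x.snd))),
        (β : ℂ) • (D.val (W.starProjection (a x.fst)) - a (D.val x.fst) + D.val (k x.fst)) +
          ((α⁻¹ : ℝ) : ℂ) • (D.val (a x.snd) - a (D.val x.snd))) := by
  obtain ⟨h₄, h₅⟩ : a x.snd ∈ D.domain ∧ x.snd ∈ D.domain := h₃
  have hkx := apply_mem_of_mem_compactLipSelfAdjoint hk x.fst
  obtain ⟨m₁, m₂⟩ : piMap W 𝒜 (toeplitzMap W a + k) x ∈ (extDirac W D α β).domain ∧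
      x ∈ (extDirac W D α β).domain := (hT.mem_domain_commutator_extDirac (α := α) (β := β) ha hk).2
    ⟨⟨h₁, h₂⟩, (⟨h₄, h₅⟩ : x.snd ∈ (D.commutator a).domain)⟩
  have m₃ : ((piMap W 𝒜 (toeplitzMap W a + k) x).fst : H) ∈ D.domain :=
    (hT.mem_extDirac_domain.1 m₁).1
  have m₄ : (piMap W 𝒜 (toeplitzMap W a + k) x).snd ∈ D.domain := (hT.mem_extDirac_domain.1 m₁).2
  rw [LinearPMap.val_commutator m₁ m₂, hT.extDirac_val m₃ m₄, hT.extDirac_val h₁ h₅,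
    hT.piMap_toeplitzMap_add ha hk, hT.piMap_toeplitzMap_add ha hk]
  refine (WithLp.ofLp_injective 2) (Prod.ext ?_ ?_)
  · show (β : ℂ) • W.orthogonalProjectionOnto (D.val (a x.snd)) -
        (W.orthogonalProjectionOnto
          (a (((β : ℂ) • W.orthogonalProjectionOnto (D.val x.snd) : W) : H)) +
          k ((β : ℂ) • W.orthogonalProjectionOnto (D.val x.snd))) = (β : ℂ) • _
    have e : W.orthogonalProjectionOnto (W.starProjection (D.val (a x.snd))) =
        W.orthogonalProjectionOnto (D.val (a x.snd)) :=
      W.orthogonalProjectionOnto_mem_subspace_eq_self _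
    rw [Submodule.coe_smul, map_smul, map_smul, map_smul, map_sub, e, smul_sub, smul_sub,
      sub_sub]
    rfl
  · show (β : ℂ) • D.val (W.starProjection (a x.fst) + (k x.fst : H)) +
        ((α⁻¹ : ℝ) : ℂ) • D.val (a x.snd) -
        a ((β : ℂ) • D.val x.fst + ((α⁻¹ : ℝ) : ℂ) • D.val x.snd) = _
    rw [LinearPMap.val_add h₂ hkx, map_add, map_smul, map_smul]
    show _ = (β : ℂ) • (D.val (W.starProjection (a x.fst)) - a (D.val x.fst) + D.val (k x.fst)) +
          ((α⁻¹ : ℝ) : ℂ) • (D.val (a x.snd) - a (D.val x.snd))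
    simp only [smul_add, smul_sub]
    abel

theorem isBounded_commutator_extDirac (hT : IsToeplitzQuadruple W 𝒜 A D) (hα : 0 < α) (hβ : 0 < β)
    {t : W →L[ℂ] W} (ht : t ∈ spaceT W A D) :
    ((extDirac W D α β).commutator (piMap W 𝒜 t)).IsBounded := by
  obtain ⟨a, ha, k, hk, rfl⟩ := hT.mem_spaceT_iff.1 ht
  obtain ⟨M, hM, hMa⟩ := hT.norm_proj_commutator_le ha.1
  have hN : 0 ≤ diracNorm D k := diracNorm_nonneg
  refine LinearPMap.isBounded_iff.2 ⟨β * (M + diracNorm D k) + (β * (M + diracNorm D k) +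
    α⁻¹ * (D.commutator a).opNorm), fun x hx => ?_⟩
  obtain ⟨⟨h₁, h₂⟩, h₃⟩ := (hT.mem_domain_commutator_extDirac ha hk).1 hx
  have h₄ : a x.snd ∈ D.domain := h₃.1
  have h₅ : x.snd ∈ D.domain := h₃.2
  have hc := (hT.commutator_bounded a ha.1).le_opNorm h₃
  rw [LinearPMap.val_commutator h₄ h₅] at hc
  have hx1 : ‖x.fst‖ ≤ ‖x‖ := WithLp.norm_fst_le _ x
  have hx2 : ‖x.snd‖ ≤ ‖x‖ := WithLp.norm_snd_le _ x
  rw [hT.val_commutator_extDirac ha hk h₁ h₂ h₃, add_mul]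
  refine (WithLp.norm_le_norm_fst_add_norm_snd _).trans (add_le_add ?_ ?_)
  · show ‖(β : ℂ) • (_ - _ : W)‖ ≤ _
    rw [norm_smul, Complex.norm_real, Real.norm_of_nonneg hβ.le, mul_assoc]
    refine mul_le_mul_of_nonneg_left ((norm_sub_le _ _).trans ?_) hβ.le
    rw [add_mul]
    refine add_le_add (((W.norm_orthogonalProjectionOnto_apply_le _).trans (hMa _ h₃)).trans ?_)
      ((hT.norm_apply_proj_val_le hk h₅).trans ?_)
    · exact mul_le_mul_of_nonneg_left hx2 hM
    · exact mul_le_mul_of_nonneg_left hx2 hN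
  · refine (norm_add_le _ _).trans ?_
    rw [norm_smul, norm_smul, Complex.norm_real, Complex.norm_real, Real.norm_of_nonneg hβ.le,
      Real.norm_of_nonneg (inv_pos.2 hα).le, add_mul, mul_assoc, mul_assoc]
    refine add_le_add (mul_le_mul_of_nonneg_left ((norm_add_le _ _).trans ?_) hβ.le)
      (mul_le_mul_of_nonneg_left (hc.trans ?_) (inv_pos.2 hα).le)
    · rw [add_mul]
      exact add_le_add ((hT.norm_val_proj_sub_le ha hM hMa h₁ h₂).trans
        (mul_le_mul_of_nonneg_left hx1 hM))
        ((hT.norm_val_le_diracNorm hk x.fst).trans (mul_le_mul_of_nonneg_left hx1 hN))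
    · exact mul_le_mul_of_nonneg_left hx2 LinearPMap.opNorm_nonneg

end Commutator

/-! ### Density of common domains -/

theorem dense_commutator_inf (hT : IsToeplitzQuadruple W 𝒜 A D) {a b : H →L[ℂ] H} (ha : a ∈ A)
    (hb : b ∈ A) :
    Dense (((D.commutator a).domain ⊓ (D.commutator b).domain : Submodule ℂ H) : Set H) := by
  set S : Submodule ℂ H := (D.commutator a).domain ⊓ (D.commutator b).domain
  have h₁ : ∀ w : W, (w : H) ∈ S.topologicalClosure := fun w =>
    map_mem_closure continuous_subtype_val (hT.dense_left a ha b hb w) fun _ hx => hx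
  have h₂ : ∀ w : Wᗮ, (w : H) ∈ S.topologicalClosure := fun w =>
    map_mem_closure continuous_subtype_val (hT.dense_right a ha b hb w) fun _ hx => hx
  intro x
  have h := S.topologicalClosure.add_mem (h₁ (W.orthogonalProjectionOnto x))
    (h₂ (Wᗮ.orthogonalProjectionOnto x))
  have e : W.starProjection x + Wᗮ.starProjection x = x :=
    W.starProjection_add_starProjection_orthogonal x
  have h' : W.starProjection x + Wᗮ.starProjection x ∈ S.topologicalClosure := h
  rw [e] at h'
  exact h'

variable {α β : ℝ}

theorem dense_commutator_extDirac_inf (hT : IsToeplitzQuadruple W 𝒜 A D) {s t : W →L[ℂ] W}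
    (hs : s ∈ spaceT W A D) (ht : t ∈ spaceT W A D) :
    Dense ((((extDirac W D α β).commutator (piMap W 𝒜 s)).domain ⊓
      ((extDirac W D α β).commutator (piMap W 𝒜 t)).domain : Submodule ℂ (ExtSpace W)) :
      Set (ExtSpace W)) := by
  obtain ⟨a, ha, k, hk, rfl⟩ := hT.mem_spaceT_iff.1 hs
  obtain ⟨b, hb, l, hl, rfl⟩ := hT.mem_spaceT_iff.1 ht
  have h := ((hT.dense_left a ha.1 b hb.1).prod (hT.dense_commutator_inf ha.1 hb.1)).preimage
    (WithLp.prodContinuousLinearEquiv 2 ℂ W H).toHomeomorph.isOpenMap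
  refine h.mono ?_
  rintro x ⟨h₁, h₂⟩
  obtain ⟨⟨h₃, h₄⟩, ⟨h₅, -⟩⟩ : (a x.fst ∈ D.domain ∧ (x.fst : H) ∈ D.domain) ∧
    (b x.fst ∈ D.domain ∧ (x.fst : H) ∈ D.domain) := h₁
  obtain ⟨h₆, h₇⟩ : x.snd ∈ (D.commutator a).domain ∧ x.snd ∈ (D.commutator b).domain := h₂
  exact ⟨(hT.mem_domain_commutator_extDirac ha hk).2 ⟨⟨h₄, hT.proj_mem h₃⟩, h₆⟩,
    (hT.mem_domain_commutator_extDirac hb hl).2 ⟨⟨h₄, hT.proj_mem h₅⟩, h₇⟩⟩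

/-! ### The Lip-norm of the extension -/

theorem lipT_add_le (hT : IsToeplitzQuadruple W 𝒜 A D) (hα : 0 < α) (hβ : 0 < β)
    (s t : spaceT W A D) :
    lipT W 𝒜 A D α β (s + t) ≤ lipT W 𝒜 A D α β s + lipT W 𝒜 A D α β t := by
  have e : piMap W 𝒜 ((s + t : spaceT W A D) : W →L[ℂ] W) = piMap W 𝒜 s + piMap W 𝒜 t :=
    hT.piMap_add s.2 t.2
  rw [lipT, e]
  exact (hT.extDirac_isFormalAdjoint α β).opNorm_commutator_add_le (hT.isSelfAdjoint_piMap s.2)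
    (hT.isSelfAdjoint_piMap t.2) (hT.isBounded_commutator_extDirac hα hβ s.2)
    (hT.isBounded_commutator_extDirac hα hβ t.2) (hT.dense_commutator_extDirac_inf s.2 t.2)

theorem lipT_smul (hT : IsToeplitzQuadruple W 𝒜 A D) (hα : 0 < α) (hβ : 0 < β) (r : ℝ)
    (t : spaceT W A D) : lipT W 𝒜 A D α β (r • t) = |r| * lipT W 𝒜 A D α β t := by
  have e : piMap W 𝒜 ((r • t : spaceT W A D) : W →L[ℂ] W) = (r : ℂ) • piMap W 𝒜 t :=
    hT.piMap_smul r t.2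
  rw [lipT, e, (hT.isBounded_commutator_extDirac hα hβ t.2).opNorm_commutator_smul,
    Complex.norm_real, Real.norm_eq_abs]
  rfl

section Estimates

variable {a : H →L[ℂ] H} {k : W →L[ℂ] W}

/-- The lower right entry of `[D_{α,β}, π(T(a) + k)]` is `α⁻¹ [D, a]`. -/
theorem opNorm_commutator_le (hT : IsToeplitzQuadruple W 𝒜 A D) (hα : 0 < α) (hβ : 0 < β)
    (ha : a ∈ spaceA A) (hk : k ∈ compactLipSelfAdjoint W D) :
    (D.commutator a).opNorm ≤
      α * ((extDirac W D α β).commutator (piMap W 𝒜 (toeplitzMap W a + k))).opNorm := by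
  refine LinearPMap.opNorm_le (mul_nonneg hα.le LinearPMap.opNorm_nonneg) fun y hy => ?_
  have m₁ : (((WithLp.toLp 2 ((0 : W), y) : ExtSpace W).fst : W) : H) ∈ D.domain :=
    D.domain.zero_mem
  have m₂ : W.starProjection (a ((WithLp.toLp 2 ((0 : W), y) : ExtSpace W).fst : W)) ∈
      D.domain := by
    show W.starProjection (a ((0 : W) : H)) ∈ D.domain
    rw [Submodule.coe_zero, map_zero, map_zero]
    exact D.domain.zero_mem
  have h := LinearPMap.IsBounded.le_opNorm (hT.isBounded_commutator_extDirac hα hβ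
    (hT.mem_spaceT_iff.2 ⟨a, ha, k, hk, rfl⟩))
    ((hT.mem_domain_commutator_extDirac ha hk).2 ⟨⟨m₁, m₂⟩, hy⟩)
  rw [hT.val_commutator_extDirac ha hk m₁ m₂ hy, WithLp.norm_toLp_snd] at h
  replace h := (WithLp.norm_snd_le _ _).trans h
  have e : (β : ℂ) • (D.val (W.starProjection (a ((0 : W) : H))) - a (D.val ((0 : W) : H)) +
      D.val (k 0)) + ((α⁻¹ : ℝ) : ℂ) • (D.val (a y) - a (D.val y)) =
      ((α⁻¹ : ℝ) : ℂ) • (D.commutator a).val y := by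
    rw [LinearPMap.val_commutator hy.1 hy.2]
    simp [LinearPMap.val_zero]
  have h' : ‖((α⁻¹ : ℝ) : ℂ) • (D.commutator a).val y‖ ≤ _ := (congrArg norm e).symm.trans_le h
  rw [norm_smul, Complex.norm_real, Real.norm_of_nonneg (inv_pos.2 hα).le,
    inv_mul_le_iff₀ hα, ← mul_assoc] at h'
  exact h'

/-- The compression to `PH` of the entry `β (D T(a) - a D + D k)` is `β (P [D, a] + D k)`. -/
theorem mul_diracNorm_le (hT : IsToeplitzQuadruple W 𝒜 A D) (hα : 0 < α) (hβ : 0 < β)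
    (ha : a ∈ spaceA A) (hk : k ∈ compactLipSelfAdjoint W D) :
    β * diracNorm D k ≤ (1 + α * β) *
      ((extDirac W D α β).commutator (piMap W 𝒜 (toeplitzMap W a + k))).opNorm := by
  have hb := hT.isBounded_commutator_extDirac hα hβ (hT.mem_spaceT_iff.2 ⟨a, ha, k, hk, rfl⟩)
  have hA := hT.opNorm_commutator_le hα hβ ha hk
  set L := ((extDirac W D α β).commutator (piMap W 𝒜 (toeplitzMap W a + k))).opNorm
  have hL : 0 ≤ L := LinearPMap.opNorm_nonneg
  rw [mul_comm, ← le_div_iff₀ hβ]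
  refine hT.diracNorm_le hk (by positivity) fun w => ?_
  -- it suffices to consider `w ∈ dom [D, a]`, as these are dense in `PH`
  have hcl : IsClosed {w : W | ‖D.val (k w)‖ ≤ (1 + α * β) * L / β * ‖w‖} :=
    isClosed_le (hT.continuous_val_apply hk).norm (by fun_prop)
  refine hcl.closure_subset_iff.2 (fun w hw => ?_) (hT.dense_left a ha.1 a ha.1 w)
  obtain ⟨⟨h₁, h₂⟩, -⟩ : (a w ∈ D.domain ∧ (w : H) ∈ D.domain) ∧ _ := hw
  have m₃ : (WithLp.toLp 2 (w, (0 : H)) : ExtSpace W).snd ∈ (D.commutator a).domain :=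
    (D.commutator a).domain.zero_mem
  have m₁ : (((WithLp.toLp 2 (w, (0 : H)) : ExtSpace W).fst : W) : H) ∈ D.domain := h₂
  have m₂ : W.starProjection (a ((WithLp.toLp 2 (w, (0 : H)) : ExtSpace W).fst : W)) ∈ D.domain :=
    hT.proj_mem h₁
  have h := hb.le_opNorm ((hT.mem_domain_commutator_extDirac ha hk).2 ⟨⟨m₁, m₂⟩, m₃⟩)
  rw [hT.val_commutator_extDirac ha hk m₁ m₂ m₃, WithLp.norm_toLp_fst] at h
  replace h := (WithLp.norm_snd_le _ _).trans h
  set v := D.val (W.starProjection (a w)) - a (D.val w) + D.val (k w) with hv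
  have h' : ‖(β : ℂ) • v‖ ≤ L * ‖w‖ := by
    refine le_of_eq_of_le (congrArg norm ?_) h
    show _ = (β : ℂ) • v + ((α⁻¹ : ℝ) : ℂ) • (D.val (a 0) - a (D.val 0))
    simp [LinearPMap.val_zero]
  rw [norm_smul, Complex.norm_real, Real.norm_of_nonneg hβ.le] at h'
  have e : D.val (k w) = W.starProjection v - W.starProjection ((D.commutator a).val w) := by
    have hPP : ∀ x, W.starProjection (W.starProjection x) = W.starProjection x := fun x =>
      W.starProjection_eq_self_iff.2 (W.starProjection_apply_mem x)
    rw [hv, LinearPMap.val_commutator h₁ h₂, hT.val_proj h₁, map_add, map_sub, map_sub, hPP,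
      hT.proj_val_coe (apply_mem_of_mem_compactLipSelfAdjoint hk w)]
    abel
  have hc : ‖(D.commutator a).val w‖ ≤ α * L * ‖w‖ :=
    ((hT.commutator_bounded a ha.1).le_opNorm ⟨h₁, h₂⟩).trans
      (mul_le_mul_of_nonneg_right hA (norm_nonneg _))
  have hP : ∀ x, ‖W.starProjection x‖ ≤ ‖x‖ := W.norm_starProjection_apply_le
  show ‖D.val (k w)‖ ≤ (1 + α * β) * L / β * ‖w‖
  rw [div_mul_eq_mul_div, le_div_iff₀ hβ, e]
  calc _ ≤ (‖v‖ + ‖(D.commutator a).val w‖) * β := by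
        refine mul_le_mul_of_nonneg_right ((norm_sub_le _ _).trans ?_) hβ.le
        exact add_le_add (hP _) (hP _)
    _ = β * ‖v‖ + β * ‖(D.commutator a).val w‖ := by ring
    _ ≤ L * ‖w‖ + β * (α * L * ‖w‖) := by gcongr
    _ = _ := by ring

/-- On `k + λ I` the commutator is off-diagonal with entries `-β k D_p P` and `β D_p k`. -/
theorem opNorm_commutator_extDirac_le (hT : IsToeplitzQuadruple W 𝒜 A D) (hβ : 0 < β)
    (hk : k ∈ compactLipSelfAdjoint W D) (r : ℝ) :
    ((extDirac W D α β).commutator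
      (piMap W 𝒜 (toeplitzMap W (r • (1 : H →L[ℂ] H)) + k))).opNorm ≤ β * diracNorm D k := by
  have hN : 0 ≤ diracNorm D k := diracNorm_nonneg
  have ha : r • (1 : H →L[ℂ] H) ∈ spaceA A :=
    (spaceA A).smul_mem r ⟨A.one_mem, IsSelfAdjoint.one _⟩
  refine LinearPMap.opNorm_le (by positivity) fun x hx => ?_
  obtain ⟨⟨h₁, h₂⟩, h₃⟩ := (hT.mem_domain_commutator_extDirac ha hk).1 hx
  have h₅ : x.snd ∈ D.domain := h₃.2
  rw [hT.val_commutator_extDirac ha hk h₁ h₂ h₃]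
  have hr : ∀ y : H, (r • (1 : H →L[ℂ] H)) y = (r : ℂ) • y := fun y => (Complex.coe_smul r y).symm
  have e₁ : W.starProjection (D.val ((r • (1 : H →L[ℂ] H)) x.snd)) -
      (r • (1 : H →L[ℂ] H)) (W.starProjection (D.val x.snd)) = 0 := by
    rw [hr, hr, LinearPMap.val_smul _ h₅, map_smul, sub_self]
  have e₂ : D.val (W.starProjection ((r • (1 : H →L[ℂ] H)) (x.fst : H))) -
      (r • (1 : H →L[ℂ] H)) (D.val (x.fst : H)) = 0 := by
    rw [hr, hr, map_smul, W.starProjection_eq_self_iff.2 x.fst.2, LinearPMap.val_smul _ h₁,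
      sub_self]
  have e₃ : D.val ((r • (1 : H →L[ℂ] H)) x.snd) - (r • (1 : H →L[ℂ] H)) (D.val x.snd) = 0 := by
    rw [hr, hr, LinearPMap.val_smul _ h₅, sub_self]
  rw [e₁, e₂, e₃, smul_zero, add_zero, zero_add, map_zero, zero_sub]
  refine le_of_sq_le_sq ?_ (by positivity)
  rw [WithLp.prod_norm_sq_eq_of_L2, mul_pow, WithLp.prod_norm_sq_eq_of_L2 x, mul_add, add_comm]
  have f₁ : ‖(β : ℂ) • D.val (k x.fst : H)‖ ≤ β * diracNorm D k * ‖x.fst‖ := by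
    rw [norm_smul, Complex.norm_real, Real.norm_of_nonneg hβ.le, mul_assoc]
    exact mul_le_mul_of_nonneg_left (hT.norm_val_le_diracNorm hk _) hβ.le
  have f₂ : ‖(β : ℂ) • -k (W.orthogonalProjectionOnto (D.val x.snd))‖ ≤
      β * diracNorm D k * ‖x.snd‖ := by
    rw [norm_smul, norm_neg, Complex.norm_real, Real.norm_of_nonneg hβ.le, mul_assoc]
    exact mul_le_mul_of_nonneg_left (hT.norm_apply_proj_val_le hk h₅) hβ.le
  refine add_le_add ?_ ?_
  · rw [← mul_pow]
    exact pow_le_pow_left₀ (norm_nonneg _) f₁ 2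
  · rw [← mul_pow]
    exact pow_le_pow_left₀ (norm_nonneg _) f₂ 2

end Estimates

/-! ### The comparison -/

theorem spaceC_le_spaceT (hT : IsToeplitzQuadruple W 𝒜 A D) : spaceC W D ≤ spaceT W A D := by
  intro x hx
  obtain ⟨k, hk, r, rfl⟩ := mem_spaceC_iff.1 hx
  refine hT.mem_spaceT_iff.2 ⟨r • (1 : H →L[ℂ] H),
    (spaceA A).smul_mem r ⟨A.one_mem, IsSelfAdjoint.one _⟩, k, hk, ?_⟩
  rw [← Complex.coe_smul, map_smul, toeplitzMap_one, add_comm]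

theorem lipT_le_mul_lipC (hT : IsToeplitzQuadruple W 𝒜 A D) (hβ : 0 < β) (x : spaceC W D) :
    lipT W 𝒜 A D α β ⟨x, hT.spaceC_le_spaceT x.2⟩ ≤ β * lipC W D x := by
  obtain ⟨k, hk, r, hx, hL⟩ := hT.exists_lipC_eq x
  have e : (x : W →L[ℂ] W) = toeplitzMap W (r • (1 : H →L[ℂ] H)) + k := by
    rw [← Complex.coe_smul, map_smul, toeplitzMap_one, hx, add_comm]
  rw [hL, lipT]
  show ((extDirac W D α β).commutator (piMap W 𝒜 (x : W →L[ℂ] W))).opNorm ≤ _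
  rw [e]
  exact hT.opNorm_commutator_extDirac_le hβ hk r

theorem exists_decomposition (hT : IsToeplitzQuadruple W 𝒜 A D) (hα : 0 < α) (hβ : 0 < β)
    (t : spaceT W A D) : ∃ (a : spaceA A) (k : spaceC W D), IsCompactOperator (k : W →L[ℂ] W) ∧
      (t : W →L[ℂ] W) = toeplitzMap W (a : H →L[ℂ] H) + k ∧
      lipA A D a ≤ α * lipT W 𝒜 A D α β t ∧
      β * lipC W D k ≤ (1 + α * β) * lipT W 𝒜 A D α β t := by
  obtain ⟨a, ha, k, hk, ht⟩ := hT.mem_spaceT_iff.1 t.2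
  have hkC : k ∈ spaceC W D := Submodule.mem_sup_left hk
  have hL : lipC W D ⟨k, hkC⟩ = diracNorm D k := hT.lipC_eq hk (r := 0)
    ((congrArg (k + ·) (zero_smul ℂ (1 : W →L[ℂ] W))).trans (add_zero k)).symm
  refine ⟨⟨a, ha⟩, ⟨k, hkC⟩, isCompactOperator_of_mem hk, ht, ?_, ?_⟩
  · rw [lipT, ht]; exact hT.opNorm_commutator_le hα hβ ha hk
  · rw [hL, lipT, ht]; exact hT.mul_diracNorm_le hα hβ ha hk

theorem lipT_eq_zero_iff (hT : IsToeplitzQuadruple W 𝒜 A D)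
    (hL : OrderUnitSpace.IsLipNorm (lipA A D)) (hα : 0 < α) (hβ : 0 < β) (t : spaceT W A D) :
    lipT W 𝒜 A D α β t = 0 ↔ ∃ r : ℝ, (t : W →L[ℂ] W) = r • (1 : W →L[ℂ] W) := by
  constructor
  · intro h
    obtain ⟨a, k, hk, ht, h₁, h₂⟩ := hT.exists_decomposition hα hβ t
    rw [h, mul_zero] at h₁ h₂
    obtain ⟨r, hr⟩ := (hL.eq_zero_iff a).1 (le_antisymm h₁ (hL.nonneg a))
    have hC := hT.isLipNorm_lipC
    have hk0 : lipC W D k = 0 := by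
      have := hC.nonneg k
      nlinarith
    have hkn := hT.norm_le_lipC_mul_stateDiam hk
    rw [hk0, zero_mul] at hkn
    replace hkn := (ContinuousLinearMap.opNorm_zero_iff _).1
      (hkn.antisymm (ContinuousLinearMap.opNorm_nonneg _))
    refine ⟨r, ?_⟩
    have har : (a : H →L[ℂ] H) = (r : ℂ) • 1 := by rw [hr]; rfl
    rw [ht, hkn, har, map_smul, toeplitzMap_one, add_zero]; rfl
  · rintro ⟨r, ht⟩
    have h1 : (1 : W →L[ℂ] W) ∈ spaceT W A D :=
      ⟨Submodule.mem_sup_left ⟨1, A.one_mem, toeplitzMap_one⟩, IsSelfAdjoint.one _⟩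
    rw [lipT, ht, hT.piMap_smul r h1, hT.piMap_one]
    exact LinearPMap.opNorm_commutator_smul_one _

theorem isExtension (hT : IsToeplitzQuadruple W 𝒜 A D) (hα : 0 < α) (hβ : 0 < β) :
    OrderUnitSpace.IsExtension (toeplitzMap W) (lipA A D) (lipC W D) (lipT W 𝒜 A D α β) α β :=
  ⟨toeplitzMap_one, norm_toeplitzMap_le, hT.exists_decomposition hα hβ⟩

theorem isLipNorm_and_quantumGHDist_le (hT : IsToeplitzQuadruple W 𝒜 A D)
    (hL : OrderUnitSpace.IsLipNorm (lipA A D)) (hα : 0 < α) (hβ : 0 < β) :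
    OrderUnitSpace.IsLipNorm (lipT W 𝒜 A D α β) ∧
      OrderUnitSpace.IsLipNorm (fun x => β * lipC W D x) ∧
      OrderUnitSpace.quantumGHDist (lipT W 𝒜 A D α β) (fun x => β * lipC W D x) ≤
        ENNReal.ofReal α *
          (OrderUnitSpace.stateDiam (lipA A D) + OrderUnitSpace.stateDiam (lipC W D)) :=
  (hT.isExtension hα hβ).isLipNorm_and_quantumGHDist_le hα hβ isOperatorSpace_spaceA
    isOperatorSpace_spaceC isOperatorSpace_spaceT hL hT.isLipNorm_lipC
    (fun _ hk => hT.norm_le_lipC_mul_stateDiam hk) (hT.lipT_add_le hα hβ) (hT.lipT_smul hα hβ)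
    (fun t => (hT.lipT_eq_zero_iff hL hα hβ t).trans
      (exists_congr fun _ => ⟨fun h => Subtype.ext h, fun h => congrArg Subtype.val h⟩))
    hT.spaceC_le_spaceT (hT.lipT_le_mul_lipC hβ)

end IsToeplitzQuadruple

end Toeplitz

end

theorem mainTheorem2 {H : Type*} [NormedAddCommGroup H] [InnerProductSpace ℂ H] [CompleteSpace H]
    (𝒜 A : StarSubalgebra ℂ (H →L[ℂ] H)) (D : H →ₗ.[ℂ] H)
    (W : Submodule ℂ H) [CompleteSpace W]
    (hT : IsToeplitzQuadruple W 𝒜 A D)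
    (hL : OrderUnitSpace.IsLipNorm (lipA A D))
    (β : ℝ) (hβ : 0 < β) :
    (∀ α : ℝ, 0 < α → α * β ≤ 1 →
      OrderUnitSpace.IsLipNorm (lipT W 𝒜 A D α β) ∧
      OrderUnitSpace.IsLipNorm (fun x => β * lipC W D x) ∧
      OrderUnitSpace.quantumGHDist (lipT W 𝒜 A D α β) (fun x => β * lipC W D x) ≤
        ENNReal.ofReal α *
          (OrderUnitSpace.stateDiam (lipA A D) + OrderUnitSpace.stateDiam (lipC W D))) ∧
    Tendsto (fun α : ℝ =>
        OrderUnitSpace.quantumGHDist (lipT W 𝒜 A D α β) (fun x => β * lipC W D x))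
      (𝓝[>] 0) (𝓝 0) := by
  refine ⟨fun α hα _ => hT.isLipNorm_and_quantumGHDist_le hL hα hβ, ?_⟩
  have hfin : OrderUnitSpace.stateDiam (lipA A D) + OrderUnitSpace.stateDiam (lipC W D) ≠ ⊤ :=
    ENNReal.add_ne_top.2 ⟨hL.stateDiam_ne_top, hT.isLipNorm_lipC.stateDiam_ne_top⟩
  have hlim : Tendsto (fun α : ℝ => ENNReal.ofReal α *
      (OrderUnitSpace.stateDiam (lipA A D) + OrderUnitSpace.stateDiam (lipC W D)))
      (𝓝[>] 0) (𝓝 0) := by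
    have h : Tendsto ENNReal.ofReal (𝓝[>] 0) (𝓝 0) := by
      simpa using (ENNReal.continuous_ofReal.tendsto 0).mono_left nhdsWithin_le_nhds
    simpa using ENNReal.Tendsto.mul_const h (Or.inr hfin)
  refine tendsto_of_tendsto_of_tendsto_of_le_of_le' tendsto_const_nhds hlim
    (Eventually.of_forall fun _ => zero_le) ?_
  filter_upwards [self_mem_nhdsWithin] with α hα
  exact (hT.isLipNorm_and_quantumGHDist_le hL hα hβ).2.2
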